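/- Let $I$ be a finite partially ordered set, $R=\mathbb{C}\{e_\alpha\mid\alpha\in I\}$ the algebra spanned by orthogonal idempotents with sum $1$, $M$ a finite-dimensional $R$-bimodule, $W\subset M\otimes_R M$ a sub-bimodule, and $A=T_R(M)/\langle W\rangle$, graded with $M$ in degree $1$. Put $\varepsilon_\alpha=\sum_{\gamma\not\le\alpha}e_\gamma$ and let $V_\alpha=e_\alpha A/e_\alpha A\varepsilon_\alpha A$ be the right-standard modules. Assume that $A$ is standard Koszul, that is: $A$ is finite-dimensional; $A$ is quasi-hereditary (with $L_\alpha$ the simple module at $\alpha$, the kernel of $V_\alpha\to L_\alpha$ is filtered by modules $L_\beta$ with $\beta<\alpha$, and the kernel of $e_\alpha A\to V_\alpha$ is filtered by modules $V_\gamma$ with $\gamma>\alpha$); and all right-standard and all left-standard modules have linear graded projective resolutions. Let $U$ be a finite-dimensional complex vector space and $S=\operatorname{Sym}U$ with $U$ in degree $2$. Let $\tilde A$ be a flat graded deformation of $A$ over $U^*$, i.e. an $\mathbb{N}$-graded $R$-algebra, flat over $S$, with graded homomorphisms $S\to\tilde A\to A$ of which the first is central and the second induces $\tilde A/\langle U\rangle\cong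 A$ (compatibly with $R$). Let $\tilde V_\alpha=e_\alpha\tilde A/e_\alpha\tilde A\varepsilon_\alpha\tilde A$, let $K$ be the fraction field of $S$, and write $N^\infty=N\otimes_S K$. Then there are unique $S$-algebra homomorphisms $h_\alpha:Z(\tilde A)\to S$ ($\alpha\in I$) with $v\cdot\zeta=h_\alpha(\zeta)v$ for all $v\in\tilde V_\alpha$ and $\zeta\in Z(\tilde A)$, and $\mathcal{Z}(\tilde A)=(U,Z(\tilde A),I,\oplus_\alpha h_\alpha)$ is a localization algebra, i.e. $Z(\tilde A)$ is a finitely generated graded $S$-algebra and $\oplus_\alpha h_\alpha:Z(\tilde A)\to\bigoplus_{\alpha\in I}S$ is a homomorphism of $S$-algebras. It is called strong if the kernel and the cokernel of $\oplus_\alpha h_\alpha$ are torsion $S$-modules, and free if $Z(\tilde A)$ is a free $S$-module of rank $|I|$. Call $\tilde A$ malleable if it satisfies the following conditions. 1. For every enumeration $\alpha_1,\dots,\alpha_n$ of $I$ in which each $\alpha_k$ is maximal in $\{\alpha_k,\dots,\alpha_n\}$, the deformed standard filtration of the right module $\tilde A^\infty$, induced by the ideals $\tilde A(e_{\alpha_1}+\dots+e_{\alpha_k})\tilde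 A$, splits. 2. The action map $\tilde A^\infty\to\bigoplus_\alpha\operatorname{End}_K(\tilde V_\alpha^\infty)$ is an isomorphism. 3. The map $\oplus_\alpha h_\alpha^\infty:Z(\tilde A)^\infty\to\bigoplus_\alpha K$ is an isomorphism. 4. The maps $h_\alpha$ $(\alpha\in I)$ are pairwise distinct. (a) If $A\cong A^{\mathrm{op}}$ as $R$-algebras, then $\mathcal{Z}(\tilde A)$ is a strong localization algebra if and only if $\tilde A$ is malleable. Moreover, in this case malleability is equivalent to each one of the conditions 1 (for any single enumeration as above), 2, 3, 4. (b) If $\tilde A$ is malleable and $\dim_{\mathbb{C}}Z(A)=|I|$, then $\mathcal{Z}(\tilde A)$ is a free localization algebra. -/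

import Mathlib

open scoped TensorProduct

namespace KoszulCenter

universe u v w

/-! ### Quadratic algebras over `R = I → ℂ` -/

section Quadratic

variable (I : Type u) [Fintype I] [DecidableEq I]
  (M : Type v) [AddCommGroup M] [Module ℂ M] [Module (I → ℂ) M] [Module (I → ℂ)ᵐᵒᵖ M]

/-- The relations presenting the tensor algebra `T_R(M)` of the `R`-bimodule `M`, where
`R = I → ℂ`, as a quotient of the tensor algebra over `ℂ` of `R × M`. -/
inductive BimoduleTensorRel :
    TensorAlgebra ℂ ((I → ℂ) × M) → TensorAlgebra ℂ ((I → ℂ) × M) → Prop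
  | one : BimoduleTensorRel (TensorAlgebra.ι ℂ ((1 : I → ℂ), (0 : M))) 1
  | mul (r s : I → ℂ) : BimoduleTensorRel
      (TensorAlgebra.ι ℂ (r, (0 : M)) * TensorAlgebra.ι ℂ (s, (0 : M)))
      (TensorAlgebra.ι ℂ (r * s, (0 : M)))
  | left (r : I → ℂ) (m : M) : BimoduleTensorRel
      (TensorAlgebra.ι ℂ (r, (0 : M)) * TensorAlgebra.ι ℂ ((0 : I → ℂ), m))
      (TensorAlgebra.ι ℂ ((0 : I → ℂ), r • m))
  | right (r : I → ℂ) (m : M) : BimoduleTensorRel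
      (TensorAlgebra.ι ℂ ((0 : I → ℂ), m) * TensorAlgebra.ι ℂ (r, (0 : M)))
      (TensorAlgebra.ι ℂ ((0 : I → ℂ), MulOpposite.op r • m))

/-- The tensor algebra `T_R(M) = R ⊕ M ⊕ (M ⊗_R M) ⊕ ⋯` of the `R`-bimodule `M`. -/
abbrev BimoduleTensorAlgebra : Type (max u v) := RingQuot (BimoduleTensorRel I M)

namespace BimoduleTensorAlgebra

/-- The structure map `R → T_R(M)`. -/
noncomputable def ofR : (I → ℂ) →ₗ[ℂ] BimoduleTensorAlgebra I M :=
  (RingQuot.mkAlgHom ℂ (BimoduleTensorRel I M)).toLinearMap ∘ₗ TensorAlgebra.ι ℂ ∘ₗ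
    LinearMap.inl ℂ (I → ℂ) M

/-- The inclusion `M → T_R(M)`. -/
noncomputable def ofM : M →ₗ[ℂ] BimoduleTensorAlgebra I M :=
  (RingQuot.mkAlgHom ℂ (BimoduleTensorRel I M)).toLinearMap ∘ₗ TensorAlgebra.ι ℂ ∘ₗ
    LinearMap.inr ℂ (I → ℂ) M

/-- The degree `k` part of `T_R(M)`, spanned by the products `r m₁ ⋯ mₖ`. -/
noncomputable def degree (k : ℕ) : Submodule ℂ (BimoduleTensorAlgebra I M) :=
  LinearMap.range (ofR I M) * LinearMap.range (ofM I M) ^ k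

end BimoduleTensorAlgebra

variable {I M}

/-- `W` is an `R`-sub-bimodule of `M ⊗_R M`, the degree two part of `T_R(M)`. -/
structure IsQuadraticRelations (W : Submodule ℂ (BimoduleTensorAlgebra I M)) : Prop where
  le_degree_two : W ≤ BimoduleTensorAlgebra.degree I M 2
  left_mem : ∀ (r : I → ℂ), ∀ x ∈ W, BimoduleTensorAlgebra.ofR I M r * x ∈ W
  right_mem : ∀ (r : I → ℂ), ∀ x ∈ W, x * BimoduleTensorAlgebra.ofR I M r ∈ W

/-- The quadratic algebra `A = T_R(M) / ⟨W⟩`. -/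
abbrev QuadAlgebra (W : Submodule ℂ (BimoduleTensorAlgebra I M)) : Type (max u v) :=
  RingQuot (fun x y : BimoduleTensorAlgebra I M => x ∈ W ∧ y = 0)

namespace QuadAlgebra

variable (W : Submodule ℂ (BimoduleTensorAlgebra I M))

/-- The projection `T_R(M) → A`. -/
noncomputable def mk : BimoduleTensorAlgebra I M →ₐ[ℂ] QuadAlgebra W :=
  RingQuot.mkAlgHom ℂ (fun x y : BimoduleTensorAlgebra I M => x ∈ W ∧ y = 0)

/-- The structure map `R → A`. -/
noncomputable def ofR : (I → ℂ) →ₗ[ℂ] QuadAlgebra W :=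
  (mk W).toLinearMap ∘ₗ BimoduleTensorAlgebra.ofR I M

/-- The idempotents `e_α` of `A`. -/
noncomputable def idem (α : I) : QuadAlgebra W := ofR W (Pi.single α 1)

/-- The degree `k` part of `A`. -/
noncomputable def degree (k : ℕ) : Submodule ℂ (QuadAlgebra W) :=
  (BimoduleTensorAlgebra.degree I M k).map (mk W).toLinearMap

end QuadAlgebra

end Quadratic

/-! ### Standard modules, quasi-hereditary and standard Koszul algebras

In this section `B` is a ring with idempotents `e α`.  Right `B`-modules are modules over `Bᵐᵒᵖ`;
in particular right ideals of `B` are elements of `Submodule Bᵐᵒᵖ B`. -/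

section Standard

variable {I : Type u} [Fintype I] [PartialOrder I] {B : Type w} [Ring B] (e : I → B)

open Classical in
/-- `ε_α`, the sum of the idempotents `e_γ` over `γ ≰ α`. -/
noncomputable def eps (α : I) : B := ∑ γ ∈ Finset.univ.filter (fun γ => ¬ γ ≤ α), e γ

/-- The right ideal `P_α = e_α B`. -/
def projective (α : I) : Submodule Bᵐᵒᵖ B := Submodule.span Bᵐᵒᵖ {e α}

/-- The right ideal `e_α B ε_α B`. -/
def upperPart (α : I) : Submodule Bᵐᵒᵖ B :=
  Submodule.span Bᵐᵒᵖ {x | ∃ b : B, x = e α * b * eps e α}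

/-- The right-standard module `V_α = e_α B / e_α B ε_α B`. -/
abbrev Standard (α : I) : Type w :=
  projective e α ⧸ (upperPart e α).submoduleOf (projective e α)

/-- The right module `X` has a finite filtration in which every subquotient is isomorphic to
`Y β` for some `β ∈ T`. -/
def HasFiltration (X : Type w) [AddCommGroup X] [Module Bᵐᵒᵖ X] (Y : I → Type w)
    [∀ β, AddCommGroup (Y β)] [∀ β, Module Bᵐᵒᵖ (Y β)] (T : Set I) : Prop :=
  ∃ (n : ℕ) (F : ℕ → Submodule Bᵐᵒᵖ X), F 0 = ⊥ ∧ F n = ⊤ ∧ Monotone F ∧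
    ∀ i < n, ∃ β ∈ T, Nonempty ((F (i + 1) ⧸ (F i).submoduleOf (F (i + 1))) ≃ₗ[Bᵐᵒᵖ] Y β)

variable [Algebra ℂ B] (𝒷 : ℕ → Submodule ℂ B)

/-- The right ideal `B_+ ⊕ ℂ{e_β | β ≠ α}`. -/
def simpleKernel (α : I) : Submodule Bᵐᵒᵖ B :=
  Submodule.span Bᵐᵒᵖ ({x | ∃ k, 0 < k ∧ x ∈ 𝒷 k} ∪ {x | ∃ β, β ≠ α ∧ x = e β})

/-- The simple right module `L_α = B / (B_+ ⊕ ℂ{e_β | β ≠ α})`. -/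
abbrev Simple (α : I) : Type w := B ⧸ simpleKernel e 𝒷 α

/-- The kernel of the natural surjection `π_α : V_α → L_α`: the image in `V_α` of the kernel of
`P_α ⊆ B → L_α`. -/
def standardRadical (α : I) : Submodule Bᵐᵒᵖ (Standard e α) :=
  ((simpleKernel e 𝒷 α).submoduleOf (projective e α)).map
    ((upperPart e α).submoduleOf (projective e α)).mkQ

/-- Quasi-heredity: the kernel of `V_α → L_α` is filtered by modules `L_β` with `β < α`, and the
kernel of `P_α → V_α` is filtered by modules `V_γ` with `γ > α`. -/
def IsQuasiHereditary : Prop :=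
  ∀ α : I,
    HasFiltration (B := B) (standardRadical e 𝒷 α) (Simple e 𝒷) {β | β < α} ∧
    HasFiltration (B := B) ((upperPart e α).submoduleOf (projective e α)) (Standard e)
      {γ | α < γ}

/-- `𝒩` makes the right `B`-module `N` a graded module over the graded algebra `B`. -/
structure IsGradedModule (N : Type w) [AddCommGroup N] [Module Bᵐᵒᵖ N]
    (𝒩 : ℕ → AddSubgroup N) : Prop where
  internal : DirectSum.IsInternal 𝒩
  smul_mem : ∀ i j, ∀ x ∈ 𝒩 i, ∀ b ∈ 𝒷 j, MulOpposite.op b • x ∈ 𝒩 (i + j)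

/-- A linear projective resolution `⋯ → Q₁ → Q₀ → N → 0` of the graded right `B`-module `N`:
`Q i` is a graded projective module generated in degree `i`, the maps preserve degrees, and the
augmented complex is exact. -/
structure LinearProjectiveResolution (N : Type w) [AddCommGroup N] [Module Bᵐᵒᵖ N]
    (𝒩 : ℕ → AddSubgroup N) where
  Q : ℕ → ModuleCat.{w} Bᵐᵒᵖ
  grading : ∀ i, ℕ → AddSubgroup (Q i)
  graded : ∀ i, IsGradedModule 𝒷 (Q i) (grading i)
  projective : ∀ i, Module.Projective Bᵐᵒᵖ (Q i)
  generated : ∀ i, Submodule.span Bᵐᵒᵖ (grading i i : Set (Q i)) = ⊤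
  d : ∀ i, Q (i + 1) →ₗ[Bᵐᵒᵖ] Q i
  aug : Q 0 →ₗ[Bᵐᵒᵖ] N
  d_mem : ∀ i k, ∀ x ∈ grading (i + 1) k, d i x ∈ grading i k
  aug_mem : ∀ k, ∀ x ∈ grading 0 k, aug x ∈ 𝒩 k
  aug_surjective : Function.Surjective aug
  exact_zero : Function.Exact (d 0) aug
  exact_succ : ∀ i, Function.Exact (d (i + 1)) (d i)

/-- The grading of `V_α` induced from that of `B`. -/
def standardGrading (α : I) (k : ℕ) : AddSubgroup (Standard e α) :=
  ((𝒷 k).toAddSubgroup.comap (projective e α).subtype.toAddMonoidHom).map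
    ((upperPart e α).submoduleOf (projective e α)).mkQ.toAddMonoidHom

/-- Every right-standard module has a linear projective resolution. -/
def HasLinearStandards : Prop :=
  ∀ α : I, Nonempty
    (LinearProjectiveResolution 𝒷 (Standard e α) (standardGrading e 𝒷 α))

/-- `B` is standard Koszul: finite-dimensional and quasi-hereditary, with linear projective
resolutions of all right-standard and all left-standard modules.  Left `B`-modules are right
modules over `Bᵐᵒᵖ`. -/
structure IsStandardKoszul : Prop where
  finite : FiniteDimensional ℂ B
  quasiHereditary : IsQuasiHereditary e 𝒷
  right_linear : HasLinearStandards e 𝒷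
  left_linear : HasLinearStandards (B := Bᵐᵒᵖ) (fun α => MulOpposite.op (e α))
    (fun k => (𝒷 k).map (MulOpposite.opLinearEquiv ℂ : B ≃ₗ[ℂ] Bᵐᵒᵖ).toLinearMap)

end Standard

/-! ### Localization algebras -/

section Localization

variable {I : Type u} [Fintype I] {U : Type v} [AddCommGroup U] [Module ℂ U]
  {Z : Type w} [Ring Z] [Algebra ℂ Z] [Algebra (SymmetricAlgebra ℂ U) Z]
  [IsScalarTower ℂ (SymmetricAlgebra ℂ U) Z]

/-- `(U, Z, I, h)` is a localization algebra, where `𝒵` is the grading of `Z` and `U` sits in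
degree two: `U` is finite-dimensional and `Z` is a finitely generated graded
`Sym U`-algebra (the finiteness of `I` and the linearity of `h` are in the binders). -/
structure IsLocalizationAlgebra (𝒵 : ℕ → Submodule ℂ Z)
    (h : Z →ₐ[SymmetricAlgebra ℂ U] (I → SymmetricAlgebra ℂ U)) : Prop where
  finite : FiniteDimensional ℂ U
  finiteType : Algebra.FiniteType (SymmetricAlgebra ℂ U) Z
  gradedMonoid : SetLike.GradedMonoid 𝒵
  internal : DirectSum.IsInternal 𝒵
  smul_mem : ∀ (u : U) (k : ℕ), ∀ z ∈ 𝒵 k, SymmetricAlgebra.ι ℂ U u • z ∈ 𝒵 (k + 2)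

/-- A localization algebra is strong if the kernel and the cokernel of `h` are torsion. -/
structure IsStrongLocalizationAlgebra (𝒵 : ℕ → Submodule ℂ Z)
    (h : Z →ₐ[SymmetricAlgebra ℂ U] (I → SymmetricAlgebra ℂ U)) : Prop
    extends IsLocalizationAlgebra 𝒵 h where
  torsion_ker : Module.IsTorsion (SymmetricAlgebra ℂ U) (LinearMap.ker h.toLinearMap)
  torsion_coker : Module.IsTorsion (SymmetricAlgebra ℂ U)
    ((I → SymmetricAlgebra ℂ U) ⧸ LinearMap.range h.toLinearMap)

/-- A localization algebra is free if `Z` is a free `Sym U`-module of rank `|I|`. -/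
structure IsFreeLocalizationAlgebra (𝒵 : ℕ → Submodule ℂ Z)
    (h : Z →ₐ[SymmetricAlgebra ℂ U] (I → SymmetricAlgebra ℂ U)) : Prop
    extends IsLocalizationAlgebra 𝒵 h where
  free : Module.Free (SymmetricAlgebra ℂ U) Z
  rank : Module.rank (SymmetricAlgebra ℂ U) Z = Fintype.card I

end Localization

/-! ### Graded deformations -/

section Deformation

variable {I : Type u} [Fintype I] [DecidableEq I]
  {M : Type v} [AddCommGroup M] [Module ℂ M] [Module (I → ℂ) M] [Module (I → ℂ)ᵐᵒᵖ M]

/-- A graded deformation over `U^*` of the quadratic algebra `A = T_R(M) / ⟨W⟩`.  The central map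
`j : Sym U → D` is the algebra structure map of `D`, and `𝒟` is the grading of `D`. -/
structure GradedDeformation (W : Submodule ℂ (BimoduleTensorAlgebra I M))
    (U : Type*) [AddCommGroup U] [Module ℂ U]
    (D : Type*) [Ring D] [Algebra ℂ D] [Algebra (SymmetricAlgebra ℂ U) D]
    (𝒟 : ℕ → Submodule ℂ D) where
  /-- the `R`-algebra structure of `D` -/
  ofR : (I → ℂ) →ₐ[ℂ] D
  /-- the projection to `A` -/
  π : D →ₐ[ℂ] QuadAlgebra W
  ofR_mem : ∀ r, ofR r ∈ 𝒟 0
  π_ofR : ∀ r, π (ofR r) = QuadAlgebra.ofR W r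
  ι_mem : ∀ u : U, algebraMap (SymmetricAlgebra ℂ U) D (SymmetricAlgebra.ι ℂ U u) ∈ 𝒟 2
  π_mem : ∀ k, ∀ x ∈ 𝒟 k, π x ∈ QuadAlgebra.degree W k
  π_surjective : Function.Surjective π
  ker_π : RingHom.ker π = Ideal.span
    (Set.range fun u : U => algebraMap (SymmetricAlgebra ℂ U) D (SymmetricAlgebra.ι ℂ U u))

/-- The idempotents `e_α` of a graded deformation. -/
def GradedDeformation.idem {W : Submodule ℂ (BimoduleTensorAlgebra I M)}
    {U : Type*} [AddCommGroup U] [Module ℂ U]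
    {D : Type*} [Ring D] [Algebra ℂ D] [Algebra (SymmetricAlgebra ℂ U) D]
    {𝒟 : ℕ → Submodule ℂ D} (𝔇 : GradedDeformation W U D 𝒟) (α : I) : D :=
  𝔇.ofR (Pi.single α 1)

end Deformation

/-! ### Central characters and malleability

Here `S` is a commutative ring with total fraction ring `K = FractionRing S`, `D` is an
`S`-algebra with idempotents `e α`, and `N^∞` is `K ⊗[S] N`. -/

section Malleable

variable {I : Type u} [Fintype I] [PartialOrder I]
  {S : Type v} [CommRing S] {D : Type w} [Ring D] [Algebra S D] (e : I → D)

/-- The centre of `D` acts on each deformed standard module `V_α` through the character `h_α`. -/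
def IsCentralCharacters (h : I → (Subalgebra.center S D →ₐ[S] S)) : Prop :=
  ∀ (α : I) (ζ : Subalgebra.center S D) (x : Standard e α),
    MulOpposite.op (ζ : D) • x = h α ζ • x

/-- The right `D^∞`-submodule `(D e_T D)^∞` of `D^∞`, where `e_T` is the sum of the `e_γ` over
`γ ∈ T`. -/
noncomputable def traceIdeal (T : Set I) :
    Submodule (FractionRing S ⊗[S] D)ᵐᵒᵖ (FractionRing S ⊗[S] D) :=
  Submodule.span _ {x | ∃ a : D, ∃ γ ∈ T, x = (1 : FractionRing S) ⊗ₜ[S] (a * e γ)}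

/-- An enumeration of `I` that starts with a maximal element, continues with a maximal element of
the remaining elements, and so on. -/
def IsDescending (σ : Fin (Fintype.card I) ≃ I) : Prop :=
  ∀ i j, σ i < σ j → j < i

/-- An enumeration `α_1, …, α_n` of `I` as above gives the deformed standard filtration of the
right module `D` by the ideals `D e_T D` with `T = {α_1, …, α_k}`; this is the condition
that the induced filtration of `D^∞` splits. -/
def StandardFiltrationSplits (σ : Fin (Fintype.card I) ≃ I) : Prop :=
  ∃ N : Fin (Fintype.card I) →
      Submodule (FractionRing S ⊗[S] D)ᵐᵒᵖ (FractionRing S ⊗[S] D),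
    DirectSum.IsInternal N ∧
      ∀ k, traceIdeal (S := S) e (σ '' {i | i ≤ k}) = ⨆ i ≤ k, N i

/-- The right action map `D → End_S (V_α)`. -/
noncomputable def actionMap (α : I) : D →ₗ[S] Module.End S (Standard e α) :=
  (Algebra.lsmul S S (Standard e α) : Dᵐᵒᵖ →ₐ[S] _).toLinearMap ∘ₗ
    (MulOpposite.opLinearEquiv S : D ≃ₗ[S] Dᵐᵒᵖ).toLinearMap

/-- The right action map `D^∞ → ⨁_α End_K (V_α^∞)`. -/
noncomputable def genericActionMap : FractionRing S ⊗[S] D →ₗ[FractionRing S]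
    ((α : I) → Module.End (FractionRing S) (FractionRing S ⊗[S] Standard e α)) :=
  LinearMap.pi fun α => LinearMap.liftBaseChange (FractionRing S)
    ((LinearMap.baseChangeHom S (FractionRing S) (Standard e α) (Standard e α)) ∘ₗ
      actionMap (S := S) e α)

/-- The map `⨁_α h_α^∞ : Z(D)^∞ → ⨁_α K`. -/
noncomputable def genericCharacterMap (h : I → (Subalgebra.center S D →ₐ[S] S)) :
    FractionRing S ⊗[S] Subalgebra.center S D →ₗ[FractionRing S] (I → FractionRing S) :=
  LinearMap.pi fun α => LinearMap.liftBaseChange (FractionRing S)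
    ((Algebra.linearMap S (FractionRing S)) ∘ₗ (h α).toLinearMap)

/-- Malleability: the deformed standard filtrations of `D^∞` split, the action map
`D^∞ → ⨁_α End_K (V_α^∞)` is an isomorphism, the map `Z(D)^∞ → ⨁_α K` is an isomorphism,
and the characters `h_α` are distinct. -/
structure IsMalleable (h : I → (Subalgebra.center S D →ₐ[S] S)) : Prop where
  splits : ∀ σ : Fin (Fintype.card I) ≃ I, IsDescending σ →
    StandardFiltrationSplits (S := S) e σ
  action_bijective : Function.Bijective (genericActionMap (S := S) e)
  character_bijective : Function.Bijective (genericCharacterMap h)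
  distinct : Function.Injective h

/-- The grading of the centre of `D` induced by a grading of `D`. -/
def centerGrading (S : Type v) [CommRing S] {D : Type w} [Ring D] [Algebra S D]
    [Algebra ℂ S] [Algebra ℂ D] [IsScalarTower ℂ S D] (𝒟 : ℕ → Submodule ℂ D) (k : ℕ) :
    Submodule ℂ (Subalgebra.center S D) :=
  (𝒟 k).comap ((Subalgebra.center S D).val.restrictScalars ℂ).toLinearMap

end Malleable

end KoszulCenter

open KoszulCenter

open scoped TensorProduct

namespace KoszulCenter

universe u v w

set_option linter.unusedSectionVars false

/-! ### Trace ideals and standard modules -/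

section Trace

variable {I : Type u} (k : Type v) [CommRing k] {B : Type w} [Ring B] [Algebra k B] (e : I → B)

/-! Write J_α for the two-sided ideal generated by the e_γ with γ > α. Three facts about A drive
everything. Since the radical of V_α involves only L_β with β < α, e_α A e_α equals ℂe_α modulo e_α
A ε_α A. Since the kernel of e_α A → V_α is filtered by V_γ with γ > α, e_α A ε_α A equals e_α J_α,
so V_α is the image of e_α A in A/J_α. Finally, with n_α = dim V_α and m_α the dimension of the
image of A e_α in A/J_α, the sum of the products m_α n_α is at most dim A
(`IsQuasiHereditary.sum_le_finrank`).

These facts pass to the deformation D. Graded Nakayama (`apply_mem_of_map_mem`) lifts the spanning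
statements: lifts a_{α,i} of columns and v_{α,j} of rows have products spanning D. Their images span
A and are no more than dim A in number, so they form a basis of A, and flatness makes the products
independent over S (`linearIndependent_of_flat`). Hence D and all deformed V_α are free, with ranks
Σ m_α n_α and n_α (`isDeformedQuasiHereditary`). As e_α ζ e_α is a multiple of e_α modulo J_α, a
central ζ acts on V_α by a scalar, and this is h_α(ζ). Strength says exactly that ⊕ h_α becomes
bijective over K.

For (a), an element annihilating every V_α moves each step of the standard filtration of D one step
down (`IsDeformedQuasiHereditary.mul_mem_of_standard`). If the filtration of D^∞ splits into right
ideals, such an element kills every summand and is zero, so the action map is injective. An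
anti-automorphism gives m_α = n_α, so dimensions agree and the map is bijective. Then D^∞ is a
product of matrix algebras and its centre is K^I, so the characters are distinct. Conversely, the
common kernel of the characters is nilpotent, so distinct characters allow the idempotents of K^I to
be lifted to Z(D)^∞; these split every standard filtration.

For (b), commutators with a basis of D give an S-linear map ψ into a free module whose rank is the
codimension of Z(A) in A. It vanishes on Z(D), and it is generically invertible on lifts of a basis
of A/Z(A). Comparing ranks, its kernel is Z(D). Cramer's rule then lifts all of Z(A) to Z(D), and
Nakayama with flatness turns homogeneous lifts of a basis of Z(A) into a basis of Z(D)
(`free_center`). -/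

/-- The two-sided ideal `B e_T B` generated by the `e γ` with `γ ∈ T`. -/
def traceSpan (T : Set I) : Submodule k B :=
  Submodule.span k {x | ∃ a b : B, ∃ γ ∈ T, x = a * e γ * b}

variable {k e}

lemma mul_idem_mul_mem_traceSpan {T : Set I} {γ : I} (hγ : γ ∈ T) (a b : B) :
    a * e γ * b ∈ traceSpan k e T :=
  Submodule.subset_span ⟨a, b, γ, hγ, rfl⟩

lemma idem_mul_mem_traceSpan {T : Set I} {γ : I} (hγ : γ ∈ T) (b : B) :
    e γ * b ∈ traceSpan k e T := by
  simpa using mul_idem_mul_mem_traceSpan (k := k) hγ 1 b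

lemma mul_idem_mem_traceSpan {T : Set I} {γ : I} (hγ : γ ∈ T) (a : B) :
    a * e γ ∈ traceSpan k e T := by
  simpa using mul_idem_mul_mem_traceSpan (k := k) hγ a 1

lemma mul_left_mem_traceSpan {T : Set I} (c : B) {x : B} (hx : x ∈ traceSpan k e T) :
    c * x ∈ traceSpan k e T := by
  induction hx using Submodule.span_induction with
  | mem x hx =>
    obtain ⟨a, b, γ, hγ, rfl⟩ := hx
    rw [← mul_assoc, ← mul_assoc]
    exact mul_idem_mul_mem_traceSpan hγ _ _
  | zero => simp
  | add x y _ _ hx hy => rw [mul_add]; exact add_mem hx hy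
  | smul r x _ hx => rw [mul_smul_comm]; exact Submodule.smul_mem _ _ hx

lemma mul_right_mem_traceSpan {T : Set I} (c : B) {x : B} (hx : x ∈ traceSpan k e T) :
    x * c ∈ traceSpan k e T := by
  induction hx using Submodule.span_induction with
  | mem x hx =>
    obtain ⟨a, b, γ, hγ, rfl⟩ := hx
    rw [mul_assoc]
    exact mul_idem_mul_mem_traceSpan hγ _ _
  | zero => simp
  | add x y _ _ hx hy => rw [add_mul]; exact add_mem hx hy
  | smul r x _ hx => rw [smul_mul_assoc]; exact Submodule.smul_mem _ _ hx

lemma traceSpan_mono {T T' : Set I} (h : T ⊆ T') : traceSpan k e T ≤ traceSpan k e T' :=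
  Submodule.span_mono fun _ ⟨a, b, γ, hγ, hx⟩ => ⟨a, b, γ, h hγ, hx⟩

lemma traceSpan_empty : traceSpan k e ∅ = ⊥ := by simp [traceSpan]

lemma traceSpan_univ [Fintype I] (he : CompleteOrthogonalIdempotents e) :
    traceSpan k e Set.univ = ⊤ := by
  refine eq_top_iff.2 fun x _ => ?_
  rw [← mul_one x, ← he.complete, Finset.mul_sum]
  exact sum_mem fun γ _ => mul_idem_mem_traceSpan (Set.mem_univ γ) x

end Trace

section Standard

variable {I : Type u} [Fintype I] [PartialOrder I] {B : Type w} [Ring B] {e : I → B}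

lemma idem_mul_mem_projective (α : I) (b : B) : e α * b ∈ projective e α :=
  Submodule.mem_span_singleton.2 ⟨MulOpposite.op b, rfl⟩

lemma idem_mul_of_mem_projective (he : OrthogonalIdempotents e) {α : I} {x : B}
    (hx : x ∈ projective e α) : e α * x = x := by
  obtain ⟨b, rfl⟩ := Submodule.mem_span_singleton.1 hx
  change e α * (e α * b.unop) = e α * b.unop
  rw [← mul_assoc, (he.idem α).eq]

lemma idem_mul_of_mem_upperPart (he : OrthogonalIdempotents e) {α : I} {x : B}
    (hx : x ∈ upperPart e α) : e α * x = x := by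
  induction hx using Submodule.span_induction with
  | mem x hx =>
    obtain ⟨b, rfl⟩ := hx
    rw [← mul_assoc, ← mul_assoc, (he.idem α).eq]
  | zero => simp
  | add x y _ _ hx hy => rw [mul_add, hx, hy]
  | smul r x _ hx =>
    change e α * (x * r.unop) = x * r.unop
    rw [← mul_assoc, hx]

lemma mul_mem_upperPart {α : I} {x : B} (hx : x ∈ upperPart e α) (c : B) :
    x * c ∈ upperPart e α :=
  (upperPart e α).smul_mem (MulOpposite.op c) hx

lemma idem_mul_eps (he : OrthogonalIdempotents e) {α γ : I} (h : ¬ γ ≤ α) :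
    e γ * eps e α = e γ := by
  classical
  rw [eps]
  convert he.mul_sum_of_mem (i := γ) (s := Finset.univ.filter (fun γ => ¬ γ ≤ α)) (by simpa)

lemma mul_idem_mem_upperPart (he : OrthogonalIdempotents e) {α γ : I} (h : ¬ γ ≤ α) (a : B) :
    e α * a * e γ ∈ upperPart e α := by
  refine Submodule.subset_span ⟨a * e γ, ?_⟩
  rw [mul_assoc, mul_assoc, mul_assoc, idem_mul_eps he h]

/-- The elements of `e_α B ε_α B` lie in every right ideal containing the `e_α a e_γ` with
`γ ≰ α`. -/
lemma upperPart_le {α : I} {N : Submodule Bᵐᵒᵖ B}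
    (h : ∀ γ, ¬ γ ≤ α → ∀ a, e α * a * e γ ∈ N) : upperPart e α ≤ N := by
  classical
  refine Submodule.span_le.2 ?_
  rintro _ ⟨b, rfl⟩
  rw [eps, Finset.mul_sum]
  refine sum_mem fun γ hγ => h γ ?_ b
  simpa using hγ

section

variable (k : Type v) [CommRing k] [Algebra k B]

lemma mul_mem_upperPart_of_mem_traceSpan (he : OrthogonalIdempotents e) {α : I} {x : B}
    (hx : x ∈ traceSpan k e {γ | α < γ}) : e α * x ∈ upperPart e α := by
  induction hx using Submodule.span_induction with
  | mem x hx =>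
    obtain ⟨a, b, γ, hγ, rfl⟩ := hx
    rw [← mul_assoc, ← mul_assoc]
    exact mul_mem_upperPart (mul_idem_mem_upperPart he hγ.not_ge a) b
  | zero => simp
  | add x y _ _ hx hy => rw [mul_add]; exact add_mem hx hy
  | smul r x _ hx =>
    rw [mul_smul_comm]
    have := mul_mem_upperPart hx (algebraMap k B r)
    rwa [← Algebra.commutes, ← Algebra.smul_def] at this

/-- Together with the preceding lemma this replaces e_α B ε_α B by e_α J, where J is the two-sided
ideal of the e_γ with γ > α. The hypothesis trades the condition γ ≰ α for γ > α, and the two-sided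
form serves rows and columns alike and lifts along surjections of algebras. -/
lemma upperPart_le_traceSpan {α : I}
    (h : ∀ γ, ¬ γ ≤ α → ∀ a, e α * a * e γ ∈ traceSpan k e {γ | α < γ}) {x : B}
    (hx : x ∈ upperPart e α) : x ∈ traceSpan k e {γ | α < γ} := by
  -- The trace ideal regarded as a right ideal, the form required for comparison with the right
  -- ideal `upperPart`.
  let N : Submodule Bᵐᵒᵖ B :=
    { (traceSpan k e {γ | α < γ}).toAddSubmonoid with
      smul_mem' := fun c x hx => mul_right_mem_traceSpan c.unop hx }
  exact upperPart_le (N := N) h hx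

/-- The surjection `b ↦ [e_α b]` from `B` to the standard module `V_α`. -/
def standardMk (α : I) : B →ₗ[k] Standard e α where
  toFun b := Submodule.Quotient.mk ⟨e α * b, idem_mul_mem_projective α b⟩
  map_add' x y := by
    rw [← Submodule.Quotient.mk_add]
    congr 1
    ext
    simp [mul_add]
  map_smul' r x := by
    rw [RingHom.id_apply, ← Submodule.Quotient.mk_smul]
    congr 1
    ext
    simp

variable {k}

lemma standardMk_surjective (he : OrthogonalIdempotents e) (α : I) :
    Function.Surjective (standardMk (e := e) k α) := by
  intro y
  obtain ⟨⟨x, hx⟩, rfl⟩ := Submodule.Quotient.mk_surjective _ y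
  refine ⟨x, ?_⟩
  change Submodule.Quotient.mk _ = Submodule.Quotient.mk _
  congr 1
  exact Subtype.ext (idem_mul_of_mem_projective he hx)

lemma standardMk_eq_zero_iff_mem_upperPart {α : I} {b : B} :
    standardMk (e := e) k α b = 0 ↔ e α * b ∈ upperPart e α :=
  Submodule.Quotient.mk_eq_zero _

lemma standardMk_eq_zero_iff (he : OrthogonalIdempotents e) {α : I}
    (h : ∀ γ, ¬ γ ≤ α → ∀ a, e α * a * e γ ∈ traceSpan k e {γ | α < γ}) {b : B} :
    standardMk (e := e) k α b = 0 ↔ e α * b ∈ traceSpan k e {γ | α < γ} := by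
  rw [standardMk_eq_zero_iff_mem_upperPart]
  refine ⟨upperPart_le_traceSpan k h, fun hb => ?_⟩
  have := mul_mem_upperPart_of_mem_traceSpan k he hb
  rwa [← mul_assoc, (he.idem α).eq] at this

lemma op_smul_standardMk (α : I) (b c : B) :
    MulOpposite.op c • standardMk (e := e) k α b = standardMk k α (b * c) := by
  change Submodule.Quotient.mk _ = Submodule.Quotient.mk _
  congr 1
  ext
  change e α * b * c = e α * (b * c)
  rw [mul_assoc]

lemma standardMk_idem_mul (he : OrthogonalIdempotents e) (α : I) (b : B) :
    standardMk (e := e) k α (e α * b) = standardMk k α b := by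
  change Submodule.Quotient.mk _ = Submodule.Quotient.mk _
  congr 1
  ext
  change e α * (e α * b) = e α * b
  rw [← mul_assoc, (he.idem α).eq]

variable (k)

/-- The map `x ↦ [e_α x]` from `B` to `B / B e_{>α} B`. -/
def rowMk (α : I) : B →ₗ[k] B ⧸ traceSpan k e {γ | α < γ} :=
  (traceSpan k e {γ | α < γ}).mkQ ∘ₗ LinearMap.mulLeft k (e α)

/-- The map `x ↦ [x e_α]` from `B` to `B / B e_{>α} B`. -/
def columnMk (α : I) : B →ₗ[k] B ⧸ traceSpan k e {γ | α < γ} :=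
  (traceSpan k e {γ | α < γ}).mkQ ∘ₗ LinearMap.mulRight k (e α)

variable {k}

/-- The maps from B to B/J and to V_α have the same kernel. This realizes V_α inside B/J, where it
can be compared with a column. -/
lemma finrank_range_rowMk (he : OrthogonalIdempotents e) {α : I}
    (h : ∀ γ, ¬ γ ≤ α → ∀ a, e α * a * e γ ∈ traceSpan k e {γ | α < γ}) :
    Module.finrank k (LinearMap.range (rowMk (e := e) k α)) = Module.finrank k (Standard e α) := by
  have hker : LinearMap.ker (rowMk (e := e) k α) = LinearMap.ker (standardMk (e := e) k α) := by
    ext b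
    rw [LinearMap.mem_ker, LinearMap.mem_ker, standardMk_eq_zero_iff he h, rowMk,
      LinearMap.comp_apply, Submodule.mkQ_apply, Submodule.Quotient.mk_eq_zero,
      LinearMap.mulLeft_apply]
  exact ((LinearMap.quotKerEquivRange _).symm.trans
    ((Submodule.quotEquivOfEq _ _ hker).trans
      ((standardMk (e := e) k α).quotKerEquivOfSurjective
        (standardMk_surjective he α)))).finrank_eq

end

end Standard

/-! ### Numerical consequences of quasi-heredity -/

section QuasiHereditary

variable {I : Type u} [Fintype I] [PartialOrder I] {B : Type w} [Ring B] {e : I → B}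

/-- Each layer is recorded as a surjection onto the model with the previous step as kernel, which
keeps later inductions free of quotients of submodules. -/
lemma HasFiltration.exists_surjections {X : Type w} [AddCommGroup X] [Module Bᵐᵒᵖ X]
    {Y : I → Type w} [∀ β, AddCommGroup (Y β)] [∀ β, Module Bᵐᵒᵖ (Y β)] {T : Set I}
    (h : HasFiltration (B := B) X Y T) :
    ∃ (n : ℕ) (F : ℕ → Submodule Bᵐᵒᵖ X), F 0 = ⊥ ∧ F n = ⊤ ∧
      ∀ i < n, F i ≤ F (i + 1) ∧ ∃ β ∈ T, ∃ φ : F (i + 1) →ₗ[Bᵐᵒᵖ] Y β, Function.Surjective φ ∧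
        ∀ x, φ x = 0 ↔ (x : X) ∈ F i := by
  obtain ⟨n, F, h0, hn, hmono, hF⟩ := h
  refine ⟨n, F, h0, hn, fun i hi => ⟨hmono i.le_succ, ?_⟩⟩
  obtain ⟨β, hβ, ⟨φ⟩⟩ := hF i hi
  refine ⟨β, hβ, φ.toLinearMap ∘ₗ Submodule.mkQ _,
    φ.surjective.comp (Submodule.mkQ_surjective _), fun x => ?_⟩
  simp only [LinearMap.coe_comp, Function.comp_apply, LinearEquiv.coe_coe,
    LinearEquiv.map_eq_zero_iff, Submodule.mkQ_apply, Submodule.Quotient.mk_eq_zero]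
  rfl

/-- Acting by c lowers the filtration index by one, and c² = c means that acting again changes
nothing, so induction ends at zero. -/
lemma HasFiltration.op_smul_eq_zero {X : Type w} [AddCommGroup X] [Module Bᵐᵒᵖ X]
    {Y : I → Type w} [∀ β, AddCommGroup (Y β)] [∀ β, Module Bᵐᵒᵖ (Y β)] {T : Set I}
    (h : HasFiltration (B := B) X Y T) {c : B} (hc : IsIdempotentElem c)
    (hY : ∀ β ∈ T, ∀ y : Y β, MulOpposite.op c • y = 0) (x : X) : MulOpposite.op c • x = 0 := by
  obtain ⟨n, F, h0, hn, hF⟩ := h.exists_surjections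
  suffices ∀ i ≤ n, ∀ x ∈ F i, MulOpposite.op c • x = 0 from this n le_rfl x (hn ▸ trivial)
  intro i
  induction i with
  | zero =>
    intro _ x hx
    rw [h0, Submodule.mem_bot] at hx
    simp [hx]
  | succ i ih =>
    intro hi x hx
    obtain ⟨-, β, hβ, φ, -, hφ⟩ := hF i hi
    have h1 : MulOpposite.op c • x ∈ F i := by
      refine (hφ (MulOpposite.op c • ⟨x, hx⟩)).1 ?_
      rw [map_smul, hY β hβ]
    have h2 := ih (Nat.le_of_succ_le hi) _ h1
    rwa [smul_smul, ← MulOpposite.op_mul, hc.eq] at h2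

variable [Algebra ℂ B]

/-- A module filtered by standard modules `V_β`, with multiplicities `c β`: its dimension, its
generation by the `e_β`, and the bound for its `α`-component modulo the trace of the `e_δ` with
`δ > α`. -/
lemma HasFiltration.exists_multiplicities (he : OrthogonalIdempotents e)
    (hdiag : ∀ α a, ∃ r : ℂ, e α * a * e α - r • e α ∈ upperPart e α)
    {X : Type w} [AddCommGroup X] [Module Bᵐᵒᵖ X] [Module ℂ X] [IsScalarTower ℂ Bᵐᵒᵖ X]
    [FiniteDimensional ℂ X] {T : Set I} (h : HasFiltration (B := B) X (Standard e) T) :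
    (∀ x : X, x ∈ Submodule.span ℂ
      {y : X | ∃ δ ∈ T, ∃ (b : B) (z : X), y = MulOpposite.op (e δ * b) • z}) ∧
    ∃ c : I → ℕ, Module.finrank ℂ X = ∑ β, c β * Module.finrank ℂ (Standard e β) ∧
      ∀ α, ∃ s : Finset X, s.card ≤ c α ∧ ∀ x : X, MulOpposite.op (e α) • x ∈
        Submodule.span ℂ (s : Set X) ⊔ Submodule.span ℂ
          {y : X | ∃ δ, α < δ ∧ ∃ (b : B) (z : X), y = MulOpposite.op (e δ * b) • z} := by
  classical
  obtain ⟨n, F, h0, hn, hF⟩ := h.exists_surjections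
  suffices H : ∀ i ≤ n, (∀ x ∈ F i, x ∈ Submodule.span ℂ
      {y : X | ∃ δ ∈ T, ∃ (b : B) (z : X), y = MulOpposite.op (e δ * b) • z}) ∧
    ∃ c : I → ℕ, Module.finrank ℂ (F i) = ∑ β, c β * Module.finrank ℂ (Standard e β) ∧
      ∀ α, ∃ s : Finset X, s.card ≤ c α ∧ ∀ x ∈ F i, MulOpposite.op (e α) • x ∈
        Submodule.span ℂ (s : Set X) ⊔ Submodule.span ℂ
          {y : X | ∃ δ, α < δ ∧ ∃ (b : B) (z : X), y = MulOpposite.op (e δ * b) • z} by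
    obtain ⟨H1, c, H2, H3⟩ := H n le_rfl
    refine ⟨fun x => H1 x (hn ▸ trivial), c, ?_, fun α => ?_⟩
    · rw [← H2, hn]
      exact (LinearEquiv.restrictScalars ℂ
        (Submodule.topEquiv : (⊤ : Submodule Bᵐᵒᵖ X) ≃ₗ[Bᵐᵒᵖ] X)).finrank_eq.symm
    · obtain ⟨s, hs, hs'⟩ := H3 α
      exact ⟨s, hs, fun x => hs' x (hn ▸ trivial)⟩
  intro i
  induction i with
  | zero =>
    intro _
    refine ⟨fun x hx => ?_, 0, ?_, fun α => ⟨∅, by simp, fun x hx => ?_⟩⟩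
    · rw [h0, Submodule.mem_bot] at hx
      simp [hx]
    · rw [h0]
      simp only [Pi.zero_apply, zero_mul, Finset.sum_const_zero]
      exact Module.finrank_zero_of_subsingleton
    · rw [h0, Submodule.mem_bot] at hx
      simp [hx]
  | succ i ih =>
    intro hi
    obtain ⟨ih1, c, ih2, ih3⟩ := ih (Nat.le_of_succ_le hi)
    obtain ⟨hle, β, hβ, φ, hφs, hφ⟩ := hF i hi
    obtain ⟨w, hw⟩ := hφs (standardMk ℂ β 1)
    -- a lift of an arbitrary element through the generator of the standard quotient
    have hlift : ∀ x (hx : x ∈ F (i + 1)), ∃ b : B,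
        φ ⟨x, hx⟩ = standardMk ℂ β b ∧ x - MulOpposite.op (e β * b) • (w : X) ∈ F i := by
      intro x hx
      obtain ⟨b, hb⟩ := standardMk_surjective (k := ℂ) he β (φ ⟨x, hx⟩)
      refine ⟨b, hb.symm, (hφ (⟨x, hx⟩ - MulOpposite.op (e β * b) • w)).1 ?_⟩
      rw [map_sub, map_smul, hw, op_smul_standardMk, one_mul, standardMk_idem_mul he, hb, sub_self]
    -- The new layer is a copy of V_β, so only the multiplicity of β grows, by one.
    refine ⟨fun x hx => ?_, c + Pi.single β 1, ?_, fun α => ?_⟩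
    · obtain ⟨b, -, hb⟩ := hlift x hx
      have h1 := ih1 _ hb
      have h2 : MulOpposite.op (e β * b) • (w : X) ∈ Submodule.span ℂ
          {y : X | ∃ δ ∈ T, ∃ (b : B) (z : X), y = MulOpposite.op (e δ * b) • z} :=
        Submodule.subset_span ⟨β, hβ, b, w, rfl⟩
      simpa using add_mem h1 h2
    · have : FiniteDimensional ℂ (F (i + 1)) :=
        inferInstanceAs (FiniteDimensional ℂ ((F (i + 1)).restrictScalars ℂ))
      have hrank := LinearMap.finrank_range_add_finrank_ker (φ.restrictScalars ℂ)
      have hr : LinearMap.range (φ.restrictScalars ℂ) = ⊤ := LinearMap.range_eq_top.2 hφs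
      have hk : Module.finrank ℂ (LinearMap.ker (φ.restrictScalars ℂ)) =
          Module.finrank ℂ (F i) := by
        let f : F i →ₗ[ℂ] F (i + 1) := (Submodule.inclusion hle).restrictScalars ℂ
        have hf : Function.Injective f := Submodule.inclusion_injective hle
        have hfr : LinearMap.range f = LinearMap.ker (φ.restrictScalars ℂ) := by
          ext x
          rw [LinearMap.mem_ker, LinearMap.restrictScalars_apply, hφ]
          constructor
          · rintro ⟨y, rfl⟩
            exact y.2
          · intro hx
            exact ⟨⟨x, hx⟩, rfl⟩
        rw [← hfr]
        exact (LinearEquiv.ofInjective f hf).finrank_eq.symm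
      rw [hr, finrank_top, hk, ih2] at hrank
      rw [← hrank]
      simp [add_mul, Finset.sum_add_distrib, Pi.single_apply, add_comm]
    · obtain ⟨s, hs, hs'⟩ := ih3 α
      -- Contribution of the new layer V_β to the e_α-component modulo the trace of the e_δ with δ >
      -- α: one generator, the e_α-component of `w`, if β = α; nothing new if α < β, since V_β is
      -- generated by e_β; zero otherwise, since then V_β e_α = 0.
      by_cases hαβ : α = β
      · subst hαβ
        refine ⟨insert (MulOpposite.op (e α) • (w : X)) s, ?_, fun x hx => ?_⟩
        · refine (Finset.card_insert_le _ _).trans ?_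
          simpa using hs
        · obtain ⟨b, hb, -⟩ := hlift x hx
          obtain ⟨r, hr⟩ := hdiag α b
          have h1 : MulOpposite.op (e α) • x - r • (w : X) ∈ F i := by
            have H := (hφ (MulOpposite.op (e α) • ⟨x, hx⟩ - (r • (1 : Bᵐᵒᵖ)) • w)).1 (by
              rw [map_sub, map_smul, map_smul, hb, hw, op_smul_standardMk, smul_assoc, one_smul,
                ← map_smul, ← map_sub, standardMk_eq_zero_iff_mem_upperPart]
              convert hr using 1
              simp [mul_sub, mul_assoc])
            simpa using H
          have h2 := hs' _ h1
          rw [smul_sub, smul_smul, ← MulOpposite.op_mul, (he.idem α).eq,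
            smul_algebra_smul_comm] at h2
          have h3 : MulOpposite.op (e α) • x =
              (MulOpposite.op (e α) • x - r • MulOpposite.op (e α) • (w : X)) +
                r • MulOpposite.op (e α) • (w : X) := by simp
          rw [h3]
          refine add_mem (SetLike.le_def.1 (sup_le_sup_right (Submodule.span_mono (by simp)) _) h2)
            (Submodule.mem_sup_left (Submodule.smul_mem _ _ (Submodule.subset_span (by simp))))
      · refine ⟨s, by simpa [Pi.single_apply, hαβ] using hs, fun x hx => ?_⟩
        obtain ⟨b, hb, hb'⟩ := hlift x hx
        by_cases hlt : α < β
        · have h1 := hs' _ hb'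
          rw [smul_sub, smul_smul, ← MulOpposite.op_mul, mul_assoc] at h1
          have h2 : MulOpposite.op (e β * (b * e α)) • (w : X) ∈ Submodule.span ℂ
              {y : X | ∃ δ, α < δ ∧ ∃ (b : B) (z : X), y = MulOpposite.op (e δ * b) • z} :=
            Submodule.subset_span ⟨β, hlt, _, _, rfl⟩
          simpa using add_mem h1 (Submodule.mem_sup_right h2)
        · have h1 : MulOpposite.op (e α) • x ∈ F i := by
            refine (hφ (MulOpposite.op (e α) • ⟨x, hx⟩)).1 ?_
            rw [map_smul, hb, op_smul_standardMk, standardMk_eq_zero_iff_mem_upperPart, ← mul_assoc]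
            exact mul_idem_mem_upperPart he (fun h => hlt (lt_of_le_of_ne h hαβ)) b
          have h2 := hs' _ h1
          rwa [smul_smul, ← MulOpposite.op_mul, (he.idem α).eq] at h2

end QuasiHereditary

section QuasiHereditaryConsequences

variable {I : Type u} [Fintype I] [PartialOrder I] {B : Type w} [Ring B] {e : I → B}
  [Algebra ℂ B] {𝒷 : ℕ → Submodule ℂ B}

/-- Right multiplication by e_α sends a combination of idempotents to a multiple of e_α, which the
kernel of B → L_β contains because α ≠ β. Elements of positive degree lie in that right ideal
already. -/
lemma op_idem_smul_simple (he : CompleteOrthogonalIdempotents e)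
    (hspan : ∀ b : B, b ∈ Submodule.span ℂ (Set.range e) ⊔
      Submodule.span ℂ {x | ∃ k, 0 < k ∧ x ∈ 𝒷 k})
    {α β : I} (h : α ≠ β) (y : Simple e 𝒷 β) : MulOpposite.op (e α) • y = 0 := by
  obtain ⟨b, rfl⟩ := Submodule.Quotient.mk_surjective _ y
  rw [← Submodule.Quotient.mk_smul, Submodule.Quotient.mk_eq_zero]
  change b * e α ∈ simpleKernel e 𝒷 β
  have hsmul : ∀ (r : ℂ) (x : B), x ∈ simpleKernel e 𝒷 β → r • x ∈ simpleKernel e 𝒷 β :=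
    fun r x hx => ((simpleKernel e 𝒷 β).restrictScalars ℂ).smul_mem r hx
  obtain ⟨b₀, h₀, b₁, h₁, rfl⟩ := Submodule.mem_sup.1 (hspan b)
  rw [add_mul]
  refine add_mem ?_ ?_
  · induction h₀ using Submodule.span_induction with
    | mem x hx =>
      obtain ⟨γ, rfl⟩ := hx
      by_cases hγ : γ = α
      · subst hγ
        rw [(he.idem γ).eq]
        exact Submodule.subset_span (Or.inr ⟨γ, h, rfl⟩)
      · rw [he.ortho hγ]
        exact zero_mem _
    | zero => simp
    | add x y _ _ hx hy => rw [add_mul]; exact add_mem hx hy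
    | smul r x _ hx => rw [smul_mul_assoc]; exact hsmul _ _ hx
  · refine (simpleKernel e 𝒷 β).smul_mem (MulOpposite.op (e α)) ?_
    induction h₁ using Submodule.span_induction with
    | mem x hx => exact Submodule.subset_span (Or.inl hx)
    | zero => simp
    | add x y _ _ hx hy => exact add_mem hx hy
    | smul r x _ hx => exact hsmul _ _ hx

/-- `e_α V_α e_α` is spanned by the class of `e_α`. -/
lemma IsQuasiHereditary.exists_smul_idem_sub_mem (hQ : IsQuasiHereditary e 𝒷)
    (he : CompleteOrthogonalIdempotents e)
    (hspan : ∀ b : B, b ∈ Submodule.span ℂ (Set.range e) ⊔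
      Submodule.span ℂ {x | ∃ k, 0 < k ∧ x ∈ 𝒷 k})
    (hmul : ∀ α k, ∀ x ∈ 𝒷 k, e α * x ∈ 𝒷 k) (α : I) (a : B) :
    ∃ r : ℂ, e α * a * e α - r • e α ∈ upperPart e α := by
  -- The radical of V_α has only layers L_β with β < α, all annihilated by e_α.
  have hrad := (hQ α).1.op_smul_eq_zero (he.idem α)
    (fun β hβ y => op_idem_smul_simple he hspan (ne_of_gt hβ) y)
  have key : ∀ x ∈ simpleKernel e 𝒷 α, e α * x ∈ simpleKernel e 𝒷 α →
      e α * x * e α ∈ upperPart e α := by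
    intro x _ hx
    have h1 := hrad ⟨standardMk ℂ α x, by
      refine Submodule.mem_map.2 ⟨⟨e α * x, idem_mul_mem_projective α x⟩, hx, rfl⟩⟩
    have h2 : MulOpposite.op (e α) • standardMk ℂ α x = 0 := congr_arg Subtype.val h1
    rw [op_smul_standardMk, standardMk_eq_zero_iff_mem_upperPart, ← mul_assoc] at h2
    exact h2
  -- The idempotent part of a yields the scalar multiple of e_α; the part of positive degree lands
  -- in the radical of V_α and so contributes nothing.
  obtain ⟨b₀, h₀, b₁, h₁, rfl⟩ := Submodule.mem_sup.1 (hspan a)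
  have hC : ∀ (r : ℂ) (x : B), x ∈ upperPart e α → r • x ∈ upperPart e α :=
    fun r x hx => ((upperPart e α).restrictScalars ℂ).smul_mem r hx
  have H0 : ∃ r : ℂ, e α * b₀ * e α = r • e α := by
    induction h₀ using Submodule.span_induction with
    | mem x hx =>
      obtain ⟨γ, rfl⟩ := hx
      by_cases hγ : γ = α
      · subst hγ
        exact ⟨1, by simp [(he.idem γ).eq]⟩
      · exact ⟨0, by simp [mul_assoc, he.ortho hγ]⟩
    | zero => exact ⟨0, by simp⟩
    | add x y _ _ hx hy =>
      obtain ⟨r, hr⟩ := hx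
      obtain ⟨s, hs⟩ := hy
      exact ⟨r + s, by rw [mul_add, add_mul, hr, hs, add_smul]⟩
    | smul r x _ hx =>
      obtain ⟨s, hs⟩ := hx
      exact ⟨r * s, by rw [mul_smul_comm, smul_mul_assoc, hs, smul_smul]⟩
  have H1 : e α * b₁ * e α ∈ upperPart e α := by
    clear H0
    induction h₁ using Submodule.span_induction with
    | mem x hx =>
      obtain ⟨k, hk, hx⟩ := hx
      exact key x (Submodule.subset_span (Or.inl ⟨k, hk, hx⟩))
        (Submodule.subset_span (Or.inl ⟨k, hk, hmul α k x hx⟩))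
    | zero => simp
    | add x y _ _ hx hy => rw [mul_add, add_mul]; exact add_mem hx hy
    | smul r x _ hx => rw [mul_smul_comm, smul_mul_assoc]; exact hC _ _ hx
  obtain ⟨r, hr⟩ := H0
  exact ⟨r, by rw [mul_add, add_mul, hr, add_sub_cancel_left]; exact H1⟩

variable [FiniteDimensional ℂ B]

instance (N : Submodule Bᵐᵒᵖ B) : FiniteDimensional ℂ N :=
  inferInstanceAs (FiniteDimensional ℂ (N.restrictScalars ℂ))

instance (N : Submodule Bᵐᵒᵖ B) (N' : Submodule Bᵐᵒᵖ N) : FiniteDimensional ℂ N' :=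
  inferInstanceAs (FiniteDimensional ℂ (N'.restrictScalars ℂ))

/-- The element lies in the kernel of P_α → V_α, whose layers V_δ with δ > α are each generated by
the class of e_δ. Hence the kernel lies in the trace of these idempotents. -/
lemma IsQuasiHereditary.idem_mul_mul_idem_mem (hQ : IsQuasiHereditary e 𝒷)
    (he : OrthogonalIdempotents e)
    (hdiag : ∀ α a, ∃ r : ℂ, e α * a * e α - r • e α ∈ upperPart e α)
    (α γ : I) (h : ¬ γ ≤ α) (a : B) : e α * a * e γ ∈ traceSpan ℂ e {γ | α < γ} := by
  have h1 := ((hQ α).2.exists_multiplicities he hdiag).1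
    ⟨⟨e α * a * e γ, by rw [mul_assoc]; exact idem_mul_mem_projective α _⟩,
      mul_idem_mem_upperPart he h a⟩
  have h2 := Submodule.mem_map_of_mem
    (f := ((projective e α).subtype ∘ₗ Submodule.subtype _).restrictScalars ℂ) h1
  rw [Submodule.map_span] at h2
  refine Submodule.span_le.2 ?_ h2
  rintro _ ⟨_, ⟨δ, hδ, b, z, rfl⟩, rfl⟩
  change ((z : projective e α) : B) * (e δ * b) ∈ traceSpan ℂ e {γ | α < γ}
  rw [← mul_assoc]
  exact mul_idem_mul_mem_traceSpan hδ _ b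

/-- The inequality half of Brauer–Humphreys reciprocity: the products of the dimensions of
the right and left standard modules add up to at most `dim B`. -/
lemma IsQuasiHereditary.sum_le_finrank (hQ : IsQuasiHereditary e 𝒷)
    (he : CompleteOrthogonalIdempotents e)
    (hdiag : ∀ α a, ∃ r : ℂ, e α * a * e α - r • e α ∈ upperPart e α) :
    ∑ α, Module.finrank ℂ (LinearMap.range (columnMk (e := e) ℂ α)) *
      Module.finrank ℂ (Standard e α) ≤ Module.finrank ℂ B := by
  classical
  have hup : ∀ α γ : I, ¬ γ ≤ α → ∀ a, e α * a * e γ ∈ traceSpan ℂ e {γ | α < γ} :=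
    hQ.idem_mul_mul_idem_mem he.toOrthogonalIdempotents hdiag
  have hex := fun γ => ((hQ γ).2.exists_multiplicities he.toOrthogonalIdempotents hdiag).2
  choose c hc hs using hex
  -- the components of a projective module
  have hcomp : ∀ γ α, ∃ t : Finset B, t.card ≤ c γ α + (if γ = α then 1 else 0) ∧
      ∀ b : B, e γ * b * e α ∈ Submodule.span ℂ (t : Set B) ⊔ traceSpan ℂ e {δ | α < δ} := by
    intro γ α
    obtain ⟨s, hs1, hs2⟩ := hs γ α
    let j : (upperPart e γ).submoduleOf (projective e γ) → B := fun z => ((z : projective e γ) : B)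
    have hs3 : ∀ x ∈ upperPart e γ, x * e α ∈
        Submodule.span ℂ (s.image j : Set B) ⊔
          traceSpan ℂ e {δ | α < δ} := by
      intro x hx
      have h1 := hs2 ⟨⟨x, by
        rw [← idem_mul_of_mem_upperPart he.toOrthogonalIdempotents hx]
        exact idem_mul_mem_projective γ x⟩, hx⟩
      have h2 := Submodule.mem_map_of_mem
        (f := ((projective e γ).subtype ∘ₗ Submodule.subtype _).restrictScalars ℂ) h1
      rw [Submodule.map_sup, Submodule.map_span, Submodule.map_span] at h2
      refine SetLike.le_def.1 (sup_le_sup (Submodule.span_mono ?_) (Submodule.span_le.2 ?_)) h2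
      · rintro _ ⟨z, hz, rfl⟩
        exact Finset.mem_coe.2 (Finset.mem_image_of_mem j hz)
      · rintro _ ⟨_, ⟨δ, hδ, b, z, rfl⟩, rfl⟩
        change ((z : projective e γ) : B) * (e δ * b) ∈ traceSpan ℂ e {δ | α < δ}
        rw [← mul_assoc]
        exact mul_idem_mul_mem_traceSpan hδ _ b
    by_cases hγα : γ = α
    · subst hγα
      refine ⟨insert (e γ) (s.image j), ?_, fun b => ?_⟩
      · refine (Finset.card_insert_le _ _).trans ?_
        simpa using Finset.card_image_le.trans hs1
      · obtain ⟨r, hr⟩ := hdiag γ b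
        have h1 := hs3 _ hr
        rw [sub_mul, smul_mul_assoc, mul_assoc, (he.idem γ).eq] at h1
        have h2 : e γ * b * e γ = (e γ * b * e γ - r • e γ) + r • e γ := by simp
        rw [h2]
        refine add_mem (SetLike.le_def.1 (sup_le_sup_right (Submodule.span_mono ?_) _) h1)
          (Submodule.mem_sup_left (Submodule.smul_mem _ _ (Submodule.subset_span (by simp))))
        rw [Finset.coe_insert]
        exact Set.subset_insert _ _
    · refine ⟨s.image j, ?_, fun b => ?_⟩
      · simpa [hγα] using Finset.card_image_le.trans hs1
      -- If α < γ the component e_γ B e_α is already in the trace of the idempotents above α. If α ≰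
      -- γ it lies in the kernel of P_γ → V_γ, where the multiplicities `c` bound it.
      · by_cases hle : α ≤ γ
        · have hlt : α < γ := lt_of_le_of_ne hle (Ne.symm hγα)
          rw [mul_assoc]
          exact Submodule.mem_sup_right (idem_mul_mem_traceSpan hlt _)
        · have := hs3 _ (mul_idem_mem_upperPart he.toOrthogonalIdempotents hle b)
          rwa [mul_assoc, (he.idem α).eq] at this
  choose t ht1 ht2 using hcomp
  -- The column at α is the sum of its e_γ-components, and each needs at most (P_γ : V_α) generators
  -- modulo the trace. The extra 1 at γ = α is the top layer V_γ of P_γ.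
  have hcol : ∀ α, Module.finrank ℂ (LinearMap.range (columnMk (e := e) ℂ α)) ≤
      ∑ γ, (c γ α + if γ = α then 1 else 0) := by
    intro α
    let q := (traceSpan ℂ e {δ | α < δ}).mkQ
    let t' : Finset (B ⧸ traceSpan ℂ e {δ | α < δ}) := Finset.univ.biUnion fun γ => (t γ α).image q
    have hle : LinearMap.range (columnMk (e := e) ℂ α) ≤ Submodule.span ℂ (t' : Set _) := by
      rintro _ ⟨b, rfl⟩
      change q (b * e α) ∈ _
      rw [← one_mul b, ← he.complete, Finset.sum_mul, Finset.sum_mul, map_sum]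
      refine sum_mem fun γ _ => ?_
      have h1 := Submodule.mem_map_of_mem (f := q) (ht2 γ α b)
      have h2 : Submodule.map q (traceSpan ℂ e {δ | α < δ}) = ⊥ := by
        exact Submodule.mkQ_map_self _
      rw [Submodule.map_sup, h2, sup_bot_eq, Submodule.map_span] at h1
      refine Submodule.span_mono ?_ h1
      rintro _ ⟨x, hx, rfl⟩
      exact Finset.mem_coe.2 (Finset.mem_biUnion.2
        ⟨γ, Finset.mem_univ γ, Finset.mem_image_of_mem _ hx⟩)
    refine (Submodule.finrank_mono hle).trans ((finrank_span_finset_le_card t').trans ?_)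
    refine Finset.card_biUnion_le.trans (Finset.sum_le_sum fun γ _ => ?_)
    exact Finset.card_image_le.trans (ht1 γ α)
  have hproj : ∀ γ, Module.finrank ℂ (projective e γ) =
      ∑ α, (c γ α + if γ = α then 1 else 0) * Module.finrank ℂ (Standard e α) := by
    intro γ
    have h1 := Submodule.finrank_quotient_add_finrank
      (((upperPart e γ).submoduleOf (projective e γ)).restrictScalars ℂ)
    have h2 : Module.finrank ℂ (((upperPart e γ).submoduleOf (projective e γ)).restrictScalars ℂ) =
      ∑ α, c γ α * Module.finrank ℂ (Standard e α) := hc γ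
    have h3 : Module.finrank ℂ (projective e γ ⧸
      ((upperPart e γ).submoduleOf (projective e γ)).restrictScalars ℂ) =
        Module.finrank ℂ (Standard e γ) := rfl
    rw [h2, h3] at h1
    rw [← h1]
    simp [add_mul, Finset.sum_add_distrib, add_comm]
  -- The right ideals e_γ B are independent, since left multiplication by e_γ recovers the component
  -- at γ.
  have hB : ∑ γ, Module.finrank ℂ (projective e γ) ≤ Module.finrank ℂ B := by
    rw [← Module.finrank_pi_fintype ℂ]
    let f : (∀ γ, projective e γ) →ₗ[ℂ] B :=
      ∑ γ, ((projective e γ).subtype.restrictScalars ℂ) ∘ₗ LinearMap.proj γ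
    refine LinearMap.finrank_le_finrank_of_injective (f := f) ?_
    refine (injective_iff_map_eq_zero f).2 fun p hp => ?_
    ext γ
    have h1 : e γ * f p = p γ := by
      simp only [f, LinearMap.sum_apply, LinearMap.comp_apply, LinearMap.proj_apply,
        LinearMap.restrictScalars_apply, Submodule.subtype_apply, Finset.mul_sum]
      rw [Finset.sum_eq_single γ]
      · exact idem_mul_of_mem_projective he.toOrthogonalIdempotents (p γ).2
      · intro δ _ hδ
        rw [← idem_mul_of_mem_projective he.toOrthogonalIdempotents (p δ).2, ← mul_assoc,
          he.ortho hδ.symm, zero_mul]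
      · simp
    rw [← h1, hp]
    simp
  calc _ ≤ ∑ α, (∑ γ, (c γ α + if γ = α then 1 else 0)) * Module.finrank ℂ (Standard e α) :=
        Finset.sum_le_sum fun α _ => Nat.mul_le_mul_right _ (hcol α)
    _ = ∑ γ, Module.finrank ℂ (projective e γ) := by
        simp_rw [hproj, Finset.sum_mul]
        exact Finset.sum_comm
    _ ≤ _ := hB

end QuasiHereditaryConsequences

/-! ### Graded algebras over a symmetric algebra and Nakayama's lemma -/

section Nakayama

open DirectSum

variable {U : Type u} [AddCommGroup U] [Module ℂ U] {D : Type v} [Ring D] [Algebra ℂ D]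
  [Algebra (SymmetricAlgebra ℂ U) D] [IsScalarTower ℂ (SymmetricAlgebra ℂ U) D]
  (𝒟 : ℕ → Submodule ℂ D) [GradedAlgebra 𝒟]

lemma iota_smul_mem
    (hι : ∀ u : U, algebraMap (SymmetricAlgebra ℂ U) D (SymmetricAlgebra.ι ℂ U u) ∈ 𝒟 2)
    (u : U) {k : ℕ} {x : D} (hx : x ∈ 𝒟 k) : SymmetricAlgebra.ι ℂ U u • x ∈ 𝒟 (k + 2) := by
  rw [Algebra.smul_def, add_comm]
  exact SetLike.mul_mem_graded (hι u) hx

/-- The elements all of whose homogeneous components lie in the `Sym U`-submodule `N`. -/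
def homogeneousCore
    (hι : ∀ u : U, algebraMap (SymmetricAlgebra ℂ U) D (SymmetricAlgebra.ι ℂ U u) ∈ 𝒟 2)
    (N : Submodule (SymmetricAlgebra ℂ U) D) : Submodule (SymmetricAlgebra ℂ U) D where
  carrier := {x | ∀ k, (decompose 𝒟 x k : D) ∈ N}
  add_mem' hx hy k := by
    rw [decompose_add, DirectSum.add_apply, Submodule.coe_add]
    exact add_mem (hx k) (hy k)
  zero_mem' k := by simp
  smul_mem' s x hx := by
    induction s using SymmetricAlgebra.induction generalizing x with
    | algebraMap r =>
      intro k
      rw [algebraMap_smul, decompose_smul, DirectSum.smul_apply, Submodule.coe_smul]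
      rw [← algebraMap_smul (SymmetricAlgebra ℂ U) r]
      exact N.smul_mem _ (hx k)
    | ι u =>
      intro k
      rw [Algebra.smul_def, coe_decompose_mul_of_left_mem 𝒟 k (hι u)]
      split_ifs
      · rw [← Algebra.smul_def]
        exact N.smul_mem _ (hx _)
      · exact zero_mem _
    | mul a b ha hb => rw [mul_smul]; exact ha _ (hb _ hx)
    | add a b ha hb =>
      intro k
      rw [add_smul, decompose_add, DirectSum.add_apply, Submodule.coe_add]
      exact add_mem (ha x hx k) (hb x hx k)

variable {𝒟}
  (hι : ∀ u : U, algebraMap (SymmetricAlgebra ℂ U) D (SymmetricAlgebra.ι ℂ U u) ∈ 𝒟 2)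

lemma mem_homogeneousCore_of_mem {N : Submodule (SymmetricAlgebra ℂ U) D} {k : ℕ} {x : D}
    (hx : x ∈ 𝒟 k) (hN : x ∈ N) : x ∈ homogeneousCore 𝒟 hι N := by
  intro i
  by_cases h : k = i
  · subst h
    rwa [decompose_of_mem_same 𝒟 hx]
  · rw [decompose_of_mem_ne 𝒟 hx h]
    exact zero_mem _

lemma homogeneousCore_mono {N N' : Submodule (SymmetricAlgebra ℂ U) D} (h : N ≤ N') :
    homogeneousCore 𝒟 hι N ≤ homogeneousCore 𝒟 hι N' :=
  fun _ hx k => h (hx k)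

lemma span_le_homogeneousCore {s : Set D} (hs : ∀ x ∈ s, ∃ k, x ∈ 𝒟 k) :
    Submodule.span (SymmetricAlgebra ℂ U) s ≤
      homogeneousCore 𝒟 hι (Submodule.span (SymmetricAlgebra ℂ U) s) := by
  refine Submodule.span_le.2 fun x hx => ?_
  obtain ⟨k, hk⟩ := hs x hx
  exact mem_homogeneousCore_of_mem hι hk (Submodule.subset_span hx)

lemma sup_le_homogeneousCore {N N' : Submodule (SymmetricAlgebra ℂ U) D}
    (hN : N ≤ homogeneousCore 𝒟 hι N) (hN' : N' ≤ homogeneousCore 𝒟 hι N') :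
    N ⊔ N' ≤ homogeneousCore 𝒟 hι (N ⊔ N') :=
  sup_le (hN.trans (homogeneousCore_mono hι le_sup_left))
    (hN'.trans (homogeneousCore_mono hι le_sup_right))

lemma traceSpan_le_homogeneousCore {I : Type w} {e : I → D} (he : ∀ γ, e γ ∈ 𝒟 0) (T : Set I) :
    traceSpan (SymmetricAlgebra ℂ U) e T ≤
      homogeneousCore 𝒟 hι (traceSpan (SymmetricAlgebra ℂ U) e T) := by
  refine Submodule.span_le.2 ?_
  rintro _ ⟨a, b, γ, hγ, rfl⟩
  induction a using Decomposition.inductionOn 𝒟 with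
  | zero => simp
  | add a a' ha ha' => rw [add_mul, add_mul]; exact add_mem ha ha'
  | @homogeneous i a =>
    induction b using Decomposition.inductionOn 𝒟 with
    | zero => simp
    | add b b' hb hb' => rw [mul_add]; exact add_mem hb hb'
    | @homogeneous j b =>
      exact mem_homogeneousCore_of_mem hι
        (SetLike.mul_mem_graded (SetLike.mul_mem_graded a.2 (he γ)) b.2)
        (mul_idem_mul_mem_traceSpan hγ _ _)

variable {A : Type w} [Ring A] [Algebra ℂ A] {π : D →ₐ[ℂ] A}
  (hker : RingHom.ker π = Ideal.span
    (Set.range fun u : U => algebraMap (SymmetricAlgebra ℂ U) D (SymmetricAlgebra.ι ℂ U u)))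

include hker

/-- U acts by zero on A, so A is the fibre at the origin: S acts through the augmentation
`algebraMapInv`. -/
lemma map_smul_of_ker (s : SymmetricAlgebra ℂ U) (x : D) :
    π (s • x) = (SymmetricAlgebra.algebraMapInv s : ℂ) • π x := by
  induction s using SymmetricAlgebra.induction generalizing x with
  | algebraMap r => rw [algebraMap_smul, map_smul, SymmetricAlgebra.algebraMap_leftInverse]
  | ι u =>
    have : algebraMap (SymmetricAlgebra ℂ U) D (SymmetricAlgebra.ι ℂ U u) ∈ RingHom.ker π := by
      rw [hker]
      exact Ideal.subset_span ⟨u, rfl⟩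
    rw [SymmetricAlgebra.algebraMapInv_ι, zero_smul, Algebra.smul_def, map_mul,
      (RingHom.mem_ker).1 this, zero_mul]
  | mul a b ha hb => rw [mul_smul, ha, hb, map_mul, mul_smul]
  | add a b ha hb => rw [add_smul, map_add, ha, hb, map_add, add_smul]

include hι

/-- The kernel is U·D and U has degree two, so a homogeneous component of a kernel element comes
from strictly smaller degree. This drop is what the induction in Nakayama's lemma uses. -/
lemma decompose_mem_span_of_mem_ker {x : D} (hx : π x = 0) (k : ℕ) :
    (decompose 𝒟 x k : D) ∈ Submodule.span ℂ
      {y | ∃ (u : U) (i : ℕ), i + 2 = k ∧ ∃ d ∈ 𝒟 i, y = SymmetricAlgebra.ι ℂ U u • d} := by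
  have h1 : x ∈ Ideal.span (Set.range fun u : U =>
      algebraMap (SymmetricAlgebra ℂ U) D (SymmetricAlgebra.ι ℂ U u)) := by
    rw [← hker]
    exact hx
  obtain ⟨c, rfl⟩ := (Finsupp.mem_ideal_span_range_iff_exists_finsupp).1 h1
  rw [Finsupp.sum, decompose_sum, DirectSum.sum_apply, AddSubmonoidClass.coe_finsetSum]
  refine sum_mem fun u _ => ?_
  rw [coe_decompose_mul_of_right_mem 𝒟 k (hι u)]
  split_ifs with h
  · refine Submodule.subset_span ⟨u, k - 2, Nat.sub_add_cancel h, _,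
      (decompose 𝒟 (c u) (k - 2)).2, ?_⟩
    rw [← Algebra.commutes, Algebra.smul_def]
  · exact zero_mem _

/-- Graded Nakayama's lemma for the image of a homogeneous projection. -/
lemma apply_mem_of_map_mem (P : D →ₗ[SymmetricAlgebra ℂ U] D)
    (hP : ∀ k, ∀ x ∈ 𝒟 k, P x ∈ 𝒟 k) (hPP : ∀ x, P (P x) = P x)
    (N : Submodule (SymmetricAlgebra ℂ U) D) (hN : N ≤ homogeneousCore 𝒟 hι N)
    (hPN : ∀ n ∈ N, P n ∈ N) (h : ∀ k, ∀ x ∈ 𝒟 k, ∃ n ∈ N, π (P x) = π n) (x : D) : P x ∈ N := by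
  suffices H : ∀ k, ∀ x ∈ 𝒟 k, P x ∈ N by
    induction x using Decomposition.inductionOn 𝒟 with
    | zero => simp
    | add x y hx hy => rw [map_add]; exact add_mem hx hy
    | @homogeneous i x => exact H i x x.2
  intro k
  induction k using Nat.strong_induction_on with
  | _ k ih =>
    intro x hx
    obtain ⟨n, hn, hxn⟩ := h k x hx
    have h1 := decompose_mem_span_of_mem_ker hι hker
      (x := P x - n) (by rw [map_sub, hxn, sub_self]) k
    rw [decompose_sub, DirectSum.sub_apply, AddSubgroupClass.coe_sub,
      decompose_of_mem_same 𝒟 (hP k x hx)] at h1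
    -- The difference is a combination of elements u·d with d of degree k - 2, to which the
    -- induction hypothesis applies after P.
    have h2 : P (P x - decompose 𝒟 n k) ∈ N := by
      generalize P x - (decompose 𝒟 n k : D) = z at h1
      induction h1 using Submodule.span_induction with
      | mem y hy =>
        obtain ⟨u, i, hi, d, hd, rfl⟩ := hy
        rw [map_smul]
        exact N.smul_mem _ (ih i (by omega) d hd)
      | zero => simp
      | add y z _ _ hy hz => rw [map_add]; exact add_mem hy hz
      | smul r y _ hy =>
        rw [← algebraMap_smul (SymmetricAlgebra ℂ U) r, map_smul]
        exact N.smul_mem _ hy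
    rw [map_sub, hPP] at h2
    have h3 := add_mem h2 (hPN _ (hN hn k))
    rwa [sub_add_cancel] at h3

end Nakayama

/-! ### Lifting linear independence to flat modules -/

section Flat

variable {S : Type*} [CommRing S] [IsDomain S] [Algebra ℂ S] (ev : S →ₐ[ℂ] ℂ)

/-- If the specialization of a matrix has independent rows, some combination of its columns is a
square matrix with determinant specializing to `1`. -/
lemma exists_det_eq_one {ι κ : Type*} [Fintype ι] [DecidableEq ι] [Fintype κ] [DecidableEq κ]
    (a : Matrix ι κ S) (h : ∀ c : ι → ℂ, Matrix.vecMul c (a.map ev) = 0 → c = 0) :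
    ∃ b : Matrix κ ι ℂ, ev (a * b.map (algebraMap ℂ S)).det = 1 := by
  -- Independent rows over ℂ give the specialized matrix a right inverse. Its complex entries serve
  -- as constants in S.
  obtain ⟨g, hg⟩ := LinearMap.exists_leftInverse_of_injective (Matrix.vecMulLinear (a.map ev))
    (LinearMap.ker_eq_bot'.2 h)
  refine ⟨(LinearMap.toMatrix' g).transpose, ?_⟩
  have h1 : a.map ev * (LinearMap.toMatrix' g).transpose = 1 := by
    rw [← Matrix.transpose_inj, Matrix.transpose_mul, Matrix.transpose_transpose,
      Matrix.transpose_one]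
    have h2 : (a.map ev).transpose = LinearMap.toMatrix' (Matrix.vecMulLinear (a.map ev)) := by
      ext i j
      simp [LinearMap.toMatrix'_apply]
    rw [h2, ← LinearMap.toMatrix'_comp, hg, LinearMap.toMatrix'_id]
  have h3 : ev.mapMatrix (a * (LinearMap.toMatrix' g).transpose.map (algebraMap ℂ S)) = 1 := by
    rw [AlgHom.mapMatrix_apply, ← AlgHom.coe_toRingHom, Matrix.map_mul, ← h1, Matrix.map_map]
    congr 1
    ext i j
    simp
  rw [AlgHom.map_det, h3, Matrix.det_one]

variable {D A : Type*} [AddCommGroup D] [Module S D] [AddCommGroup A] [Module ℂ A]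
  {ev} {π : D →+ A} (hπ : ∀ s d, π (s • d) = ev s • π d)

include hπ in
-- By the equational criterion for flatness, a relation f comes from a factorization b_i = Σ a_{ij}
-- y_j with f·a = 0. Independence of the π(b_i) forces the specialization of a to have independent
-- rows, so a has a square combination of columns with nonzero determinant over the domain S, and f
-- = 0.
lemma linearIndependent_of_flat [Module.Flat S D] {ι : Type*} [Fintype ι] (b : ι → D)
    (hb : LinearIndependent ℂ (fun i => π (b i))) : LinearIndependent S b := by
  classical
  refine Fintype.linearIndependent_iff.2 fun f hf => ?_
  obtain ⟨k, a, y, hay, hfa⟩ := Module.Flat.isTrivialRelation_of_sum_smul_eq_zero hf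
  obtain ⟨c, hc⟩ := exists_det_eq_one ev (Matrix.of a) (fun r hr => by
    refine funext (Fintype.linearIndependent_iff.1 hb r ?_)
    simp_rw [hay, map_sum, hπ, Finset.smul_sum, smul_smul]
    rw [Finset.sum_comm]
    refine Finset.sum_eq_zero fun j _ => ?_
    rw [← Finset.sum_smul]
    have := congr_fun hr j
    simp only [Matrix.vecMul, dotProduct, Matrix.map_apply, Matrix.of_apply, Pi.zero_apply] at this
    rw [this, zero_smul])
  have h1 : Matrix.vecMul f (Matrix.of a * c.map (algebraMap ℂ S)) = 0 := by
    have h2 : Matrix.vecMul f (Matrix.of a) = 0 := funext hfa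
    rw [← Matrix.vecMul_vecMul, h2, Matrix.zero_vecMul]
  exact congr_fun (Matrix.eq_zero_of_vecMul_eq_zero (fun h0 => by simp [h0] at hc) h1)

end Flat

/-! ### Bases of deformed standard modules -/

section StandardBasis

variable {U : Type u} [AddCommGroup U] [Module ℂ U] {D : Type v} [Ring D] [Algebra ℂ D]
  [Algebra (SymmetricAlgebra ℂ U) D] [IsScalarTower ℂ (SymmetricAlgebra ℂ U) D]
  {𝒟 : ℕ → Submodule ℂ D} [GradedAlgebra 𝒟]
  (hι : ∀ u : U, algebraMap (SymmetricAlgebra ℂ U) D (SymmetricAlgebra.ι ℂ U u) ∈ 𝒟 2)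
  {A : Type w} [Ring A] [Algebra ℂ A] {π : D →ₐ[ℂ] A} (hsurj : Function.Surjective π)
  (hker : RingHom.ker π = Ideal.span
    (Set.range fun u : U => algebraMap (SymmetricAlgebra ℂ U) D (SymmetricAlgebra.ι ℂ U u)))

include hsurj in
-- Images of homogeneous elements span the range, so a basis can be picked among them. Homogeneity
-- is what graded Nakayama demands of the lifts.
lemma exists_homogeneous_lift (𝒟 : ℕ → Submodule ℂ D) [GradedAlgebra 𝒟]
    [FiniteDimensional ℂ A] {Q : Type*} [AddCommGroup Q] [Module ℂ Q] (g : A →ₗ[ℂ] Q) :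
    ∃ x : Fin (Module.finrank ℂ (LinearMap.range g)) → D, (∀ i, ∃ k, x i ∈ 𝒟 k) ∧
      LinearIndependent ℂ (fun i => g (π (x i))) ∧
      Submodule.span ℂ (Set.range fun i => g (π (x i))) = LinearMap.range g := by
  let s : Set Q := {y | ∃ k, ∃ x ∈ 𝒟 k, g (π x) = y}
  have hs : Submodule.span ℂ s = LinearMap.range g := by
    refine le_antisymm (Submodule.span_le.2 ?_) ?_
    · rintro _ ⟨k, x, -, rfl⟩
      exact ⟨π x, rfl⟩
    · rintro _ ⟨a, rfl⟩
      obtain ⟨d, rfl⟩ := hsurj a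
      induction d using DirectSum.Decomposition.inductionOn 𝒟 with
      | zero => simp
      | add x y hx hy => rw [map_add, map_add]; exact add_mem hx hy
      | @homogeneous i x => exact Submodule.subset_span ⟨i, x, x.2, rfl⟩
  have : Module.Finite ℂ (Submodule.span ℂ s) := by rw [hs]; infer_instance
  have hex := Submodule.exists_fun_fin_finrank_span_eq ℂ s
  rw [hs] at hex
  obtain ⟨f, hf, hfs, hfi⟩ := hex
  choose k x hxk hx using hf
  refine ⟨x, fun i => ⟨k i, hxk i⟩, ?_, ?_⟩
  · simpa only [hx] using hfi
  · simpa only [hx] using hfs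

variable {I : Type*} {e : I → D} {eA : I → A} (heA : ∀ α, π (e α) = eA α)

include hsurj heA in
lemma exists_mem_traceSpan {T : Set I} {x : A} (hx : x ∈ traceSpan ℂ eA T) :
    ∃ n ∈ traceSpan (SymmetricAlgebra ℂ U) e T, π n = x := by
  induction hx using Submodule.span_induction with
  | mem x hx =>
    obtain ⟨a, b, γ, hγ, rfl⟩ := hx
    obtain ⟨a, rfl⟩ := hsurj a
    obtain ⟨b, rfl⟩ := hsurj b
    exact ⟨_, mul_idem_mul_mem_traceSpan hγ a b, by simp [heA]⟩
  | zero => exact ⟨0, zero_mem _, map_zero π⟩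
  | add x y _ _ hx hy =>
    obtain ⟨n, hn, rfl⟩ := hx
    obtain ⟨m, hm, rfl⟩ := hy
    exact ⟨_, add_mem hn hm, map_add π n m⟩
  | smul r x _ hx =>
    obtain ⟨n, hn, rfl⟩ := hx
    refine ⟨r • n, ?_, map_smul π r n⟩
    rw [← algebraMap_smul (SymmetricAlgebra ℂ U) r]
    exact Submodule.smul_mem _ _ hn

variable [Fintype I] [PartialOrder I] (he : CompleteOrthogonalIdempotents e)
  (he0 : ∀ α, e α ∈ 𝒟 0)
  (hupA : ∀ α γ : I, ¬ γ ≤ α → ∀ a, eA α * a * eA γ ∈ traceSpan ℂ eA {γ | α < γ})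
  (hdiagA : ∀ α a, ∃ r : ℂ, eA α * a * eA α - r • eA α ∈ upperPart eA α)

include he0 in
lemma mulLeft_idem_apply_mem {α : I} {k : ℕ} {x : D} (hx : x ∈ 𝒟 k) : e α * x ∈ 𝒟 k := by
  simpa using SetLike.mul_mem_graded (he0 α) hx

include he0 in
lemma mulRight_idem_apply_mem {α : I} {k : ℕ} {x : D} (hx : x ∈ 𝒟 k) : x * e α ∈ 𝒟 k := by
  simpa using SetLike.mul_mem_graded hx (he0 α)

include hι hsurj hker heA he he0 hupA

/-- Graded Nakayama for the projection d ↦ e_α d e_γ, which preserves degrees because the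
idempotents have degree zero. -/
lemma idem_mul_mul_idem_mem_traceSpan (α γ : I) (h : ¬ γ ≤ α) (d : D) :
    e α * d * e γ ∈ traceSpan (SymmetricAlgebra ℂ U) e {γ | α < γ} := by
  refine apply_mem_of_map_mem hι hker
    (LinearMap.mulRight _ (e γ) ∘ₗ LinearMap.mulLeft _ (e α)) ?_ ?_ _
    (traceSpan_le_homogeneousCore hι he0 _) ?_ ?_ d
  · intro k x hx
    exact mulRight_idem_apply_mem he0 (mulLeft_idem_apply_mem he0 hx)
  · intro x
    change e α * (e α * x * e γ) * e γ = e α * x * e γ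
    rw [← mul_assoc, ← mul_assoc, (he.idem α).eq, mul_assoc, (he.idem γ).eq]
  · intro n hn
    exact mul_right_mem_traceSpan _ (mul_left_mem_traceSpan _ hn)
  · intro k x _
    obtain ⟨n, hn, hn'⟩ := exists_mem_traceSpan (U := U) (e := e) hsurj heA (hupA α γ h (π x))
    refine ⟨n, hn, ?_⟩
    simp [hn', heA]

include hdiagA in
lemma idem_mul_mul_idem_mem_sup (α : I) (d : D) :
    e α * d * e α ∈ Submodule.span (SymmetricAlgebra ℂ U) {e α} ⊔
      traceSpan (SymmetricAlgebra ℂ U) e {γ | α < γ} := by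
  refine apply_mem_of_map_mem hι hker
    (LinearMap.mulRight _ (e α) ∘ₗ LinearMap.mulLeft _ (e α)) ?_ ?_ _
    (sup_le_homogeneousCore hι (span_le_homogeneousCore hι (by simpa using ⟨0, he0 α⟩))
      (traceSpan_le_homogeneousCore hι he0 _)) ?_ ?_ d
  · intro k x hx
    exact mulRight_idem_apply_mem he0 (mulLeft_idem_apply_mem he0 hx)
  · intro x
    change e α * (e α * x * e α) * e α = e α * x * e α
    rw [← mul_assoc, ← mul_assoc, (he.idem α).eq, mul_assoc, (he.idem α).eq]
  · intro n hn
    obtain ⟨x, hx, y, hy, rfl⟩ := Submodule.mem_sup.1 hn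
    obtain ⟨s, rfl⟩ := Submodule.mem_span_singleton.1 hx
    rw [map_add]
    refine add_mem (Submodule.mem_sup_left (Submodule.mem_span_singleton.2 ⟨s, ?_⟩))
      (Submodule.mem_sup_right (mul_right_mem_traceSpan _ (mul_left_mem_traceSpan _ hy)))
    simp [(he.idem α).eq]
  · intro k x _
    obtain ⟨r, hr⟩ := hdiagA α (π x)
    obtain ⟨n, hn, hn'⟩ := exists_mem_traceSpan (U := U) (e := e) hsurj heA
      (upperPart_le_traceSpan ℂ (hupA α) hr)
    refine ⟨algebraMap ℂ (SymmetricAlgebra ℂ U) r • e α + n, add_mem (Submodule.mem_sup_left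
      (Submodule.smul_mem _ _ (Submodule.mem_span_singleton_self _)))
      (Submodule.mem_sup_right hn), ?_⟩
    rw [map_add, hn', algebraMap_smul, map_smul]
    simp [heA]

/-- Nakayama for d ↦ e_α d, applied to homogeneous lifts of a basis of V_α over A. Only generation
is obtained here; independence follows from the count of all products of rows and columns. -/
lemma exists_generators_row [FiniteDimensional ℂ A] (heA' : OrthogonalIdempotents eA) (α : I) :
    ∃ v : Fin (Module.finrank ℂ (Standard eA α)) → D, (∀ j, e α * v j = v j) ∧
      ∀ d, e α * d ∈ Submodule.span (SymmetricAlgebra ℂ U) (Set.range v) ⊔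
        traceSpan (SymmetricAlgebra ℂ U) e {γ | α < γ} := by
  have hex := exists_homogeneous_lift hsurj 𝒟 (rowMk (e := eA) ℂ α)
  rw [finrank_range_rowMk heA' (hupA α)] at hex
  obtain ⟨x, hx1, -, hx2⟩ := hex
  refine ⟨fun j => e α * x j, fun j => by rw [← mul_assoc, (he.idem α).eq], ?_⟩
  refine apply_mem_of_map_mem hι hker (LinearMap.mulLeft _ (e α)) ?_ ?_ _
    (sup_le_homogeneousCore hι (span_le_homogeneousCore hι ?_)
      (traceSpan_le_homogeneousCore hι he0 _)) ?_ ?_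
  · exact fun k x hx => mulLeft_idem_apply_mem he0 hx
  · intro x
    change e α * (e α * x) = e α * x
    rw [← mul_assoc, (he.idem α).eq]
  · rintro _ ⟨j, rfl⟩
    obtain ⟨k, hk⟩ := hx1 j
    exact ⟨k, mulLeft_idem_apply_mem he0 hk⟩
  · intro n hn
    obtain ⟨x', hx, y, hy, rfl⟩ := Submodule.mem_sup.1 hn
    rw [map_add]
    refine add_mem (Submodule.mem_sup_left ?_)
      (Submodule.mem_sup_right (mul_left_mem_traceSpan _ hy))
    have := Submodule.mem_map_of_mem (f := LinearMap.mulLeft (SymmetricAlgebra ℂ U) (e α)) hx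
    rw [Submodule.map_span] at this
    refine Submodule.span_mono ?_ this
    rintro _ ⟨_, ⟨j, rfl⟩, rfl⟩
    exact ⟨j, by simp [← mul_assoc, (he.idem α).eq]⟩
  · intro k d _
    have h1 : rowMk (e := eA) ℂ α (π d) ∈ LinearMap.range (rowMk (e := eA) ℂ α) := ⟨_, rfl⟩
    rw [← hx2] at h1
    obtain ⟨c, hc⟩ := (Submodule.mem_span_range_iff_exists_fun ℂ).1 h1
    have h2 : eA α * π d - ∑ j, c j • (eA α * π (x j)) ∈ traceSpan ℂ eA {γ | α < γ} := by
      rw [← Submodule.Quotient.mk_eq_zero, Submodule.Quotient.mk_sub, sub_eq_zero]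
      change rowMk (e := eA) ℂ α (π d) = Submodule.mkQ _ _
      rw [← hc, map_sum]
      simp only [map_smul]
      rfl
    obtain ⟨n, hn, hn'⟩ := exists_mem_traceSpan (U := U) (e := e) hsurj heA h2
    refine ⟨∑ j, algebraMap ℂ (SymmetricAlgebra ℂ U) (c j) • (e α * x j) + n,
      add_mem (Submodule.mem_sup_left (sum_mem fun j _ =>
        Submodule.smul_mem _ _ (Submodule.subset_span ⟨j, rfl⟩)))
      (Submodule.mem_sup_right hn), ?_⟩
    rw [map_add, hn', map_sum]
    simp only [algebraMap_smul, map_smul, map_mul, heA, LinearMap.mulLeft_apply]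
    simp

omit hupA in
lemma exists_generators_column [FiniteDimensional ℂ A] (α : I) :
    ∃ v : Fin (Module.finrank ℂ (LinearMap.range (columnMk (e := eA) ℂ α))) → D,
      ∀ d, d * e α ∈ Submodule.span (SymmetricAlgebra ℂ U) (Set.range v) ⊔
        traceSpan (SymmetricAlgebra ℂ U) e {γ | α < γ} := by
  obtain ⟨x, hx1, -, hx2⟩ := exists_homogeneous_lift hsurj 𝒟 (columnMk (e := eA) ℂ α)
  refine ⟨fun j => x j * e α, ?_⟩
  refine apply_mem_of_map_mem hι hker (LinearMap.mulRight _ (e α)) ?_ ?_ _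
    (sup_le_homogeneousCore hι (span_le_homogeneousCore hι ?_)
      (traceSpan_le_homogeneousCore hι he0 _)) ?_ ?_
  · exact fun k x hx => mulRight_idem_apply_mem he0 hx
  · intro x
    change x * e α * e α = x * e α
    rw [mul_assoc, (he.idem α).eq]
  · rintro _ ⟨j, rfl⟩
    obtain ⟨k, hk⟩ := hx1 j
    exact ⟨k, mulRight_idem_apply_mem he0 hk⟩
  · intro n hn
    obtain ⟨x', hx, y, hy, rfl⟩ := Submodule.mem_sup.1 hn
    rw [map_add]
    refine add_mem (Submodule.mem_sup_left ?_)
      (Submodule.mem_sup_right (mul_right_mem_traceSpan _ hy))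
    have := Submodule.mem_map_of_mem (f := LinearMap.mulRight (SymmetricAlgebra ℂ U) (e α)) hx
    rw [Submodule.map_span] at this
    refine Submodule.span_mono ?_ this
    rintro _ ⟨_, ⟨j, rfl⟩, rfl⟩
    exact ⟨j, by simp [mul_assoc, (he.idem α).eq]⟩
  · intro k d _
    have h1 : columnMk (e := eA) ℂ α (π d) ∈ LinearMap.range (columnMk (e := eA) ℂ α) := ⟨_, rfl⟩
    rw [← hx2] at h1
    obtain ⟨c, hc⟩ := (Submodule.mem_span_range_iff_exists_fun ℂ).1 h1
    have h2 : π d * eA α - ∑ j, c j • (π (x j) * eA α) ∈ traceSpan ℂ eA {γ | α < γ} := by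
      rw [← Submodule.Quotient.mk_eq_zero, Submodule.Quotient.mk_sub, sub_eq_zero]
      change columnMk (e := eA) ℂ α (π d) = Submodule.mkQ _ _
      rw [← hc, map_sum]
      simp only [map_smul]
      rfl
    obtain ⟨n, hn, hn'⟩ := exists_mem_traceSpan (U := U) (e := e) hsurj heA h2
    refine ⟨∑ j, algebraMap ℂ (SymmetricAlgebra ℂ U) (c j) • (x j * e α) + n,
      add_mem (Submodule.mem_sup_left (sum_mem fun j _ =>
        Submodule.smul_mem _ _ (Submodule.subset_span ⟨j, rfl⟩)))
      (Submodule.mem_sup_right hn), ?_⟩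
    rw [map_add, hn', map_sum]
    simp only [algebraMap_smul, map_smul, map_mul, heA, LinearMap.mulRight_apply]
    simp

end StandardBasis

/-- The structural properties of a deformed quasi-hereditary algebra `D` over `S` with
idempotents `e α`: its standard modules `V_α` are free of rank `n α > 0`, `e_α V_α e_α` is spanned
by `e_α`, and `D` is free of rank `∑ m α * n α`. -/
structure IsDeformedQuasiHereditary {I : Type u} [Fintype I] [PartialOrder I] (S : Type v)
    [CommRing S] {D : Type w} [Ring D] [Algebra S D] (e : I → D) (m n : I → ℕ) : Prop where
  complete : CompleteOrthogonalIdempotents e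
  upper : ∀ α γ : I, ¬ γ ≤ α → ∀ d, e α * d * e γ ∈ traceSpan S e {γ | α < γ}
  diag : ∀ α d, e α * d * e α ∈ Submodule.span S {e α} ⊔ traceSpan S e {γ | α < γ}
  pos : ∀ α, 0 < n α
  standard : ∀ α, Nonempty (Module.Basis (Fin (n α)) S (Standard e α))
  basis : Nonempty (Module.Basis (Σ α, Fin (m α) × Fin (n α)) S D)

/-! ### Freeness of the deformed algebra and of its standard modules -/

section Construction

variable {U : Type u} [AddCommGroup U] [Module ℂ U] {D : Type v} [Ring D] [Algebra ℂ D]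
  [Algebra (SymmetricAlgebra ℂ U) D] [IsScalarTower ℂ (SymmetricAlgebra ℂ U) D]
  {𝒟 : ℕ → Submodule ℂ D} [GradedAlgebra 𝒟]
  (hι : ∀ u : U, algebraMap (SymmetricAlgebra ℂ U) D (SymmetricAlgebra.ι ℂ U u) ∈ 𝒟 2)
  {A : Type w} [Ring A] [Algebra ℂ A] {π : D →ₐ[ℂ] A} (hsurj : Function.Surjective π)
  (hker : RingHom.ker π = Ideal.span
    (Set.range fun u : U => algebraMap (SymmetricAlgebra ℂ U) D (SymmetricAlgebra.ι ℂ U u)))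
  {I : Type*} {e : I → D} {eA : I → A} (heA : ∀ α, π (e α) = eA α)
  [Fintype I] [PartialOrder I] (he : CompleteOrthogonalIdempotents e)
  (he0 : ∀ α, e α ∈ 𝒟 0)
  (hupA : ∀ α γ : I, ¬ γ ≤ α → ∀ a, eA α * a * eA γ ∈ traceSpan ℂ eA {γ | α < γ})
  (hdiagA : ∀ α a, ∃ r : ℂ, eA α * a * eA α - r • eA α ∈ upperPart eA α)

/-- If `a α` generates `D e_α` and `v α` generates `e_α D`, each modulo the trace of the `e_γ` with
`γ > α`, then the products of the `a α` and the `v α` generate `D`. -/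
lemma span_mul_eq_top {S : Type*} [CommRing S] [Algebra S D] (he : CompleteOrthogonalIdempotents e)
    {m n : I → ℕ} (a : ∀ α, Fin (m α) → D) (v : ∀ α, Fin (n α) → D)
    (ha' : ∀ α d, d * e α ∈ Submodule.span S (Set.range (a α)) ⊔ traceSpan S e {γ | α < γ})
    (hv' : ∀ α d, e α * d ∈ Submodule.span S (Set.range (v α)) ⊔ traceSpan S e {γ | α < γ}) :
    (∀ α, traceSpan S e {γ | α < γ} ≤
      Submodule.span S {x | ∃ δ, α < δ ∧ ∃ i j, x = a δ i * v δ j}) ∧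
    Submodule.span S (Set.range fun p : Σ α, Fin (m α) × Fin (n α) =>
      a p.1 p.2.1 * v p.1 p.2.2) = ⊤ := by
  -- Descending induction on α. Writing d e_α d' as (d e_α)(e_α d') reduces it to products of
  -- generators at α and error terms in the trace of larger idempotents, covered by induction.
  have key : ∀ α, ∀ d d', d * e α * d' ∈
      Submodule.span S {x | ∃ δ, α ≤ δ ∧ ∃ i j, x = a δ i * v δ j} := by
    intro α
    induction α using WellFoundedGT.induction with
    | _ α ih =>
      have hJ : ∀ x ∈ traceSpan S e {γ | α < γ},
          x ∈ Submodule.span S {x | ∃ δ, α ≤ δ ∧ ∃ i j, x = a δ i * v δ j} := by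
        refine fun x hx => Submodule.span_le.2 ?_ hx
        rintro _ ⟨b, b', γ, hγ, rfl⟩
        refine Submodule.span_mono ?_ (ih γ hγ b b')
        rintro _ ⟨δ, hδ, i, j, rfl⟩
        exact ⟨δ, (le_of_lt hγ).trans hδ, i, j, rfl⟩
      intro d d'
      have h1 : d * e α * d' = (d * e α) * (e α * d') := by
        rw [mul_assoc, mul_assoc, ← mul_assoc (e α) (e α), (he.idem α).eq]
      obtain ⟨x, hx, y, hy, hxy⟩ := Submodule.mem_sup.1 (ha' α d)
      rw [h1, ← hxy, add_mul]
      refine add_mem ?_ (hJ _ (mul_right_mem_traceSpan _ hy))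
      clear hxy
      induction hx using Submodule.span_induction with
      | mem x hx =>
        obtain ⟨i, rfl⟩ := hx
        obtain ⟨z, hz, y', hy', hzy⟩ := Submodule.mem_sup.1 (hv' α d')
        rw [← hzy, mul_add]
        refine add_mem ?_ (hJ _ (mul_left_mem_traceSpan _ hy'))
        clear hzy
        induction hz using Submodule.span_induction with
        | mem z hz =>
          obtain ⟨j, rfl⟩ := hz
          exact Submodule.subset_span ⟨α, le_rfl, i, j, rfl⟩
        | zero => simp
        | add z z' _ _ hz hz' => rw [mul_add]; exact add_mem hz hz'
        | smul r z _ hz => rw [mul_smul_comm]; exact Submodule.smul_mem _ _ hz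
      | zero => simp
      | add x x' _ _ hx hx' => rw [add_mul]; exact add_mem hx hx'
      | smul r x _ hx => rw [smul_mul_assoc]; exact Submodule.smul_mem _ _ hx
  constructor
  · intro α
    refine Submodule.span_le.2 ?_
    rintro _ ⟨b, b', γ, hγ, rfl⟩
    refine Submodule.span_mono ?_ (key γ b b')
    rintro _ ⟨δ, hδ, i, j, rfl⟩
    exact ⟨δ, lt_of_lt_of_le hγ hδ, i, j, rfl⟩
  · refine eq_top_iff.2 fun x _ => ?_
    rw [← mul_one x, ← he.complete, Finset.mul_sum]
    refine sum_mem fun α _ => ?_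
    rw [← mul_one (x * e α)]
    refine Submodule.span_mono ?_ (key α x 1)
    rintro _ ⟨δ, -, i, j, rfl⟩
    exact ⟨⟨δ, i, j⟩, rfl⟩

include hι hsurj hker heA he he0 hupA hdiagA in
-- The products of column and row generators span D. Their images span A and are at most dim A many,
-- hence independent, and flatness lifts independence to D. A relation among the rows modulo the
-- trace becomes, after left multiplication by one column generator, a relation between basis
-- products at α and at δ > α, so it is trivial.
theorem isDeformedQuasiHereditary [Module.Flat (SymmetricAlgebra ℂ U) D] [FiniteDimensional ℂ A]
    (heA' : OrthogonalIdempotents eA) (hnot : ∀ α, eA α ∉ traceSpan ℂ eA {γ | α < γ})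
    (hsum : ∑ α, Module.finrank ℂ (LinearMap.range (columnMk (e := eA) ℂ α)) *
      Module.finrank ℂ (Standard eA α) ≤ Module.finrank ℂ A) :
    IsDeformedQuasiHereditary (SymmetricAlgebra ℂ U) e
      (fun α => Module.finrank ℂ (LinearMap.range (columnMk (e := eA) ℂ α)))
      (fun α => Module.finrank ℂ (Standard eA α)) := by
  classical
  choose v hv hv' using fun α => exists_generators_row hι hsurj hker heA he he0 hupA heA' α
  choose a ha' using fun α => exists_generators_column hι hsurj hker heA he he0 α
  obtain ⟨hJ, htop⟩ := span_mul_eq_top he a v ha' hv'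
  have hup := idem_mul_mul_idem_mem_traceSpan hι hsurj hker heA he he0 hupA
  -- The class of e_α in A/J_α is nonzero, so neither the column nor the row at α vanishes.
  have hmpos : ∀ α, 0 < Module.finrank ℂ (LinearMap.range (columnMk (e := eA) ℂ α)) := by
    intro α
    refine Module.finrank_pos_iff_exists_ne_zero.2 ⟨⟨_, ⟨1, rfl⟩⟩, fun h => hnot α ?_⟩
    have h1 : columnMk (e := eA) ℂ α 1 = 0 := congr_arg Subtype.val h
    have h2 := (Submodule.Quotient.mk_eq_zero _).1 h1
    simpa using h2
  have hnpos : ∀ α, 0 < Module.finrank ℂ (Standard eA α) := by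
    intro α
    rw [← finrank_range_rowMk (k := ℂ) heA' (hupA α)]
    refine Module.finrank_pos_iff_exists_ne_zero.2 ⟨⟨_, ⟨1, rfl⟩⟩, fun h => hnot α ?_⟩
    have h1 : rowMk (e := eA) ℂ α 1 = 0 := congr_arg Subtype.val h
    have h2 := (Submodule.Quotient.mk_eq_zero _).1 h1
    simpa using h2
  have hindA : LinearIndependent ℂ (fun p : Σ α,
      Fin (Module.finrank ℂ (LinearMap.range (columnMk (e := eA) ℂ α))) ×
        Fin (Module.finrank ℂ (Standard eA α)) => π (a p.1 p.2.1 * v p.1 p.2.2)) := by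
    have hspan : ⊤ ≤ Submodule.span ℂ (Set.range fun p : Σ α,
      Fin (Module.finrank ℂ (LinearMap.range (columnMk (e := eA) ℂ α))) ×
        Fin (Module.finrank ℂ (Standard eA α)) => π (a p.1 p.2.1 * v p.1 p.2.2)) := by
      intro x _
      obtain ⟨d, rfl⟩ := hsurj x
      have hd : d ∈ (⊤ : Submodule (SymmetricAlgebra ℂ U) D) := trivial
      rw [← htop] at hd
      induction hd using Submodule.span_induction with
      | mem x hx =>
        obtain ⟨p, rfl⟩ := hx
        exact Submodule.subset_span ⟨p, rfl⟩
      | zero => simp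
      | add x y _ _ hx hy => rw [map_add]; exact add_mem (hx trivial) (hy trivial)
      | smul r x _ hx =>
        rw [map_smul_of_ker hker]
        exact Submodule.smul_mem _ _ (hx trivial)
    exact linearIndependent_of_top_le_span_of_card_le_finrank hspan (by simpa using hsum)
  have hind := linearIndependent_of_flat (ev := SymmetricAlgebra.algebraMapInv)
    (π := π.toLinearMap.toAddMonoidHom) (fun s d => map_smul_of_ker hker s d) _ hindA
  refine ⟨he, hup, idem_mul_mul_idem_mem_sup hι hsurj hker heA he he0 hupA hdiagA, hnpos,
    fun α => ?_, ⟨Module.Basis.mk hind htop.ge⟩⟩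
  let q := standardMk (e := e) (SymmetricAlgebra ℂ U) α
  have hq : ∀ b, q b = 0 ↔ e α * b ∈ traceSpan (SymmetricAlgebra ℂ U) e {γ | α < γ} :=
    fun b => standardMk_eq_zero_iff he.toOrthogonalIdempotents (hup α)
  refine ⟨Module.Basis.mk (v := fun j => q (v α j)) ?_ ?_⟩
  · refine Fintype.linearIndependent_iff.2 fun f hf j => ?_
    have h1 : ∑ j, f j • v α j ∈ traceSpan (SymmetricAlgebra ℂ U) e {γ | α < γ} := by
      have h2 : q (∑ j, f j • v α j) = 0 := by
        rw [map_sum]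
        simpa using hf
      rw [hq, Finset.mul_sum] at h2
      simpa only [mul_smul_comm, hv] using h2
    -- Any column index would do; one exists because the column at α is nonzero.
    let i₀ : Fin (Module.finrank ℂ (LinearMap.range (columnMk (e := eA) ℂ α))) := ⟨0, hmpos α⟩
    -- The left factor turns membership in the trace, on which rows alone give no coordinates, into
    -- a statement about coordinates in the product basis.
    have h2 := hJ α (mul_left_mem_traceSpan (a α i₀) h1)
    let b := Module.Basis.mk hind htop.ge
    have hb : ∀ δ i j, b ⟨δ, i, j⟩ = a δ i * v δ j := fun δ i j => by
      rw [Module.Basis.mk_apply]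
    have h3 : ∀ x ∈ Submodule.span (SymmetricAlgebra ℂ U)
        {x | ∃ δ, α < δ ∧ ∃ i j, x = a δ i * v δ j}, b.repr x ⟨α, i₀, j⟩ = 0 := by
      intro x hx
      induction hx using Submodule.span_induction with
      | mem x hx =>
        obtain ⟨δ, hδ, i, j', rfl⟩ := hx
        rw [← hb, Module.Basis.repr_self, Finsupp.single_apply, if_neg]
        intro h
        exact hδ.ne' (congr_arg Sigma.fst h)
      | zero => simp
      | add x y _ _ hx hy => rw [map_add, Finsupp.add_apply, hx, hy, add_zero]
      | smul r x _ hx => rw [map_smul, Finsupp.smul_apply, hx, smul_zero]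
    have h4 := h3 _ h2
    have h5 : a α i₀ * ∑ j, f j • v α j = ∑ j, f j • b ⟨α, i₀, j⟩ := by
      rw [Finset.mul_sum]
      refine Finset.sum_congr rfl fun j _ => ?_
      rw [mul_smul_comm, hb]
    rw [h5, map_sum, Finsupp.finsetSum_apply, Finset.sum_eq_single j] at h4
    · simpa using h4
    · intro j' _ hj'
      have : (⟨α, i₀, j'⟩ : Σ α,
        Fin (Module.finrank ℂ (LinearMap.range (columnMk (e := eA) ℂ α))) ×
          Fin (Module.finrank ℂ (Standard eA α))) ≠ ⟨α, i₀, j⟩ := by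
        intro h
        simp only [Sigma.mk.injEq, heq_eq_eq, Prod.mk.injEq, true_and] at h
        exact hj' h
      rw [map_smul, Module.Basis.repr_self, Finsupp.smul_apply, Finsupp.single_apply, if_neg this,
        smul_zero]
    · simp
  · intro y _
    obtain ⟨d, rfl⟩ := standardMk_surjective (k := SymmetricAlgebra ℂ U)
      he.toOrthogonalIdempotents α y
    obtain ⟨x, hx, z, hz, hxz⟩ := Submodule.mem_sup.1 (hv' α d)
    have hz' : q z = 0 := (hq z).2 (mul_left_mem_traceSpan _ hz)
    have h1 : standardMk (SymmetricAlgebra ℂ U) α d = q x := by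
      rw [← standardMk_idem_mul he.toOrthogonalIdempotents α d, ← hxz]
      change q (x + z) = q x
      rw [map_add, hz', add_zero]
    rw [h1]
    have := Submodule.mem_map_of_mem (f := q) hx
    rwa [Submodule.map_span, ← Set.range_comp] at this

end Construction

/-! ### Central characters of the deformed standard modules -/

section Characters

variable {I : Type u} [Fintype I] [PartialOrder I] {S : Type v} [CommRing S] [IsDomain S]
  {D : Type w} [Ring D] [Algebra S D] {e : I → D} {m n : I → ℕ}

lemma IsDeformedQuasiHereditary.free (hD : IsDeformedQuasiHereditary S e m n) : Module.Free S D :=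
  Module.Free.of_basis hD.basis.some

lemma IsDeformedQuasiHereditary.finite (hD : IsDeformedQuasiHereditary S e m n) :
    Module.Finite S D := by
  classical exact Module.Finite.of_basis hD.basis.some

lemma IsDeformedQuasiHereditary.finrank_eq (hD : IsDeformedQuasiHereditary S e m n) :
    Module.finrank S D = ∑ α, m α * n α := by
  rw [Module.finrank_eq_card_basis hD.basis.some]
  simp

lemma IsDeformedQuasiHereditary.standard_free (hD : IsDeformedQuasiHereditary S e m n) (α : I) :
    Module.Free S (Standard e α) :=
  Module.Free.of_basis (hD.standard α).some

lemma IsDeformedQuasiHereditary.standard_finite (hD : IsDeformedQuasiHereditary S e m n) (α : I) :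
    Module.Finite S (Standard e α) :=
  Module.Finite.of_basis (hD.standard α).some

lemma IsDeformedQuasiHereditary.standard_finrank_eq (hD : IsDeformedQuasiHereditary S e m n)
    (α : I) : Module.finrank S (Standard e α) = n α := by
  rw [Module.finrank_eq_card_basis (hD.standard α).some]
  simp

lemma IsDeformedQuasiHereditary.standardMk_eq_zero_iff (hD : IsDeformedQuasiHereditary S e m n)
    {α : I} {b : D} :
    standardMk (e := e) S α b = 0 ↔ e α * b ∈ traceSpan S e {γ | α < γ} :=
  KoszulCenter.standardMk_eq_zero_iff hD.complete.toOrthogonalIdempotents (hD.upper α)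

lemma IsDeformedQuasiHereditary.smul_injective (hD : IsDeformedQuasiHereditary S e m n) {α : I}
    {s t : S} (h : ∀ x : Standard e α, s • x = t • x) : s = t := by
  have := congr_arg (fun x => (hD.standard α).some.repr x ⟨0, hD.pos α⟩)
    (h ((hD.standard α).some ⟨0, hD.pos α⟩))
  simpa using this

/-- Modulo the trace of the e_γ with γ > α, e_α ζ e_α is a multiple s·e_α. Since ζ commutes with
every b, the class of e_α b is multiplied by the same s. -/
lemma IsDeformedQuasiHereditary.exists_center_smul (hD : IsDeformedQuasiHereditary S e m n)
    (α : I) (ζ : Subalgebra.center S D) :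
    ∃ s : S, ∀ x : Standard e α, MulOpposite.op (ζ : D) • x = s • x := by
  obtain ⟨x, hx, y, hy, hxy⟩ := Submodule.mem_sup.1 (hD.diag α (ζ : D))
  obtain ⟨s, rfl⟩ := Submodule.mem_span_singleton.1 hx
  have hζ : ∀ d, d * (ζ : D) = ζ * d := Subalgebra.mem_center_iff.1 ζ.2
  refine ⟨s, fun x => ?_⟩
  obtain ⟨b, rfl⟩ := standardMk_surjective (k := S) hD.complete.toOrthogonalIdempotents α x
  rw [op_smul_standardMk, ← map_smul, ← sub_eq_zero, ← map_sub, hD.standardMk_eq_zero_iff]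
  have h1 : e α * (b * ζ - s • b) = y * b := by
    rw [hζ, mul_sub, ← mul_assoc, mul_smul_comm, ← smul_mul_assoc, ← sub_mul]
    congr 1
    rw [sub_eq_iff_eq_add, add_comm, hxy, mul_assoc, ← hζ, ← mul_assoc,
      (hD.complete.idem α).eq]
  rw [h1]
  exact mul_right_mem_traceSpan _ hy

/-- Existence and uniqueness of the central characters. -/
theorem IsDeformedQuasiHereditary.exists_isCentralCharacters
    (hD : IsDeformedQuasiHereditary S e m n) :
    ∃ h : I → (Subalgebra.center S D →ₐ[S] S),
      IsCentralCharacters e h ∧ ∀ h', IsCentralCharacters e h' → h' = h := by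
  choose f hf using hD.exists_center_smul
  refine ⟨fun α => AlgHom.ofLinearMap
    { toFun := f α
      map_add' := fun ζ η => hD.smul_injective (α := α) fun x => ?_
      map_smul' := fun r ζ => hD.smul_injective (α := α) fun x => ?_ } ?_ ?_, ?_, ?_⟩
  · rw [← hf, add_smul, ← hf, ← hf, Subalgebra.coe_add, MulOpposite.op_add, add_smul]
  · rw [← hf, RingHom.id_apply, smul_assoc, ← hf, Subalgebra.coe_smul, MulOpposite.op_smul,
      smul_assoc]
  · refine hD.smul_injective (α := α) fun x => ?_
    change f α 1 • x = _
    rw [← hf, one_smul, Subalgebra.coe_one, MulOpposite.op_one, one_smul]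
  · intro ζ η
    refine hD.smul_injective (α := α) fun x => ?_
    change f α (ζ * η) • x = (f α ζ * f α η) • x
    rw [← hf, mul_smul, ← hf, ← hf, smul_smul, ← MulOpposite.op_mul, mul_comm ζ η,
      Subalgebra.coe_mul]
  · exact fun α ζ x => hf α ζ x
  · intro h' hh'
    ext α ζ
    refine hD.smul_injective (α := α) fun x => ?_
    rw [← hh']
    exact hf α ζ x

end Characters

/-! ### Localization at the generic point -/

section Generic

variable {S : Type v} [CommRing S] [IsDomain S]

/-- Clearing denominators: statements over K are reduced to numerators in N. -/
lemma exists_smul_eq_one_tmul {N : Type w} [AddCommGroup N] [Module S N]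
    (x : FractionRing S ⊗[S] N) :
    ∃ s : S, s ≠ 0 ∧ ∃ y : N, algebraMap S (FractionRing S) s • x = 1 ⊗ₜ[S] y := by
  obtain ⟨⟨y, s⟩, h⟩ := IsLocalizedModule.surj (nonZeroDivisors S)
    (TensorProduct.mk S (FractionRing S) N 1) x
  refine ⟨s, nonZeroDivisors.ne_zero s.2, y, ?_⟩
  rw [algebraMap_smul]
  exact h

lemma exists_smul_eq_zero_of_one_tmul_eq_zero {N : Type w} [AddCommGroup N] [Module S N] {y : N}
    (h : (1 : FractionRing S) ⊗ₜ[S] y = 0) : ∃ s : S, s ≠ 0 ∧ s • y = 0 := by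
  obtain ⟨s, hs⟩ := (IsLocalizedModule.eq_zero_iff (nonZeroDivisors S)
    (TensorProduct.mk S (FractionRing S) N 1)).1 h
  exact ⟨s, nonZeroDivisors.ne_zero s.2, hs⟩

lemma algebraMap_fractionRing_ne_zero {s : S} (hs : s ≠ 0) :
    algebraMap S (FractionRing S) s ≠ 0 := by
  simpa using hs

lemma isUnit_algebraMap_fractionRing {s : S} (hs : s ≠ 0) :
    IsUnit (algebraMap S (FractionRing S) s) :=
  IsUnit.mk0 _ (algebraMap_fractionRing_ne_zero hs)

lemma one_tmul_eq_zero_iff {N : Type w} [AddCommGroup N] [Module S N] [Module.IsTorsionFree S N]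
    {y : N} : (1 : FractionRing S) ⊗ₜ[S] y = 0 ↔ y = 0 := by
  refine ⟨fun h => ?_, fun h => by rw [h, TensorProduct.tmul_zero]⟩
  obtain ⟨s, hs, h⟩ := exists_smul_eq_zero_of_one_tmul_eq_zero h
  exact (smul_eq_zero.1 h).resolve_left hs

variable {I : Type u} [Fintype I] [PartialOrder I] {D : Type w} [Ring D] [Algebra S D] {e : I → D}

lemma genericActionMap_one_tmul (d : D) (α : I) :
    genericActionMap (S := S) e (1 ⊗ₜ[S] d) α = (actionMap (S := S) e α d).baseChange _ := by
  simp [genericActionMap]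

lemma actionMap_apply (α : I) (d : D) (x : Standard e α) :
    actionMap (S := S) e α d x = MulOpposite.op d • x := rfl

lemma genericCharacterMap_one_tmul (h : I → (Subalgebra.center S D →ₐ[S] S))
    (ζ : Subalgebra.center S D) (α : I) :
    genericCharacterMap h (1 ⊗ₜ[S] ζ) α = algebraMap S (FractionRing S) (h α ζ) := by
  simp [genericCharacterMap]

/-- The kernel and the cokernel of `⨁ h_α` are torsion if and only if `⨁ h_α^∞` is bijective. -/
lemma isTorsion_and_isTorsion_iff (h : I → (Subalgebra.center S D →ₐ[S] S)) :
    (Module.IsTorsion S (LinearMap.ker (AlgHom.pi h).toLinearMap) ∧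
      Module.IsTorsion S ((I → S) ⧸ LinearMap.range (AlgHom.pi h).toLinearMap)) ↔
      Function.Bijective (genericCharacterMap h) := by
  constructor
  · rintro ⟨h1, h2⟩
    constructor
    · refine (injective_iff_map_eq_zero _).2 fun x hx => ?_
      obtain ⟨s, hs, ζ, hζ⟩ := exists_smul_eq_one_tmul x
      have h3 : AlgHom.pi h ζ = 0 := by
        ext α
        have := congr_fun (congr_arg (genericCharacterMap h) hζ) α
        rw [map_smul, hx, smul_zero, genericCharacterMap_one_tmul, Pi.zero_apply] at this
        exact (FaithfulSMul.algebraMap_eq_zero_iff S (FractionRing S)).1 this.symm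
      obtain ⟨t, ht⟩ := @h1 ⟨ζ, h3⟩
      have ht' : (t : S) • ζ = 0 := congr_arg Subtype.val ht
      have h4 : algebraMap S (FractionRing S) t • ((1 : FractionRing S) ⊗ₜ[S] ζ) = 0 := by
        rw [algebraMap_smul, ← TensorProduct.tmul_smul, ht', TensorProduct.tmul_zero]
      rw [← hζ, smul_smul, ← map_mul] at h4
      exact (isUnit_algebraMap_fractionRing
        (mul_ne_zero (nonZeroDivisors.ne_zero t.2) hs)).smul_eq_zero.1 h4
    · intro k
      classical
      -- A common denominator s for the coordinates; torsion of the cokernel supplies a further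
      -- factor t that brings the numerators into the image.
      obtain ⟨s, hs⟩ := IsLocalization.exist_integer_multiples_of_finset (nonZeroDivisors S)
        (Finset.univ.image k)
      have hs' : ∀ α, ∃ f : S, algebraMap S (FractionRing S) f = (s : S) • k α := fun α =>
        hs (k α) (Finset.mem_image_of_mem k (Finset.mem_univ α))
      choose f hf using hs'
      obtain ⟨t, ht⟩ := @h2 (Submodule.Quotient.mk f)
      obtain ⟨ζ, hζ⟩ : (t : S) • f ∈ LinearMap.range (AlgHom.pi h).toLinearMap :=
        (Submodule.Quotient.mk_eq_zero _).1 ht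
      have hts : algebraMap S (FractionRing S) (t * s) ≠ 0 := algebraMap_fractionRing_ne_zero
        (mul_ne_zero (nonZeroDivisors.ne_zero t.2) (nonZeroDivisors.ne_zero s.2))
      refine ⟨(algebraMap S (FractionRing S) (t * s))⁻¹ • (1 ⊗ₜ[S] ζ), ?_⟩
      ext α
      rw [map_smul, Pi.smul_apply, genericCharacterMap_one_tmul, smul_eq_mul,
        inv_mul_eq_iff_eq_mul₀ hts]
      have h3 : h α ζ = t * f α := congr_fun hζ α
      rw [h3, map_mul, hf, map_mul, Algebra.smul_def, mul_assoc]
  · rintro ⟨h1, h2⟩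
    constructor
    · rintro ⟨ζ, hζ⟩
      have h3 : (1 : FractionRing S) ⊗ₜ[S] ζ = 0 := by
        refine h1 ?_
        ext α
        have h4 : h α ζ = 0 := congr_fun hζ α
        rw [genericCharacterMap_one_tmul, h4, map_zero, map_zero, Pi.zero_apply]
      obtain ⟨s, hs, h4⟩ := exists_smul_eq_zero_of_one_tmul_eq_zero h3
      exact ⟨⟨s, mem_nonZeroDivisors_of_ne_zero hs⟩, Subtype.ext h4⟩
    · intro y
      obtain ⟨f, rfl⟩ := Submodule.Quotient.mk_surjective _ y
      obtain ⟨x, hx⟩ := h2 fun α => algebraMap S (FractionRing S) (f α)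
      obtain ⟨s, hs, ζ, hζ⟩ := exists_smul_eq_one_tmul x
      refine ⟨⟨s, mem_nonZeroDivisors_of_ne_zero hs⟩, ?_⟩
      refine (Submodule.Quotient.mk_eq_zero _).2 ⟨ζ, ?_⟩
      ext α
      have h3 := congr_fun (congr_arg (genericCharacterMap h) hζ) α
      rw [map_smul, hx, genericCharacterMap_one_tmul, Pi.smul_apply, smul_eq_mul, ← map_mul] at h3
      exact (IsFractionRing.injective S (FractionRing S) h3).symm

end Generic

/-! ### The conditions defining malleability -/

section Filtration

variable {I : Type u} [Fintype I] [PartialOrder I] {S : Type v} [CommRing S] [IsDomain S]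
  {D : Type w} [Ring D] [Algebra S D] {e : I → D} {m n : I → ℕ}

/-- The first `p` elements of an enumeration. -/
def initialSet (σ : Fin (Fintype.card I) ≃ I) (p : ℕ) : Set I := {γ | (σ.symm γ : ℕ) < p}

lemma mem_initialSet {σ : Fin (Fintype.card I) ≃ I} {p : ℕ} {γ : I} :
    γ ∈ initialSet σ p ↔ (σ.symm γ : ℕ) < p := Iff.rfl

/-- The filtration in the statement is indexed by i ≤ k, the initial sets by a strict bound. The
shift makes room for the zero step at p = 0. -/
lemma image_le_eq_initialSet (σ : Fin (Fintype.card I) ≃ I) (k : Fin (Fintype.card I)) :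
    σ '' {i | i ≤ k} = initialSet σ (k + 1) := by
  refine Set.ext fun γ => ?_
  rw [σ.image_eq_preimage_symm, mem_initialSet, Nat.lt_succ_iff]
  exact Iff.rfl

lemma initialSet_zero (σ : Fin (Fintype.card I) ≃ I) : initialSet σ 0 = ∅ := by
  simp [initialSet]

lemma initialSet_card (σ : Fin (Fintype.card I) ≃ I) :
    initialSet σ (Fintype.card I) = Set.univ :=
  Set.eq_univ_of_forall fun γ => mem_initialSet.2 (σ.symm γ).2

/-- The step from p to p + 1 adds the ideal generated by e_γ with γ = σ(p). If d annihilates V_γ,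
then e_γ b d lies in the trace of the e_δ with δ > γ, and a descending enumeration lists all such δ
before γ. -/
lemma IsDeformedQuasiHereditary.mul_mem_of_standard (hD : IsDeformedQuasiHereditary S e m n)
    {σ : Fin (Fintype.card I) ≃ I} (hσ : IsDescending σ) {d : D} {p : ℕ}
    (hd : ∀ i : Fin (Fintype.card I), (i : ℕ) = p →
      ∀ x : Standard e (σ i), MulOpposite.op d • x = 0)
    {y : D} (hy : y ∈ traceSpan S e (initialSet σ (p + 1))) :
    y * d ∈ traceSpan S e (initialSet σ p) := by
  induction hy using Submodule.span_induction with
  | mem x hx =>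
    obtain ⟨a, b, γ, hγ, rfl⟩ := hx
    rw [mem_initialSet, Nat.lt_succ_iff_lt_or_eq] at hγ
    rcases hγ with h | h
    · have hγ : γ ∈ initialSet σ p := mem_initialSet.2 h
      rw [mul_assoc]
      exact mul_idem_mul_mem_traceSpan hγ a (b * d)
    · have h1 := hd (σ.symm γ) h
      rw [Equiv.apply_symm_apply] at h1
      have h2 := h1 (standardMk S γ b)
      rw [op_smul_standardMk, hD.standardMk_eq_zero_iff] at h2
      rw [mul_assoc, mul_assoc]
      refine mul_left_mem_traceSpan _ (traceSpan_mono ?_ h2)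
      intro δ hδ
      rw [← h]
      rw [mem_initialSet]
      exact hσ (σ.symm γ) (σ.symm δ) (by simpa using hδ)
  | zero => simp
  | add x y _ _ hx hy => rw [add_mul]; exact add_mem hx hy
  | smul r x _ hx => rw [smul_mul_assoc]; exact Submodule.smul_mem _ _ hx

lemma IsDeformedQuasiHereditary.mul_pow_mem_of_standard (hD : IsDeformedQuasiHereditary S e m n)
    {σ : Fin (Fintype.card I) ≃ I} (hσ : IsDescending σ) {d : D} {p : ℕ} (q : ℕ)
    (hd : ∀ i : Fin (Fintype.card I), p ≤ i → (i : ℕ) < p + q →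
      ∀ x : Standard e (σ i), MulOpposite.op d • x = 0)
    {y : D} (hy : y ∈ traceSpan S e (initialSet σ (p + q))) :
    y * d ^ q ∈ traceSpan S e (initialSet σ p) := by
  induction q generalizing y with
  | zero => simpa using hy
  | succ q ih =>
    rw [pow_succ', ← mul_assoc]
    refine ih (fun i hi hi' => hd i hi (by omega)) ?_
    exact hD.mul_mem_of_standard hσ (fun i hi => hd i (by omega) (by omega)) hy

/-- The trace ideal of D^∞ is the localization of the one of D, so membership can be tested on
numerators. -/
lemma mem_traceIdeal_iff {T : Set I} {x : FractionRing S ⊗[S] D} :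
    x ∈ traceIdeal (S := S) e T ↔ ∃ s : S, s ≠ 0 ∧ ∃ y ∈ traceSpan S e T,
      algebraMap S (FractionRing S) s • x = 1 ⊗ₜ[S] y := by
  constructor
  · intro hx
    induction hx using Submodule.span_induction with
    | mem x hx =>
      obtain ⟨a, γ, hγ, rfl⟩ := hx
      exact ⟨1, one_ne_zero, _, mul_idem_mem_traceSpan hγ a, by simp⟩
    | zero => exact ⟨1, one_ne_zero, 0, zero_mem _, by simp⟩
    | add x x' _ _ hx hx' =>
      obtain ⟨s, hs, y, hy, hxy⟩ := hx
      obtain ⟨s', hs', y', hy', hxy'⟩ := hx'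
      refine ⟨s * s', mul_ne_zero hs hs', s' • y + s • y',
        add_mem (Submodule.smul_mem _ _ hy) (Submodule.smul_mem _ _ hy'), ?_⟩
      rw [TensorProduct.tmul_add, TensorProduct.tmul_smul, TensorProduct.tmul_smul, ← hxy, ← hxy',
        smul_add, ← algebraMap_smul (FractionRing S) s', ← algebraMap_smul (FractionRing S) s,
        smul_smul, smul_smul, map_mul, mul_comm (algebraMap _ _ s')]
    | smul c x _ hx =>
      obtain ⟨s, hs, y, hy, hxy⟩ := hx
      obtain ⟨t, ht, d, hd⟩ := exists_smul_eq_one_tmul c.unop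
      refine ⟨s * t, mul_ne_zero hs ht, y * d, mul_right_mem_traceSpan d hy, ?_⟩
      change _ • (x * c.unop) = _
      rw [map_mul, ← smul_mul_smul_comm, hxy, hd, Algebra.TensorProduct.tmul_mul_tmul, one_mul]
  · rintro ⟨s, hs, y, hy, hxy⟩
    have h1 : (1 : FractionRing S) ⊗ₜ[S] y ∈ traceIdeal (S := S) e T := by
      clear hxy
      induction hy using Submodule.span_induction with
      | mem y hy =>
        obtain ⟨a, b, γ, hγ, rfl⟩ := hy
        have := (traceIdeal (S := S) e T).smul_mem (MulOpposite.op (1 ⊗ₜ[S] b))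
          (Submodule.subset_span ⟨a, γ, hγ, rfl⟩)
        rwa [op_smul_eq_mul, Algebra.TensorProduct.tmul_mul_tmul, one_mul] at this
      | zero => simp
      | add y y' _ _ hy hy' => rw [TensorProduct.tmul_add]; exact add_mem hy hy'
      | smul r y _ hy =>
        have := (traceIdeal (S := S) e T).smul_mem (MulOpposite.op (1 ⊗ₜ[S] (algebraMap S D r))) hy
        rwa [op_smul_eq_mul, Algebra.TensorProduct.tmul_mul_tmul, one_mul,
          ← Algebra.commutes, ← Algebra.smul_def] at this
    have h2 := (traceIdeal (S := S) e T).smul_mem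
      (MulOpposite.op ((algebraMap S (FractionRing S) s)⁻¹ ⊗ₜ[S] (1 : D))) h1
    rw [op_smul_eq_mul, Algebra.TensorProduct.tmul_mul_tmul, one_mul, mul_one] at h2
    have h3 : x = (algebraMap S (FractionRing S) s)⁻¹ • (1 ⊗ₜ[S] y) := by
      rw [← hxy, smul_smul, inv_mul_cancel₀ (algebraMap_fractionRing_ne_zero hs), one_smul]
    rwa [h3, TensorProduct.smul_tmul', smul_eq_mul, mul_one]

lemma exists_isDescending : ∃ σ : Fin (Fintype.card I) ≃ I, IsDescending σ := by
  classical
  -- A linear extension of the order, reversed so that larger elements come first.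
  let : Fintype (LinearExtension I)ᵒᵈ := inferInstanceAs (Fintype I)
  let f := monoEquivOfFin (LinearExtension I)ᵒᵈ (k := Fintype.card I) rfl
  let j : (LinearExtension I)ᵒᵈ ≃ I := Equiv.refl I
  refine ⟨f.toEquiv.trans j, fun i k hik => ?_⟩
  have h1 : toLinearExtension (j (f i)) ≤ toLinearExtension (j (f k)) :=
    toLinearExtension.monotone (le_of_lt hik)
  have h2 : f k ≤ f i := h1
  have h3 : k ≤ i := f.le_iff_le.1 h2
  refine lt_of_le_of_ne h3 ?_
  rintro rfl
  exact lt_irrefl _ hik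

end Filtration

/-! ### Equivalence of the malleability conditions -/

section Malleability

variable {I : Type u} [Fintype I] [PartialOrder I] {S : Type v} [CommRing S] [IsDomain S]
  {D : Type w} [Ring D] [Algebra S D] {e : I → D} {m n : I → ℕ}
  {h : I → (Subalgebra.center S D →ₐ[S] S)}

/-- A preimage of the indicator function of α, cleared of denominators, separates h_α from every
other character. -/
lemma injective_of_bijective_genericCharacterMap
    (hb : Function.Bijective (genericCharacterMap h)) : Function.Injective h := by
  classical
  intro α β hαβ
  by_contra hne
  obtain ⟨x, hx⟩ := hb.2 (Pi.single α 1)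
  obtain ⟨s, hs, ζ, hζ⟩ := exists_smul_eq_one_tmul x
  have h1 := congr_fun (congr_arg (genericCharacterMap h) hζ)
  have h2 := h1 α
  have h3 := h1 β
  rw [map_smul, hx, genericCharacterMap_one_tmul, Pi.smul_apply] at h2 h3
  rw [← hαβ, ← h2] at h3
  simp only [Pi.single_eq_same, Pi.single_eq_of_ne (Ne.symm hne), smul_eq_mul, mul_one,
    mul_zero] at h3
  exact algebraMap_fractionRing_ne_zero hs h3.symm

/-- The character `h_α^∞` as a homomorphism of `K`-algebras. -/
noncomputable def genericCharacter (f : Subalgebra.center S D →ₐ[S] S) :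
    FractionRing S ⊗[S] Subalgebra.center S D →ₐ[FractionRing S] FractionRing S :=
  Algebra.TensorProduct.lift (AlgHom.id _ _) ((Algebra.ofId S (FractionRing S)).comp f)
    fun _ _ => Commute.all _ _

lemma genericCharacter_one_tmul (f : Subalgebra.center S D →ₐ[S] S) (ζ : Subalgebra.center S D) :
    genericCharacter f (1 ⊗ₜ[S] ζ) = algebraMap S (FractionRing S) (f ζ) := by
  simp [genericCharacter, Algebra.ofId_apply]

variable (S D) in
/-- The map `Z(D)^∞ → D^∞`. -/
noncomputable def genericCenterMap :
    FractionRing S ⊗[S] Subalgebra.center S D →ₐ[FractionRing S] FractionRing S ⊗[S] D :=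
  Algebra.TensorProduct.map (AlgHom.id _ _) (Subalgebra.center S D).val

lemma genericCenterMap_one_tmul (ζ : Subalgebra.center S D) :
    genericCenterMap S D ((1 : FractionRing S) ⊗ₜ[S] ζ) = 1 ⊗ₜ[S] (ζ : D) := by
  simp [genericCenterMap]

lemma genericCenterMap_mul_comm (x : FractionRing S ⊗[S] Subalgebra.center S D)
    (y : FractionRing S ⊗[S] D) : genericCenterMap S D x * y = y * genericCenterMap S D x := by
  induction x using TensorProduct.induction_on with
  | zero => simp
  | add x x' hx hx' => rw [map_add, add_mul, mul_add, hx, hx']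
  | tmul k ζ =>
    induction y using TensorProduct.induction_on with
    | zero => simp
    | add y y' hy hy' => rw [mul_add, add_mul, hy, hy']
    | tmul l d =>
      have hζ : d * (ζ : D) = ζ * d := Subalgebra.mem_center_iff.1 ζ.2 d
      simp [genericCenterMap, hζ, mul_comm]

/-- Lagrange interpolation: with ζ_β separating h_α from h_β, the product of the ζ_β - h_β(ζ_β) over
β ≠ α is annihilated by each h_β but not by h_α; then divide by its value at α. -/
lemma exists_genericCharacter_eq_single [DecidableEq I] (hinj : Function.Injective h) (α : I) :
    ∃ x : FractionRing S ⊗[S] Subalgebra.center S D,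
      ∀ β, genericCharacter (h β) x = (Pi.single α 1 : I → FractionRing S) β := by
  have h1 : ∀ β, β ≠ α → ∃ ζ, h α ζ ≠ h β ζ := by
    intro β hβ
    by_contra! hcon
    exact hβ (hinj (AlgHom.ext hcon)).symm
  choose! ζ hζ using h1
  let p := ∏ β ∈ Finset.univ.erase α, (ζ β - algebraMap S _ (h β (ζ β)))
  have hp1 : h α p ≠ 0 := by
    rw [map_prod, Finset.prod_ne_zero_iff]
    intro β hβ
    rw [map_sub, AlgHom.commutes, sub_ne_zero]
    exact hζ β (Finset.ne_of_mem_erase hβ)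
  have hp2 : ∀ β, β ≠ α → h β p = 0 := by
    intro β hβ
    rw [map_prod]
    refine Finset.prod_eq_zero (Finset.mem_erase.2 ⟨hβ, Finset.mem_univ β⟩) ?_
    rw [map_sub, AlgHom.commutes, sub_eq_zero]
    rfl
  refine ⟨(algebraMap S (FractionRing S) (h α p))⁻¹ • (1 ⊗ₜ[S] p), fun β => ?_⟩
  rw [map_smul, genericCharacter_one_tmul, smul_eq_mul]
  by_cases hβ : β = α
  · subst hβ
    rw [inv_mul_cancel₀ (algebraMap_fractionRing_ne_zero hp1), Pi.single_eq_same]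
  · rw [hp2 β hβ, map_zero, mul_zero, Pi.single_eq_of_ne hβ]

variable (hD : IsDeformedQuasiHereditary S e m n) (hh : IsCentralCharacters e h)

include hD

lemma IsDeformedQuasiHereditary.isTorsionFree : Module.IsTorsionFree S D :=
  have := hD.free
  inferInstance

include hh in
-- Such a ζ annihilates every V_α, so each multiplication descends one step of the standard
-- filtration, and the unit reaches zero after |I| steps.
lemma IsDeformedQuasiHereditary.pow_card_eq_zero {ζ : Subalgebra.center S D}
    (hζ : ∀ α, h α ζ = 0) : ζ ^ Fintype.card I = 0 := by
  obtain ⟨σ, hσ⟩ := exists_isDescending (I := I)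
  have h1 := hD.mul_pow_mem_of_standard hσ (d := (ζ : D)) (p := 0) (Fintype.card I)
    (fun i _ _ x => by rw [hh, hζ, zero_smul]) (y := 1)
    (by rw [zero_add, initialSet_card, traceSpan_univ hD.complete]; trivial)
  rw [initialSet_zero, traceSpan_empty, one_mul, Submodule.mem_bot] at h1
  exact Subtype.ext (by rw [Subalgebra.coe_pow, h1, Subalgebra.coe_zero])

include hh in
/-- If the characters are distinct, then `D^∞` has central idempotents that generate the
central characters. -/
lemma IsDeformedQuasiHereditary.exists_idempotents [DecidableEq I] (hinj : Function.Injective h) :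
    ∃ E : I → FractionRing S ⊗[S] Subalgebra.center S D, CompleteOrthogonalIdempotents E ∧
      ∀ α β, genericCharacter (h β) (E α) = (Pi.single α 1 : I → FractionRing S) β := by
  let f : FractionRing S ⊗[S] Subalgebra.center S D →+* (I → FractionRing S) :=
    RingHom.pi fun β => (genericCharacter (h β)).toRingHom
  have hnil : ∀ x ∈ RingHom.ker f, IsNilpotent x := by
    intro x hx
    obtain ⟨s, hs, ζ, hζ⟩ := exists_smul_eq_one_tmul x
    have h1 : ∀ β, h β ζ = 0 := by
      intro β
      have h2 : genericCharacter (h β) x = 0 := congr_fun hx β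
      have h3 := congr_arg (genericCharacter (h β)) hζ
      rw [map_smul, h2, smul_zero, genericCharacter_one_tmul] at h3
      exact (FaithfulSMul.algebraMap_eq_zero_iff S (FractionRing S)).1 h3.symm
    refine ⟨Fintype.card I, ?_⟩
    have h4 : (algebraMap S (FractionRing S) s • x) ^ Fintype.card I = 0 := by
      rw [hζ, Algebra.TensorProduct.tmul_pow, hD.pow_card_eq_zero hh h1, TensorProduct.tmul_zero]
    rw [smul_pow] at h4
    exact ((isUnit_algebraMap_fractionRing hs).pow _).smul_eq_zero.1 h4
  obtain ⟨E, hE, hE'⟩ := CompleteOrthogonalIdempotents.lift_of_isNilpotent_ker f hnil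
    (CompleteOrthogonalIdempotents.single (fun _ : I => FractionRing S)) (fun α => by
      obtain ⟨x, hx⟩ := exists_genericCharacter_eq_single hinj α
      exact ⟨x, funext hx⟩)
  exact ⟨E, hE, fun α β => congr_fun (congr_fun hE' α) β⟩

include hh in
/-- Distinct characters split the deformed standard filtrations. -/
theorem IsDeformedQuasiHereditary.splits_of_injective (hinj : Function.Injective h)
    {σ : Fin (Fintype.card I) ≃ I} (hσ : IsDescending σ) :
    StandardFiltrationSplits (S := S) e σ := by
  classical
  have := hD.isTorsionFree
  obtain ⟨E, hE, hEh⟩ := hD.exists_idempotents hh hinj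
  let F : I → FractionRing S ⊗[S] D := fun α => genericCenterMap S D (E α)
  have hF : CompleteOrthogonalIdempotents F := hE.map (genericCenterMap S D).toRingHom
  have hFc : ∀ α y, F α * y = y * F α := fun α y => genericCenterMap_mul_comm _ _
  -- a multiple of `F α` comes from a central element with known characters
  have hlift : ∀ α, ∃ s : S, s ≠ 0 ∧ ∃ ζ : D, algebraMap S (FractionRing S) s • F α = 1 ⊗ₜ[S] ζ ∧
      ∀ β, β ≠ α → ∀ x : Standard e β, MulOpposite.op ζ • x = 0 := by
    intro α
    obtain ⟨s, hs, ζ, hζ⟩ := exists_smul_eq_one_tmul (E α)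
    refine ⟨s, hs, ζ, ?_, fun β hβ x => ?_⟩
    · rw [← genericCenterMap_one_tmul, ← hζ, map_smul]
    · have h1 := congr_arg (genericCharacter (h β)) hζ
      rw [map_smul, hEh, Pi.single_eq_of_ne hβ, smul_zero, genericCharacter_one_tmul] at h1
      rw [hh, (FaithfulSMul.algebraMap_eq_zero_iff S (FractionRing S)).1 h1.symm, zero_smul]
  -- The exponent p + 1 keeps the identity valid at p = 0.
  have hpow : ∀ α (p : ℕ), F α ^ (p + 1) = F α := fun α p => (hF.idem α).pow_succ_eq p
  -- If α is not among the first p elements, the numerator ζ of F α annihilates the first p standard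
  -- modules, so p multiplications take the p-th filtration step to zero.
  have hzero : ∀ p x, x ∈ traceIdeal (S := S) e (initialSet σ p) → ∀ α, p ≤ σ.symm α →
      F α * x = 0 := by
    intro p x hx α hα
    obtain ⟨s, hs, y, hy, hxy⟩ := mem_traceIdeal_iff.1 hx
    obtain ⟨t, ht, ζ, hζ, hζ'⟩ := hlift α
    have h1 := hD.mul_pow_mem_of_standard hσ (d := ζ) (p := 0) p (fun i _ hi x => hζ' _ (by
      rintro rfl
      rw [Equiv.symm_apply_apply] at hα
      omega) x) (y := y) (by rwa [zero_add])
    rw [initialSet_zero, traceSpan_empty, Submodule.mem_bot] at h1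
    have h2 : (algebraMap S (FractionRing S) s * algebraMap S (FractionRing S) t ^ (p + 1)) •
        (x * F α) = 0 := by
      rw [← hpow α p, ← smul_mul_smul_comm, ← smul_pow, hxy, hζ, Algebra.TensorProduct.tmul_pow,
        Algebra.TensorProduct.tmul_mul_tmul, pow_succ ζ, ← mul_assoc y, h1, zero_mul,
        TensorProduct.tmul_zero]
    rw [hFc]
    exact ((isUnit_algebraMap_fractionRing hs).mul
      ((isUnit_algebraMap_fractionRing ht).pow _)).smul_eq_zero.1 h2
  -- Dually, if α is among the first p elements, ζ annihilates all later standard modules, so a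
  -- power of ζ takes 1 into the p-th filtration step.
  have hmem : ∀ p ≤ Fintype.card I, ∀ α, (σ.symm α : ℕ) < p →
      F α ∈ traceIdeal (S := S) e (initialSet σ p) := by
    intro p hp α hα
    obtain ⟨t, ht, ζ, hζ, hζ'⟩ := hlift α
    have h1 := hD.mul_pow_mem_of_standard hσ (d := ζ) (p := p) (Fintype.card I - p)
      (fun i hi _ x => hζ' _ (by
      rintro rfl
      rw [Equiv.symm_apply_apply] at hα
      omega) x) (y := 1) (by
        rw [Nat.add_sub_cancel' hp, initialSet_card, traceSpan_univ hD.complete]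
        trivial)
    rw [one_mul] at h1
    refine mem_traceIdeal_iff.2 ⟨t ^ (Fintype.card I - p + 1), pow_ne_zero _ ht,
      ζ ^ (Fintype.card I - p + 1), ?_, ?_⟩
    · rw [pow_succ]
      exact mul_right_mem_traceSpan _ h1
    · rw [map_pow, ← hpow α (Fintype.card I - p), ← smul_pow, hζ, Algebra.TensorProduct.tmul_pow,
        one_pow]
  -- The splitting is the decomposition of D^∞ by central idempotents, taken in the order of the
  -- enumeration.
  let N : Fin (Fintype.card I) → Submodule (FractionRing S ⊗[S] D)ᵐᵒᵖ (FractionRing S ⊗[S] D) :=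
    fun k => Submodule.span _ {F (σ k)}
  have hN : ∀ k y, F (σ k) * y ∈ N k := fun k y =>
    Submodule.mem_span_singleton.2 ⟨MulOpposite.op y, rfl⟩
  have hN' : ∀ k, ∀ y ∈ N k, F (σ k) * y = y := by
    intro k y hy
    obtain ⟨c, rfl⟩ := Submodule.mem_span_singleton.1 hy
    change F (σ k) * (F (σ k) * c.unop) = F (σ k) * c.unop
    rw [← mul_assoc, (hF.idem _).eq]
  have hsum : ∀ y, ∑ k, F (σ k) * y = y := by
    intro y
    rw [← Finset.sum_mul, Equiv.sum_comp σ F, hF.complete, one_mul]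
  refine ⟨N, DirectSum.isInternal_submodule_of_iSupIndep_of_iSup_eq_top ?_ ?_, fun k => ?_⟩
  · refine iSupIndep_def.2 fun k => Submodule.disjoint_def.2 fun y hy hy' => ?_
    rw [← hN' k y hy]
    let K : Submodule (FractionRing S ⊗[S] D)ᵐᵒᵖ (FractionRing S ⊗[S] D) :=
      { carrier := {y | F (σ k) * y = 0}
        add_mem' := fun {a b} ha hb => by
          change F (σ k) * (a + b) = 0
          have ha' : F (σ k) * a = 0 := ha
          have hb' : F (σ k) * b = 0 := hb
          rw [mul_add, ha', hb', add_zero]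
        zero_mem' := mul_zero _
        smul_mem' := fun c a ha => by
          change F (σ k) * (a * c.unop) = 0
          have ha' : F (σ k) * a = 0 := ha
          rw [← mul_assoc, ha', zero_mul] }
    have hK : (⨆ j, ⨆ (_ : j ≠ k), N j) ≤ K := by
      refine iSup₂_le fun j hj y hy => ?_
      change F (σ k) * y = 0
      rw [← hN' j y hy, ← mul_assoc, hF.ortho (σ.injective.ne hj.symm), zero_mul]
    exact hK hy'
  · refine eq_top_iff.2 fun y _ => ?_
    rw [← hsum y]
    exact sum_mem fun k _ => Submodule.mem_iSup_of_mem k (hN k y)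
  · rw [image_le_eq_initialSet]
    refine le_antisymm (fun y hy => ?_) (iSup₂_le fun i hi => ?_)
    · rw [← hsum y]
      refine sum_mem fun i _ => ?_
      by_cases hi : i ≤ k
      · exact Submodule.mem_iSup_of_mem i (Submodule.mem_iSup_of_mem hi (hN i y))
      · rw [hzero _ y hy (σ i) (by
          rw [Equiv.symm_apply_apply]
          exact Nat.succ_le_of_lt (not_le.1 hi))]
        exact zero_mem _
    · refine Submodule.span_le.2 (Set.singleton_subset_iff.2 ?_)
      refine hmem _ k.2 _ ?_
      rw [Equiv.symm_apply_apply]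
      exact Nat.lt_succ_of_le hi

omit hD in
lemma genericActionMap_eq_zero_iff (hD : IsDeformedQuasiHereditary S e m n) {s : S} (hs : s ≠ 0)
    {x : FractionRing S ⊗[S] D} {d : D}
    (hd : algebraMap S (FractionRing S) s • x = 1 ⊗ₜ[S] d) :
    genericActionMap (S := S) e x = 0 ↔
      ∀ α, ∀ y : Standard e α, MulOpposite.op d • y = 0 := by
  have hfree := hD.standard_free
  have h1 : genericActionMap (S := S) e x = 0 ↔ genericActionMap (S := S) e (1 ⊗ₜ[S] d) = 0 := by
    rw [← hd, map_smul, (isUnit_algebraMap_fractionRing hs).smul_eq_zero]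
  rw [h1, funext_iff]
  refine forall_congr' fun α => ?_
  rw [genericActionMap_one_tmul, Pi.zero_apply]
  constructor
  · intro h2 y
    have h3 := LinearMap.congr_fun h2 (1 ⊗ₜ[S] y)
    rw [LinearMap.baseChange_tmul, LinearMap.zero_apply, one_tmul_eq_zero_iff] at h3
    exact h3
  · intro h2
    have h3 : actionMap (S := S) e α d = 0 := LinearMap.ext h2
    rw [h3, LinearMap.baseChange_zero]

/-- If the deformed standard filtration splits, `D^∞` acts faithfully on the standard modules. -/
lemma IsDeformedQuasiHereditary.injective_of_splits
    {σ : Fin (Fintype.card I) ≃ I} (hσ : IsDescending σ)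
    (hs : StandardFiltrationSplits (S := S) e σ) :
    Function.Injective (genericActionMap (S := S) e) := by
  classical
  obtain ⟨N, hN, hσN⟩ := hs
  refine (injective_iff_map_eq_zero _).2 fun x hx => ?_
  obtain ⟨s, hs, d, hd⟩ := exists_smul_eq_one_tmul x
  have hd' := (genericActionMap_eq_zero_iff hD hs hd).1 hx
  have hJ : ∀ p : ℕ, ∀ y ∈ traceIdeal (S := S) e (initialSet σ (p + 1)),
      y * x ∈ traceIdeal (S := S) e (initialSet σ p) := by
    intro p y hy
    obtain ⟨t, ht, z, hz, hyz⟩ := mem_traceIdeal_iff.1 hy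
    refine mem_traceIdeal_iff.2 ⟨t * s, mul_ne_zero ht hs, z * d,
      hD.mul_mem_of_standard hσ (fun i _ y => hd' _ y) hz, ?_⟩
    rw [map_mul, ← smul_mul_smul_comm, hyz, hd, Algebra.TensorProduct.tmul_mul_tmul, one_mul]
  -- N k is a right ideal, so N k · x stays in N k; but x also moves the filtration step ending with
  -- N k into the sum of the earlier summands, which meets N k only in zero.
  have hNx : ∀ k, ∀ y ∈ N k, y * x = 0 := by
    intro k y hy
    have h1 : y ∈ traceIdeal (S := S) e (initialSet σ (k + 1)) := by
      rw [← image_le_eq_initialSet, hσN]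
      exact Submodule.mem_iSup_of_mem k (Submodule.mem_iSup_of_mem le_rfl hy)
    have h2 := hJ k y h1
    have h3 : y * x ∈ ⨆ j, ⨆ (_ : j ≠ k), N j := by
      rcases k with ⟨k, hk⟩
      -- The previous step is a supremum of the N i only when k > 0; for k = 0 it is the zero ideal.
      cases k with
      | zero =>
        have h4 : traceIdeal (S := S) e (initialSet σ 0) = ⊥ := by
          rw [initialSet_zero]
          simp [traceIdeal]
        rw [h4, Submodule.mem_bot] at h2
        rw [h2]
        exact zero_mem _
      | succ k =>
        have h5 := image_le_eq_initialSet σ ⟨k, Nat.lt_of_succ_lt hk⟩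
        rw [← h5, hσN] at h2
        refine SetLike.le_def.1 (iSup₂_le fun i hi => ?_) h2
        refine le_iSup₂_of_le i ?_ le_rfl
        rintro rfl
        exact absurd (Fin.le_def.1 hi) (by simp)
    exact Submodule.disjoint_def.1 (iSupIndep_def.1 hN.submodule_iSupIndep k) _
      ((N k).smul_mem (MulOpposite.op x) hy) h3
  have h1 : (1 : FractionRing S ⊗[S] D) ∈ ⨆ k, N k := by
    rw [hN.submodule_iSup_eq_top]
    trivial
  rw [← one_mul x]
  generalize (1 : FractionRing S ⊗[S] D) = u at h1
  induction h1 using Submodule.iSup_induction' with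
  | mem k y hy => exact hNx k y hy
  | zero => rw [zero_mul]
  | add y z _ _ hy hz => rw [add_mul, hy, hz, add_zero]

omit hD in
lemma bijective_pi_end_of_injective {K V : Type*} {W : I → Type*} [Field K] [AddCommGroup V]
    [Module K V] [FiniteDimensional K V] [∀ i, AddCommGroup (W i)] [∀ i, Module K (W i)]
    [∀ i, FiniteDimensional K (W i)] (f : V →ₗ[K] ((i : I) → Module.End K (W i)))
    (hf : Function.Injective f)
    (hrank : Module.finrank K V = ∑ i, Module.finrank K (W i) * Module.finrank K (W i)) :
    Function.Bijective f := by
  refine ⟨hf, (LinearMap.injective_iff_surjective_of_finrank_eq_finrank ?_).1 hf⟩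
  rw [hrank, Module.finrank_pi_fintype]
  exact Finset.sum_congr rfl fun i _ => (Module.finrank_linearMap K K (W i) (W i)).symm

/-- With m = n, the dimension Σ m_α n_α of D^∞ equals Σ n_α², that of the product of endomorphism
algebras, so injectivity suffices. -/
theorem IsDeformedQuasiHereditary.bijective_of_splits (hmn : ∀ α, m α = n α)
    {σ : Fin (Fintype.card I) ≃ I} (hσ : IsDescending σ)
    (hs : StandardFiltrationSplits (S := S) e σ) :
    Function.Bijective (genericActionMap (S := S) e) := by
  have hinj := hD.injective_of_splits hσ hs
  have := hD.free
  have := hD.finite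
  have := hD.standard_free
  have := hD.standard_finite
  refine bijective_pi_end_of_injective _ hinj ?_
  rw [Module.finrank_baseChange, hD.finrank_eq]
  refine Finset.sum_congr rfl fun α _ => ?_
  rw [Module.finrank_baseChange, hD.standard_finrank_eq, hmn]

include hh in
-- Faithfulness of D^∞ on the standard modules makes a central element determined by its characters,
-- and makes any element acting by scalars central. Surjectivity of the action map realizes all
-- families of scalars.
theorem IsDeformedQuasiHereditary.bijective_genericCharacterMap
    (hb : Function.Bijective (genericActionMap (S := S) e)) :
    Function.Bijective (genericCharacterMap h) := by
  have := hD.isTorsionFree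
  have hfree := hD.standard_free
  constructor
  · refine (injective_iff_map_eq_zero _).2 fun x hx => ?_
    obtain ⟨s, hs, ζ, hζ⟩ := exists_smul_eq_one_tmul x
    have h1 : ∀ α, h α ζ = 0 := by
      intro α
      have h2 := congr_fun (congr_arg (genericCharacterMap h) hζ) α
      rw [map_smul, hx, smul_zero, genericCharacterMap_one_tmul, Pi.zero_apply] at h2
      exact (FaithfulSMul.algebraMap_eq_zero_iff S (FractionRing S)).1 h2.symm
    have h3 : (1 : FractionRing S) ⊗ₜ[S] (ζ : D) = 0 := by
      refine hb.1 ?_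
      rw [map_zero, genericActionMap_eq_zero_iff hD one_ne_zero (d := (ζ : D)) (by simp)]
      exact fun α y => by rw [hh, h1, zero_smul]
    have h4 : ζ = 0 := Subtype.ext (one_tmul_eq_zero_iff.1 h3)
    rw [h4, TensorProduct.tmul_zero] at hζ
    exact (isUnit_algebraMap_fractionRing hs).smul_eq_zero.1 hζ
  · intro c
    obtain ⟨x, hx⟩ := hb.2 fun α => c α • LinearMap.id
    obtain ⟨s, hs, d, hd⟩ := exists_smul_eq_one_tmul x
    have hact : ∀ α, (actionMap (S := S) e α d).baseChange (FractionRing S) =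
        (algebraMap S (FractionRing S) s * c α) • LinearMap.id := by
      intro α
      rw [← genericActionMap_one_tmul, ← hd, map_smul, hx, Pi.smul_apply, smul_smul]
    -- The commutator of d with any d' acts by zero on every V_α^∞, hence vanishes in D^∞ and in the
    -- torsion-free D.
    have hcent : d ∈ Subalgebra.center S D := by
      refine Subalgebra.mem_center_iff.2 fun d' => ?_
      rw [← sub_eq_zero, ← one_tmul_eq_zero_iff (S := S)]
      refine hb.1 ?_
      rw [map_zero, genericActionMap_eq_zero_iff hD one_ne_zero (d := d' * d - d * d') (by simp)]
      intro α y
      rw [← one_tmul_eq_zero_iff (S := S)]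
      have h1 : ∀ z : Standard e α, (1 : FractionRing S) ⊗ₜ[S] (MulOpposite.op d • z) =
          (algebraMap S (FractionRing S) s * c α) • (1 ⊗ₜ[S] z) := fun z => by
        have := LinearMap.congr_fun (hact α) (1 ⊗ₜ[S] z)
        rwa [LinearMap.baseChange_tmul] at this
      have h2 : (1 : FractionRing S) ⊗ₜ[S] (MulOpposite.op d' • MulOpposite.op d • y) =
          (algebraMap S (FractionRing S) s * c α) • (1 ⊗ₜ[S] (MulOpposite.op d' • y)) := by
        have := congr_arg ((actionMap (S := S) e α d').baseChange (FractionRing S)) (h1 y)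
        rwa [map_smul, LinearMap.baseChange_tmul, LinearMap.baseChange_tmul] at this
      rw [MulOpposite.op_sub, sub_smul, MulOpposite.op_mul, MulOpposite.op_mul, mul_smul, mul_smul,
        TensorProduct.tmul_sub, h1, h2, sub_self]
    refine ⟨(algebraMap S (FractionRing S) s)⁻¹ • (1 ⊗ₜ[S] ⟨d, hcent⟩), ?_⟩
    ext α
    rw [map_smul, Pi.smul_apply, genericCharacterMap_one_tmul, smul_eq_mul,
      inv_mul_eq_iff_eq_mul₀ (algebraMap_fractionRing_ne_zero hs)]
    -- A basis vector stays nonzero in V_α^∞, so the scalar by which d acts can be read off from it.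
    let y := (hD.standard α).some ⟨0, hD.pos α⟩
    have hy : (1 : FractionRing S) ⊗ₜ[S] y ≠ 0 := by
      rw [Ne, one_tmul_eq_zero_iff]
      exact (hD.standard α).some.ne_zero _
    have h1 := LinearMap.congr_fun (hact α) (1 ⊗ₜ[S] y)
    rw [LinearMap.baseChange_tmul, actionMap_apply, hh α ⟨d, hcent⟩ y, TensorProduct.tmul_smul,
      ← algebraMap_smul (FractionRing S), LinearMap.smul_apply, LinearMap.id_apply,
      ← sub_eq_zero, ← sub_smul] at h1
    by_contra hne
    exact hy ((IsUnit.mk0 _ (sub_ne_zero.2 hne)).smul_eq_zero.1 h1)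

include hh in
/-- For `m = n` the four conditions in the definition of malleability are equivalent. -/
theorem IsDeformedQuasiHereditary.malleable_tfae (hmn : ∀ α, m α = n α)
    {σ : Fin (Fintype.card I) ≃ I} (hσ : IsDescending σ) :
    [IsMalleable e h, StandardFiltrationSplits (S := S) e σ,
      Function.Bijective (genericActionMap (S := S) e),
      Function.Bijective (genericCharacterMap h), Function.Injective h].TFAE := by
  tfae_have 1 → 2 := fun H => H.splits σ hσ
  tfae_have 2 → 3 := hD.bijective_of_splits hmn hσ
  tfae_have 3 → 4 := hD.bijective_genericCharacterMap hh
  tfae_have 4 → 5 := injective_of_bijective_genericCharacterMap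
  tfae_have 5 → 1 := fun H => by
    have h1 : Function.Bijective (genericActionMap (S := S) e) :=
      hD.bijective_of_splits hmn hσ (hD.splits_of_injective hh H hσ)
    exact ⟨fun σ' hσ' => hD.splits_of_injective hh H hσ', h1,
      hD.bijective_genericCharacterMap hh h1, H⟩
  tfae_finish

end Malleability

/-! ### The grading of the centre -/

section CenterGrading

open DirectSum

variable {U : Type u} [AddCommGroup U] [Module ℂ U] {D : Type v} [Ring D] [Algebra ℂ D]
  [Algebra (SymmetricAlgebra ℂ U) D] [IsScalarTower ℂ (SymmetricAlgebra ℂ U) D]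
  {𝒟 : ℕ → Submodule ℂ D} [GradedAlgebra 𝒟]

/-- For homogeneous b, compare the components of bζ = ζb in degree k + deg b. -/
lemma decompose_mem_center {S : Type*} [CommRing S] [Algebra S D] {ζ : D}
    (hζ : ζ ∈ Subalgebra.center S D) (k : ℕ) :
    (decompose 𝒟 ζ k : D) ∈ Subalgebra.center S D := by
  refine Subalgebra.mem_center_iff.2 fun b => ?_
  induction b using Decomposition.inductionOn 𝒟 with
  | zero => simp
  | add b b' hb hb' => rw [add_mul, mul_add, hb, hb']
  | @homogeneous j b =>
    rw [← coe_decompose_mul_add_of_left_mem 𝒟 b.2, ← coe_decompose_mul_add_of_right_mem 𝒟 b.2,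
      Subalgebra.mem_center_iff.1 hζ, add_comm]

lemma gradedMonoid_centerGrading :
    SetLike.GradedMonoid (centerGrading (SymmetricAlgebra ℂ U) 𝒟) where
  one_mem := SetLike.one_mem_graded 𝒟
  mul_mem _ _ _ _ hx hy := SetLike.mul_mem_graded (A := 𝒟) hx hy

lemma isInternal_centerGrading :
    DirectSum.IsInternal (centerGrading (SymmetricAlgebra ℂ U) 𝒟) := by
  refine isInternal_submodule_of_iSupIndep_of_iSup_eq_top ?_ (eq_top_iff.2 fun ζ _ => ?_)
  · intro i
    rw [Submodule.disjoint_def]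
    intro ζ hζ hζ'
    have h1 : ⨆ (j) (_ : j ≠ i), centerGrading (SymmetricAlgebra ℂ U) 𝒟 j ≤
        (LinearMap.ker (GradedAlgebra.proj 𝒟 i)).comap
          ((Subalgebra.center (SymmetricAlgebra ℂ U) D).val.restrictScalars ℂ).toLinearMap :=
      iSup₂_le fun j hj ξ hξ => decompose_of_mem_ne 𝒟 hξ hj
    have h2 : (decompose 𝒟 (ζ : D) i : D) = 0 := h1 hζ'
    exact Subtype.ext ((decompose_of_mem_same 𝒟 hζ).symm.trans h2)
  · classical
    have h1 : ζ = ∑ k ∈ (decompose 𝒟 (ζ : D)).support,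
        (⟨decompose 𝒟 (ζ : D) k, decompose_mem_center ζ.2 k⟩ :
          Subalgebra.center (SymmetricAlgebra ℂ U) D) := by
      refine Subtype.ext ?_
      rw [AddSubmonoidClass.coe_finsetSum]
      exact (sum_support_decompose 𝒟 (ζ : D)).symm
    rw [h1]
    exact sum_mem fun k _ => Submodule.mem_iSup_of_mem k (decompose 𝒟 (ζ : D) k).2

variable [FiniteDimensional ℂ U]

variable (U) in
lemma isNoetherianRing_symmetricAlgebra : IsNoetherianRing (SymmetricAlgebra ℂ U) :=
  isNoetherianRing_of_ringEquiv _
    (SymmetricAlgebra.equivMvPolynomial (Module.finBasis ℂ U)).symm.toRingEquiv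

lemma finite_center (S : Type*) (D : Type*) [CommRing S] [IsNoetherianRing S] [Ring D] [Algebra S D]
    [Module.Finite S D] : Module.Finite S (Subalgebra.center S D) :=
  inferInstanceAs (Module.Finite S (Subalgebra.toSubmodule (Subalgebra.center S D)))

theorem isLocalizationAlgebra_centerGrading {I : Type w} [Fintype I]
    [Module.Finite (SymmetricAlgebra ℂ U) D]
    (hι : ∀ u : U, algebraMap (SymmetricAlgebra ℂ U) D (SymmetricAlgebra.ι ℂ U u) ∈ 𝒟 2)
    (h : Subalgebra.center (SymmetricAlgebra ℂ U) D →ₐ[SymmetricAlgebra ℂ U]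
      (I → SymmetricAlgebra ℂ U)) :
    IsLocalizationAlgebra (centerGrading (SymmetricAlgebra ℂ U) 𝒟) h := by
  have := isNoetherianRing_symmetricAlgebra U
  have := finite_center (SymmetricAlgebra ℂ U) D
  exact ⟨inferInstance, inferInstance, gradedMonoid_centerGrading, isInternal_centerGrading,
    fun u k z hz => iota_smul_mem 𝒟 hι u hz⟩

end CenterGrading

/-! ### Freeness of the centre -/

section Rank

variable {S : Type v} [CommRing S] [IsDomain S] {D : Type w} [Ring D] [Algebra S D]
  [Module.IsTorsionFree S D]

/-- The centre is saturated in a torsion-free algebra, so a rank comparison can identify it with a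
larger submodule. -/
lemma mem_center_of_smul_mem {s : S} (hs : s ≠ 0) {d : D} (h : s • d ∈ Subalgebra.center S D) :
    d ∈ Subalgebra.center S D := by
  refine Subalgebra.mem_center_iff.2 fun b => ?_
  have h1 := Subalgebra.mem_center_iff.1 h b
  rw [mul_smul_comm, smul_mul_assoc] at h1
  exact smul_right_injective D hs h1

lemma finrank_center_eq {I : Type u} [Fintype I] {h : I → (Subalgebra.center S D →ₐ[S] S)}
    (hb : Function.Bijective (genericCharacterMap h)) :
    Module.finrank S (Subalgebra.center S D) = Fintype.card I := by
  rw [← IsLocalizedModule.finrank_eq (nonZeroDivisors S)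
    (TensorProduct.mk S (FractionRing S) (Subalgebra.center S D) 1) le_rfl,
    ← IsFractionRing.finrank_right_eq S (FractionRing S),
    (LinearEquiv.ofBijective _ hb).finrank_eq, Module.finrank_fintype_fun_eq_card]

/-- A linear map that kills the centre and has sufficiently large rank has kernel the centre. -/
lemma mem_center_of_apply_eq_zero [Module.Finite S D] [IsNoetherianRing S] {p : ℕ}
    (hr : Module.finrank S D ≤ p + Module.finrank S (Subalgebra.center S D))
    (ψ : D →ₗ[S] (Fin p → S)) (hψ : ∀ ζ ∈ Subalgebra.center S D, ψ ζ = 0)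
    (x : Fin p → D) (hx : LinearIndependent S (fun i => ψ (x i))) {y : D} (hy : ψ y = 0) :
    y ∈ Subalgebra.center S D := by
  let Z := Subalgebra.toSubmodule (Subalgebra.center S D)
  let N := LinearMap.ker ψ
  have hZN : Z ≤ N := fun ζ hζ => hψ ζ hζ
  have h1 : p ≤ Module.finrank S (LinearMap.range ψ) := by
    have h2 : LinearIndependent S (fun i => (⟨ψ (x i), x i, rfl⟩ : LinearMap.range ψ)) :=
      LinearIndependent.of_comp (LinearMap.range ψ).subtype hx
    simpa using h2.fintype_card_le_finrank
  have h2 := N.finrank_quotient_add_finrank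
  rw [ψ.quotKerEquivRange.finrank_eq] at h2
  have h3 := Submodule.finrank_quotient_add_finrank (Z.submoduleOf N)
  have h4 : Module.finrank S (Z.submoduleOf N) = Module.finrank S (Subalgebra.center S D) :=
    (Submodule.submoduleOfEquivOfLe hZN).finrank_eq
  -- The range of ψ has rank at least p, so its kernel has rank at most that of the centre. The
  -- quotient of the kernel by the centre therefore has rank zero, i.e. is torsion.
  have h5 : Module.finrank S (N ⧸ Z.submoduleOf N) = 0 := by
    omega
  have h6 : Module.rank S (N ⧸ Z.submoduleOf N) = 0 := by
    rw [← Module.finrank_eq_rank, h5, Nat.cast_zero]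
  obtain ⟨t, ht, h7⟩ := rank_eq_zero_iff.1 h6 (Submodule.Quotient.mk ⟨y, hy⟩)
  exact mem_center_of_smul_mem ht ((Submodule.Quotient.mk_eq_zero _).1 h7)

end Rank

section FreeCenter

open DirectSum

variable {U : Type u} [AddCommGroup U] [Module ℂ U] {D : Type v} [Ring D] [Algebra ℂ D]
  [Algebra (SymmetricAlgebra ℂ U) D] [IsScalarTower ℂ (SymmetricAlgebra ℂ U) D]
  {𝒟 : ℕ → Submodule ℂ D} [GradedAlgebra 𝒟]
  (hι : ∀ u : U, algebraMap (SymmetricAlgebra ℂ U) D (SymmetricAlgebra.ι ℂ U u) ∈ 𝒟 2)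
  {A : Type w} [Ring A] [Algebra ℂ A] {π : D →ₐ[ℂ] A} (hsurj : Function.Surjective π)
  (hker : RingHom.ker π = Ideal.span
    (Set.range fun u : U => algebraMap (SymmetricAlgebra ℂ U) D (SymmetricAlgebra.ι ℂ U u)))

include hsurj in
lemma map_mem_center {S : Type*} [CommRing S] [Algebra S D] {ζ : D}
    (hζ : ζ ∈ Subalgebra.center S D) : π ζ ∈ Subalgebra.center ℂ A := by
  refine Subalgebra.mem_center_iff.2 fun a => ?_
  obtain ⟨d, rfl⟩ := hsurj a
  rw [← map_mul, ← map_mul, Subalgebra.mem_center_iff.1 hζ]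

include hsurj hker in
/-- A linear map that kills the centre of `D` and restricts to an isomorphism, up to a scalar
specializing to `1`, on lifts of elements of `A` that are independent modulo the centre. -/
lemma exists_linearMap_det_eq_one {β : Type*} [Finite β]
    (b : Module.Basis β (SymmetricAlgebra ℂ U) D) {p : ℕ} (x : Fin p → D)
    (hx : LinearIndependent ℂ
      (fun i => (Subalgebra.toSubmodule (Subalgebra.center ℂ A)).mkQ (π (x i)))) :
    ∃ ψ : D →ₗ[SymmetricAlgebra ℂ U] (Fin p → SymmetricAlgebra ℂ U),
      (∀ ζ ∈ Subalgebra.center (SymmetricAlgebra ℂ U) D, ψ ζ = 0) ∧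
      SymmetricAlgebra.algebraMapInv (Matrix.of fun i => ψ (x i)).det = (1 : ℂ) := by
  classical
  have := Fintype.ofFinite β
  -- The matrix collects the coordinates of the commutators [x_i, b_k]. A relation between its
  -- specialized rows says that a combination of the π(x_i) commutes with every π(b_k), hence is
  -- central, hence is trivial modulo the centre.
  obtain ⟨c, hc⟩ := exists_det_eq_one SymmetricAlgebra.algebraMapInv
    (Matrix.of fun (i : Fin p) (kl : β × β) => b.repr (x i * b kl.1 - b kl.1 * x i) kl.2)
    (fun r hr => by
      refine funext (Fintype.linearIndependent_iff.1 hx r ?_)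
      have hb : ∀ k, π (b k) * ∑ i, r i • π (x i) = (∑ i, r i • π (x i)) * π (b k) := by
        intro k
        rw [← sub_eq_zero, Finset.mul_sum, Finset.sum_mul, ← Finset.sum_sub_distrib,
          ← neg_eq_zero, ← Finset.sum_neg_distrib]
        have h1 : ∀ i, -(π (b k) * r i • π (x i) - r i • π (x i) * π (b k)) =
            ∑ l, (r i * SymmetricAlgebra.algebraMapInv
              (b.repr (x i * b k - b k * x i) l)) • π (b l) := by
          intro i
          have h2 := congr_arg π (b.sum_repr (x i * b k - b k * x i))
          rw [map_sum] at h2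
          simp_rw [map_smul_of_ker hker] at h2
          simp_rw [mul_smul, ← Finset.smul_sum]
          rw [h2, map_sub, map_mul, map_mul, neg_sub, smul_sub, mul_smul_comm, smul_mul_assoc]
        simp_rw [h1]
        rw [Finset.sum_comm]
        refine Finset.sum_eq_zero fun l _ => ?_
        rw [← Finset.sum_smul]
        have h3 : ∑ i, r i * SymmetricAlgebra.algebraMapInv
            (b.repr (x i * b k - b k * x i) l) = 0 := congr_fun hr (k, l)
        rw [h3, zero_smul]
      have h1 : ∑ i, r i • π (x i) ∈ Subalgebra.toSubmodule (Subalgebra.center ℂ A) := by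
        refine (Subalgebra.mem_center_iff (R := ℂ)).2 fun a => ?_
        obtain ⟨d, rfl⟩ := hsurj a
        rw [← b.sum_repr d, map_sum, Finset.sum_mul, Finset.mul_sum]
        refine Finset.sum_congr rfl fun k _ => ?_
        rw [map_smul_of_ker hker, smul_mul_assoc, hb, mul_smul_comm]
      rw [← Submodule.Quotient.mk_eq_zero (Subalgebra.toSubmodule (Subalgebra.center ℂ A)),
        ← Submodule.mkQ_apply, map_sum] at h1
      simpa only [map_smul] using h1)
  refine ⟨LinearMap.pi fun j => ∑ kl : β × β, algebraMap ℂ (SymmetricAlgebra ℂ U) (c kl j) •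
    (b.coord kl.2 ∘ₗ (LinearMap.mulRight (SymmetricAlgebra ℂ U) (b kl.1) -
      LinearMap.mulLeft (SymmetricAlgebra ℂ U) (b kl.1))), fun ζ hζ => ?_, ?_⟩
  · ext j
    simp [Subalgebra.mem_center_iff.1 hζ]
  · rw [← hc]
    congr 2
    ext i j
    simp [Matrix.mul_apply, Algebra.smul_def, mul_comm]

include hsurj hker in
-- Cramer's rule: for a lift d of a, det·d minus a suitable combination of the x_i is annihilated by
-- ψ, hence central. Its image is a minus a combination of the π(x_i); as both it and a are central,
-- independence modulo the centre makes the combination vanish.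
lemma exists_mem_center_map_eq {p : ℕ} (x : Fin p → D)
    (hx : LinearIndependent ℂ
      (fun i => (Subalgebra.toSubmodule (Subalgebra.center ℂ A)).mkQ (π (x i))))
    (ψ : D →ₗ[SymmetricAlgebra ℂ U] (Fin p → SymmetricAlgebra ℂ U))
    (hdet : SymmetricAlgebra.algebraMapInv (Matrix.of fun i => ψ (x i)).det = (1 : ℂ))
    (hψ : ∀ y, ψ y = 0 → y ∈ Subalgebra.center (SymmetricAlgebra ℂ U) D) {a : A}
    (ha : a ∈ Subalgebra.center ℂ A) :
    ∃ ζ ∈ Subalgebra.center (SymmetricAlgebra ℂ U) D, π ζ = a := by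
  obtain ⟨d, rfl⟩ := hsurj a
  set G := Matrix.of fun i => ψ (x i) with hG
  set s := Matrix.vecMul (ψ d) G.adjugate with hs
  have h1 : ∑ i, s i • ψ (x i) = G.det • ψ d := by
    have h2 : Matrix.vecMul s G = G.det • ψ d := by
      rw [hs, Matrix.vecMul_vecMul, Matrix.adjugate_mul, Matrix.vecMul_smul, Matrix.vecMul_one]
    rw [← h2, Matrix.vecMul_eq_sum]
    rfl
  have hy : G.det • d - ∑ i, s i • x i ∈ Subalgebra.center (SymmetricAlgebra ℂ U) D := by
    refine hψ _ ?_
    rw [map_sub, map_smul, map_sum]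
    simp_rw [map_smul]
    rw [h1, sub_self]
  refine ⟨_, hy, ?_⟩
  have h2 : π (G.det • d - ∑ i, s i • x i) =
      π d - ∑ i, (SymmetricAlgebra.algebraMapInv (s i) : ℂ) • π (x i) := by
    rw [map_sub, map_sum, map_smul_of_ker hker, hdet, one_smul]
    simp_rw [map_smul_of_ker hker]
  have h3 := Subalgebra.sub_mem _ ha (map_mem_center hsurj hy)
  rw [h2, sub_sub_cancel] at h3
  have h4 := Fintype.linearIndependent_iff.1 hx (fun i => SymmetricAlgebra.algebraMapInv (s i)) (by
    have h5 := (Submodule.Quotient.mk_eq_zero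
      (Subalgebra.toSubmodule (Subalgebra.center ℂ A))).2 h3
    rw [← Submodule.mkQ_apply, map_sum] at h5
    simpa only [map_smul] using h5)
  rw [h2]
  simp [h4]

include hsurj in
lemma exists_homogeneous_lift_center [FiniteDimensional ℂ A] {S : Type*} [CommRing S] [Algebra S D]
    (h : ∀ a ∈ Subalgebra.center ℂ A, ∃ ζ ∈ Subalgebra.center S D, π ζ = a) :
    ∃ (n : ℕ) (z : Fin n → D), (∀ i, z i ∈ Subalgebra.center S D) ∧ (∀ i, ∃ k, z i ∈ 𝒟 k) ∧
      LinearIndependent ℂ (fun i => π (z i)) ∧ Submodule.span ℂ (Set.range fun i => π (z i)) =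
        Subalgebra.toSubmodule (Subalgebra.center ℂ A) := by
  let s : Set A := {y | ∃ k, ∃ ζ ∈ 𝒟 k, ζ ∈ Subalgebra.center S D ∧ π ζ = y}
  have hs : Submodule.span ℂ s = Subalgebra.toSubmodule (Subalgebra.center ℂ A) := by
    refine le_antisymm (Submodule.span_le.2 ?_) fun a ha => ?_
    · rintro _ ⟨k, ζ, -, hζ, rfl⟩
      exact map_mem_center hsurj hζ
    · obtain ⟨ζ, hζ, rfl⟩ := h a ha
      classical
      rw [← sum_support_decompose 𝒟 ζ, map_sum]
      exact sum_mem fun k _ => Submodule.subset_span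
        ⟨k, _, (decompose 𝒟 ζ k).2, decompose_mem_center hζ k, rfl⟩
  have hex := Submodule.exists_fun_fin_finrank_span_eq ℂ s
  obtain ⟨f, hf, hfs, hfi⟩ := hex
  choose k z hzk hz hπ using hf
  refine ⟨_, z, hz, fun i => ⟨k i, hzk i⟩, ?_, ?_⟩
  · simpa only [hπ] using hfi
  · rw [← hs]
    simpa only [hπ] using hfs

include hι hsurj hker in
/-- If the centres of `D` and `A` have the same rank then the centre of `D` is free. -/
theorem free_center [FiniteDimensional ℂ U] [FiniteDimensional ℂ A]
    [Module.Flat (SymmetricAlgebra ℂ U) D] [Module.Finite (SymmetricAlgebra ℂ U) D]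
    [Module.Free (SymmetricAlgebra ℂ U) D]
    (hDA : Module.finrank (SymmetricAlgebra ℂ U) D ≤ Module.finrank ℂ A)
    (hr : Module.finrank ℂ (Subalgebra.center ℂ A) = Module.finrank (SymmetricAlgebra ℂ U)
      (Subalgebra.center (SymmetricAlgebra ℂ U) D)) :
    Module.Free (SymmetricAlgebra ℂ U) (Subalgebra.center (SymmetricAlgebra ℂ U) D) := by
  have := isNoetherianRing_symmetricAlgebra U
  let Z := Subalgebra.toSubmodule (Subalgebra.center ℂ A)
  obtain ⟨x, hxk, hxi, hxs⟩ := exists_homogeneous_lift hsurj 𝒟 Z.mkQ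
  obtain ⟨ψ, hψ, hdet⟩ := exists_linearMap_det_eq_one hsurj hker
    (Module.Free.chooseBasis (SymmetricAlgebra ℂ U) D) x hxi
  have hψx : LinearIndependent (SymmetricAlgebra ℂ U) (fun i => ψ (x i)) :=
    Matrix.linearIndependent_rows_of_det_ne_zero (A := Matrix.of fun i => ψ (x i))
      (fun h0 => by simp [h0] at hdet)
  have hcenter : ∀ y, ψ y = 0 → y ∈ Subalgebra.center (SymmetricAlgebra ℂ U) D := by
    -- Here p is the codimension of Z(A) in A, and the rank of Z(D) equals dim Z(A), so the required
    -- bound is rank D ≤ dim A.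
    refine fun y hy => mem_center_of_apply_eq_zero ?_ ψ hψ x hψx hy
    rw [← hr, LinearMap.range_eq_top.2 Z.mkQ_surjective, finrank_top]
    exact hDA.trans (Submodule.finrank_quotient_add_finrank Z).ge
  obtain ⟨n, z, hz, hzk, hzi, hzs⟩ := exists_homogeneous_lift_center (𝒟 := 𝒟) hsurj
    (fun a ha => exists_mem_center_map_eq hsurj hker x hxi ψ hdet hcenter ha)
  -- The images of the z_i and x_i span Z(A) and a complement, so Nakayama gives generation of D.
  have htop : ∀ d, d ∈ Submodule.span (SymmetricAlgebra ℂ U) (Set.range z) ⊔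
      Submodule.span (SymmetricAlgebra ℂ U) (Set.range x) := by
    refine apply_mem_of_map_mem hι hker LinearMap.id (fun k x hx => hx) (fun _ => rfl) _
      (sup_le_homogeneousCore hι (span_le_homogeneousCore hι ?_) (span_le_homogeneousCore hι ?_))
      (fun n hn => hn) fun k d _ => ?_
    · rintro _ ⟨i, rfl⟩
      exact hzk i
    · rintro _ ⟨i, rfl⟩
      exact hxk i
    · have h1 : Z.mkQ (π d) ∈ LinearMap.range Z.mkQ := ⟨_, rfl⟩
      rw [← hxs] at h1
      obtain ⟨c, hc⟩ := (Submodule.mem_span_range_iff_exists_fun ℂ).1 h1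
      have h2 : π d - ∑ i, c i • π (x i) ∈ Z := by
        rw [← Submodule.Quotient.mk_eq_zero, ← Submodule.mkQ_apply, map_sub, ← hc, map_sum]
        simp_rw [map_smul]
        rw [sub_self]
      change _ ∈ Subalgebra.toSubmodule (Subalgebra.center ℂ A) at h2
      rw [← hzs] at h2
      obtain ⟨c', hc'⟩ := (Submodule.mem_span_range_iff_exists_fun ℂ).1 h2
      refine ⟨∑ i, algebraMap ℂ (SymmetricAlgebra ℂ U) (c' i) • z i +
        ∑ i, algebraMap ℂ (SymmetricAlgebra ℂ U) (c i) • x i, Submodule.add_mem_sup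
        (sum_mem fun i _ => Submodule.smul_mem _ _ (Submodule.subset_span ⟨i, rfl⟩))
        (sum_mem fun i _ => Submodule.smul_mem _ _ (Submodule.subset_span ⟨i, rfl⟩)), ?_⟩
      simp_rw [algebraMap_smul]
      rw [map_add, map_sum, map_sum]
      simp_rw [map_smul]
      rw [hc', sub_add_cancel]
      rfl
  have hind : LinearIndependent (SymmetricAlgebra ℂ U) z := linearIndependent_of_flat
    (ev := SymmetricAlgebra.algebraMapInv) (π := π.toLinearMap.toAddMonoidHom)
    (fun s d => map_smul_of_ker hker s d) z hzi
  refine Module.Free.of_basis (Module.Basis.mk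
    (v := fun i => (⟨z i, hz i⟩ : Subalgebra.center (SymmetricAlgebra ℂ U) D))
    (LinearIndependent.of_comp (Subalgebra.center (SymmetricAlgebra ℂ U) D).val.toLinearMap hind)
    fun ζ _ => ?_)
  obtain ⟨y, hy, y', hy', hyy⟩ := Submodule.mem_sup.1 (htop ζ)
  obtain ⟨c, rfl⟩ := (Submodule.mem_span_range_iff_exists_fun _).1 hy
  obtain ⟨c', rfl⟩ := (Submodule.mem_span_range_iff_exists_fun _).1 hy'
  -- ψ annihilates ζ and all z_i, so the part of ζ along the x_i disappears and the z_i alone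
  -- generate the centre.
  have h1 : ∑ i, c' i • ψ (x i) = 0 := by
    have h2 := congr_arg ψ hyy
    rw [hψ _ ζ.2, map_add, map_sum, map_sum] at h2
    simp_rw [map_smul, hψ _ (hz _), smul_zero, Finset.sum_const_zero, zero_add] at h2
    exact h2
  have h2 := Fintype.linearIndependent_iff.1 hψx c' h1
  refine (Submodule.mem_span_range_iff_exists_fun _).2 ⟨c, Subtype.ext ?_⟩
  rw [← hyy, AddSubmonoidClass.coe_finsetSum]
  simp [h2]

end FreeCenter

/-! ### Anti-automorphisms -/

section AntiAutomorphism

variable {I : Type u} [Fintype I] [PartialOrder I] {k : Type v} [CommRing k] {B : Type w} [Ring B]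
  [Algebra k B] {e : I → B}

/-- An anti-automorphism that fixes the idempotents identifies rows and columns. -/
lemma finrank_range_columnMk_eq (τ : B ≃ₐ[k] Bᵐᵒᵖ)
    (hτ : ∀ α, τ (e α) = MulOpposite.op (e α)) (α : I) :
    Module.finrank k (LinearMap.range (columnMk (e := e) k α)) =
      Module.finrank k (LinearMap.range (rowMk (e := e) k α)) := by
  let f : B ≃ₗ[k] B := τ.toLinearEquiv.trans (MulOpposite.opLinearEquiv k).symm
  have hf : ∀ a b, f (a * b) = f b * f a := fun a b => congr_arg MulOpposite.unop (map_mul τ a b)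
  have he : ∀ α, f (e α) = e α := fun α => congr_arg MulOpposite.unop (hτ α)
  have hT : (traceSpan k e {γ | α < γ}).map (f : B →ₗ[k] B) = traceSpan k e {γ | α < γ} := by
    rw [traceSpan, Submodule.map_span]
    congr 1
    ext x
    constructor
    · rintro ⟨_, ⟨a, b, γ, hγ, rfl⟩, rfl⟩
      exact ⟨f b, f a, γ, hγ, by simp [hf, he, mul_assoc]⟩
    · rintro ⟨a, b, γ, hγ, rfl⟩
      exact ⟨_, ⟨f.symm b, f.symm a, γ, hγ, rfl⟩, by simp [hf, he, mul_assoc]⟩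
  let g := Submodule.Quotient.equiv _ _ f hT
  have h1 : (g : _ →ₗ[k] _) ∘ₗ rowMk (e := e) k α = columnMk (e := e) k α ∘ₗ (f : B →ₗ[k] B) := by
    ext b
    simp [g, rowMk, columnMk, hf, he]
  have h2 : LinearMap.range (columnMk (e := e) k α) =
      (LinearMap.range (rowMk (e := e) k α)).map (g : _ →ₗ[k] _) := by
    rw [← LinearMap.range_comp, h1, LinearMap.range_comp, LinearEquiv.range, Submodule.map_top]
  rw [h2]
  exact LinearEquiv.finrank_map_eq g _

end AntiAutomorphism

/-! ### Quadratic algebras and their deformations -/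

section Quadratic

variable {I : Type u} [Fintype I] [DecidableEq I]
  {M : Type v} [AddCommGroup M] [Module ℂ M] [Module (I → ℂ) M] [Module (I → ℂ)ᵐᵒᵖ M]

namespace BimoduleTensorAlgebra

lemma ofR_mul (r s : I → ℂ) : ofR I M r * ofR I M s = ofR I M (r * s) := by
  have := RingQuot.mkAlgHom_rel ℂ (BimoduleTensorRel.mul (M := M) r s)
  rwa [map_mul] at this

lemma ofR_mul_mem_degree (r : I → ℂ) {k : ℕ} {x : BimoduleTensorAlgebra I M}
    (hx : x ∈ degree I M k) : ofR I M r * x ∈ degree I M k := by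
  induction hx using Submodule.mul_induction_on' with
  | mem_mul_mem y hy z hz =>
    obtain ⟨s, rfl⟩ := hy
    rw [← mul_assoc, ofR_mul]
    exact Submodule.mul_mem_mul ⟨_, rfl⟩ hz
  | add x _ y _ hx hy => rw [mul_add]; exact add_mem hx hy

variable (I M) in
/-- The projection `T_R(M) → R` onto the degree zero part. -/
noncomputable def augmentation : BimoduleTensorAlgebra I M →ₐ[ℂ] (I → ℂ) :=
  RingQuot.liftAlgHom ℂ ⟨TensorAlgebra.lift ℂ (LinearMap.fst ℂ (I → ℂ) M), fun x y h => by
    cases h <;> simp⟩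

lemma augmentation_ofR (r : I → ℂ) : augmentation I M (ofR I M r) = r := by
  simp [augmentation, ofR]

lemma augmentation_ofM (m : M) : augmentation I M (ofM I M m) = 0 := by
  simp [augmentation, ofM]

lemma augmentation_eq_zero {k : ℕ} {x : BimoduleTensorAlgebra I M}
    (hx : x ∈ degree I M (k + 1)) : augmentation I M x = 0 := by
  have h1 : degree I M (k + 1) ≤ LinearMap.ker (augmentation I M).toLinearMap := by
    rw [degree, pow_succ, ← mul_assoc]
    refine Submodule.mul_le.2 ?_
    rintro y - _ ⟨m, rfl⟩
    rw [LinearMap.mem_ker, AlgHom.toLinearMap_apply, map_mul, augmentation_ofM, mul_zero]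
  exact h1 hx

end BimoduleTensorAlgebra

variable {W : Submodule ℂ (BimoduleTensorAlgebra I M)}

lemma QuadAlgebra.idem_mul_mem_degree (α : I) (k : ℕ) :
    ∀ x ∈ degree W k, idem W α * x ∈ degree W k := by
  rintro _ ⟨x, hx, rfl⟩
  exact ⟨_, BimoduleTensorAlgebra.ofR_mul_mem_degree (Pi.single α 1) hx, map_mul (mk W) _ _⟩

lemma QuadAlgebra.degree_zero_le : degree W 0 ≤ Submodule.span ℂ (Set.range (idem W)) := by
  rintro _ ⟨x, hx, rfl⟩
  rw [BimoduleTensorAlgebra.degree, pow_zero, mul_one] at hx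
  obtain ⟨r, rfl⟩ := hx
  change ofR W r ∈ _
  rw [pi_eq_sum_univ' r, map_sum]
  refine sum_mem fun α _ => ?_
  rw [map_smul]
  refine Submodule.smul_mem _ _ (Submodule.subset_span ⟨α, ?_⟩)
  rw [idem]

/-- The relations have degree two, so the augmentation T_R(M) → R descends to A. Its coordinate at α
is 1 on e_α and 0 on the trace of the e_γ with γ ≠ α. -/
lemma QuadAlgebra.idem_notMem_traceSpan [PartialOrder I] (hW : IsQuadraticRelations W) (α : I) :
    idem W α ∉ traceSpan ℂ (idem W) {γ | α < γ} := by
  let ε : QuadAlgebra W →ₐ[ℂ] (I → ℂ) :=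
    RingQuot.liftAlgHom ℂ ⟨BimoduleTensorAlgebra.augmentation I M, fun x y h => by
      rw [h.2, map_zero, BimoduleTensorAlgebra.augmentation_eq_zero (hW.le_degree_two h.1)]⟩
  have hε : ∀ γ, ε (idem W γ) = Pi.single γ 1 := by
    intro γ
    have h1 := BimoduleTensorAlgebra.augmentation_ofR (M := M) (Pi.single γ (1 : ℂ))
    rw [← h1]
    exact RingQuot.liftAlgHom_mkAlgHom_apply _ _ _ _
  intro h
  have h1 : ∀ x ∈ traceSpan ℂ (idem W) {γ | α < γ}, ε x α = 0 := by
    intro x hx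
    induction hx using Submodule.span_induction with
    | mem x hx =>
      obtain ⟨a, b, γ, hγ, rfl⟩ := hx
      have h2 : α ≠ γ := ne_of_lt hγ
      simp [hε, h2]
    | zero => simp
    | add x y _ _ hx hy => rw [map_add, Pi.add_apply, hx, hy, add_zero]
    | smul r x _ hx => rw [map_smul, Pi.smul_apply, hx, smul_zero]
  have h2 := h1 _ h
  simp [hε] at h2

variable {U : Type*} [AddCommGroup U] [Module ℂ U] {D : Type*} [Ring D] [Algebra ℂ D]
  [Algebra (SymmetricAlgebra ℂ U) D] {𝒟 : ℕ → Submodule ℂ D} (𝔇 : GradedDeformation W U D 𝒟)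

namespace GradedDeformation

lemma completeOrthogonalIdempotents : CompleteOrthogonalIdempotents 𝔇.idem :=
  (CompleteOrthogonalIdempotents.single (fun _ : I => ℂ)).map 𝔇.ofR.toRingHom

lemma π_idem (α : I) : 𝔇.π (𝔇.idem α) = QuadAlgebra.idem W α := 𝔇.π_ofR _

include 𝔇 in
lemma completeOrthogonalIdempotents_idem : CompleteOrthogonalIdempotents (QuadAlgebra.idem W) := by
  have h1 : QuadAlgebra.idem W = 𝔇.π.toRingHom ∘ 𝔇.idem := funext fun α => (𝔇.π_idem α).symm
  rw [h1]
  exact 𝔇.completeOrthogonalIdempotents.map 𝔇.π.toRingHom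

include 𝔇 in
lemma mem_span_idem_sup [GradedAlgebra 𝒟] (b : QuadAlgebra W) :
    b ∈ Submodule.span ℂ (Set.range (QuadAlgebra.idem W)) ⊔
      Submodule.span ℂ {x | ∃ k, 0 < k ∧ x ∈ QuadAlgebra.degree W k} := by
  obtain ⟨d, rfl⟩ := 𝔇.π_surjective b
  induction d using DirectSum.Decomposition.inductionOn 𝒟 with
  | zero => simp
  | add x y hx hy => rw [map_add]; exact add_mem hx hy
  | @homogeneous k x =>
    have hx := 𝔇.π_mem k x x.2
    obtain rfl | hk := Nat.eq_zero_or_pos k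
    · exact Submodule.mem_sup_left (QuadAlgebra.degree_zero_le hx)
    · exact Submodule.mem_sup_right (Submodule.subset_span ⟨k, hk, hx⟩)

end GradedDeformation

end Quadratic

end KoszulCenter

/-! ### The main theorem -/

open KoszulCenter
theorem mainTheorem11
    {I : Type*} [Fintype I] [DecidableEq I] [PartialOrder I]
    {M : Type*} [AddCommGroup M] [Module ℂ M] [Module (I → ℂ) M] [Module (I → ℂ)ᵐᵒᵖ M]
    [IsScalarTower ℂ (I → ℂ) M] [IsScalarTower ℂ (I → ℂ)ᵐᵒᵖ M]
    [SMulCommClass (I → ℂ) (I → ℂ)ᵐᵒᵖ M] [FiniteDimensional ℂ M]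
    (W : Submodule ℂ (BimoduleTensorAlgebra I M)) (hW : IsQuadraticRelations W)
    (hA : IsStandardKoszul (QuadAlgebra.idem W) (QuadAlgebra.degree W))
    {U : Type*} [AddCommGroup U] [Module ℂ U] [FiniteDimensional ℂ U]
    {D : Type*} [Ring D] [Algebra ℂ D] [Algebra (SymmetricAlgebra ℂ U) D]
    [IsScalarTower ℂ (SymmetricAlgebra ℂ U) D]
    (𝒟 : ℕ → Submodule ℂ D) [GradedAlgebra 𝒟]
    (𝔇 : GradedDeformation W U D 𝒟) [Module.Flat (SymmetricAlgebra ℂ U) D] :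
    ∃ h : I → (Subalgebra.center (SymmetricAlgebra ℂ U) D →ₐ[SymmetricAlgebra ℂ U]
        SymmetricAlgebra ℂ U),
      (IsCentralCharacters 𝔇.idem h ∧ ∀ h', IsCentralCharacters 𝔇.idem h' → h' = h) ∧
      IsLocalizationAlgebra (centerGrading (SymmetricAlgebra ℂ U) 𝒟)
        (AlgHom.pi h) ∧
      ((∃ τ : QuadAlgebra W ≃ₐ[ℂ] (QuadAlgebra W)ᵐᵒᵖ,
          ∀ r, τ (QuadAlgebra.ofR W r) = MulOpposite.op (QuadAlgebra.ofR W r)) →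
        (IsStrongLocalizationAlgebra (centerGrading (SymmetricAlgebra ℂ U) 𝒟)
            (AlgHom.pi h) ↔
          IsMalleable 𝔇.idem h) ∧
        ∀ σ : Fin (Fintype.card I) ≃ I, IsDescending σ →
          [IsMalleable 𝔇.idem h,
            StandardFiltrationSplits (S := SymmetricAlgebra ℂ U) 𝔇.idem σ,
            Function.Bijective (genericActionMap (S := SymmetricAlgebra ℂ U) 𝔇.idem),
            Function.Bijective (genericCharacterMap h),
            Function.Injective h].TFAE) ∧
      (IsMalleable 𝔇.idem h →
        Module.finrank ℂ (Subalgebra.center ℂ (QuadAlgebra W)) = Fintype.card I →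
        IsFreeLocalizationAlgebra (centerGrading (SymmetricAlgebra ℂ U) 𝒟)
          (AlgHom.pi h)) := by
  classical
  have := hA.finite
  have heA := 𝔇.completeOrthogonalIdempotents_idem
  have hdiag := hA.quasiHereditary.exists_smul_idem_sub_mem heA 𝔇.mem_span_idem_sup
    QuadAlgebra.idem_mul_mem_degree
  have hup := hA.quasiHereditary.idem_mul_mul_idem_mem heA.toOrthogonalIdempotents hdiag
  have hsum := hA.quasiHereditary.sum_le_finrank heA hdiag
  have hD := isDeformedQuasiHereditary 𝔇.ι_mem 𝔇.π_surjective 𝔇.ker_π 𝔇.π_idem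
    𝔇.completeOrthogonalIdempotents (fun α => 𝔇.ofR_mem _) hup hdiag heA.toOrthogonalIdempotents
    (QuadAlgebra.idem_notMem_traceSpan hW) hsum
  have := hD.finite
  have := hD.free
  have := hD.isTorsionFree
  have := isNoetherianRing_symmetricAlgebra U
  obtain ⟨h, hh, huniq⟩ := hD.exists_isCentralCharacters
  have hloc := isLocalizationAlgebra_centerGrading (𝒟 := 𝒟) 𝔇.ι_mem (AlgHom.pi h)
  refine ⟨h, ⟨hh, huniq⟩, hloc, ?_, fun hmall hcard => ?_⟩
  · rintro ⟨τ, hτ⟩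
    -- The anti-automorphism exchanges rows and columns, giving m = n.
    have hmn : ∀ α, Module.finrank ℂ (LinearMap.range (columnMk (e := QuadAlgebra.idem W) ℂ α)) =
        Module.finrank ℂ (Standard (QuadAlgebra.idem W) α) := fun α =>
      (finrank_range_columnMk_eq τ (fun γ => hτ (Pi.single γ 1)) α).trans
        (finrank_range_rowMk heA.toOrthogonalIdempotents (hup α))
    refine ⟨⟨fun H => ?_, fun H => ?_⟩, fun σ hσ => hD.malleable_tfae hh hmn hσ⟩
    · obtain ⟨σ, hσ⟩ := exists_isDescending (I := I)
      exact ((hD.malleable_tfae hh hmn hσ).out 3 0).1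
        ((isTorsion_and_isTorsion_iff h).1 ⟨H.torsion_ker, H.torsion_coker⟩)
    · obtain ⟨h1, h2⟩ := (isTorsion_and_isTorsion_iff h).2 H.character_bijective
      exact ⟨hloc, h1, h2⟩
  · have hrank := finrank_center_eq hmall.character_bijective
    -- The rank Σ m_α n_α of D is at most dim A by reciprocity, and malleability gives Z(D) rank |I|
    -- = dim Z(A).
    have := free_center 𝔇.ι_mem 𝔇.π_surjective 𝔇.ker_π (hD.finrank_eq.trans_le hsum)
      (hcard.trans hrank.symm)
    have := finite_center (SymmetricAlgebra ℂ U) D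
    exact ⟨hloc, inferInstance, by rw [← Module.finrank_eq_rank, hrank]⟩
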